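/- **Theorem (regularization property of the mini-batch adaptive stochastic heavy ball method).** *Setting.* Let $\mathcal X$ be a real Hilbert space, let $\mathcal Y_1,\dots,\mathcal Y_N$ be uniformly smooth real Banach spaces, let $F_i:\mathrm{dom}(F_i)\subset\mathcal X\to\mathcal Y_i$ and $y_i\in\mathcal Y_i$, and consider the system $F_i(x)=y_i$, $i=1,\dots,N$. A *solution* is a point of $\mathcal D=\bigcap_i\mathrm{dom}(F_i)$ satisfying all $N$ equations. Write $D_\xi\Theta(z,x)=\Theta(z)-\Theta(x)-\langle\xi,z-x\rangle$ and $B_s(x_0)=\{x:\|x-x_0\|\le s\}$. Assume: 1. $\Theta:\mathcal X\to(-\infty,\infty]$ is proper, lower semicontinuous and strongly convex, and $\sigma>0$ is such that $D_\xi\Theta(z,x)\ge\sigma\|z-x\|^2$ for all $z\in\mathcal X$, $x\in\mathrm{dom}(\Theta)$, $\xi\in\partial\Theta(x)$. 2. $x_0\in\mathrm{dom}(\Theta)$ and $\xi_0\in\partial\Theta(x_0)$. For some $\rho>0$ one has $B_{2\rho}(x_0)\subset\mathcal D$, and there is a solution $x\in\mathrm{dom}(\Theta)$ with $D_{\xi_0}\Theta(x,x_0)\le\sigma\rho^2$.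 3. For each $i$ there are bounded linear operators $L_i(x):\mathcal X\to\mathcal Y_i$, $x\in B_{2\rho}(x_0)$, continuous in $x$ in operator norm, with $\|L_i(x)\|\le B_0$ for some $B_0>0$. There is $0\le\eta<1$ with $\|F_i(x)-F_i(\bar x)-L_i(x)(x-\bar x)\|\le\eta\|F_i(x)-F_i(\bar x)\|$ for all $x,\bar x\in B_{2\rho}(x_0)$ and all $i$. Under these assumptions there is exactly one solution $x^\dagger\in\mathrm{dom}(\Theta)$ that minimizes $D_{\xi_0}\Theta(\cdot,x_0)$ among all solutions in $\mathrm{dom}(\Theta)$. *Method.* Let $1<r<\infty$ and let $J_r^{\mathcal Y_i}(v)$ be the unique $\varphi\in\mathcal Y_i^*$ with $\|\varphi\|=\|v\|^{r-1}$ and $\varphi(v)=\|v\|^r$. Let $0<\mu_0<4\sigma$, $\mu_1,\upsilon_0,\upsilon_1>0$, $0\le\beta<1$, $\tau>(1+\eta)/(1-\eta)$ and $1\le b\le N$. Let $I_0,I_1,\dots$ be independent random sets, each uniformly distributed on the $b$-element subsets of $\{1,\dots,N\}$. Given noisy data $y^\delta=(y_i^\delta)$ and noise levels $\delta_i>0$,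 put $\delta_{\min}=\min_i\delta_i$, $\xi_{-1}^\delta=\xi_0^\delta=\xi_0$, $x_0^\delta=x_0$, $\tilde\gamma_0^\delta=0$, $\mathscr A_0=\{1,\dots,N\}$. For $n\ge0$, with $\mathfrak r_{n,i}=F_i(x_n^\delta)-y_i^\delta$, let $\Gamma_n=\{i\in I_n:\|\mathfrak r_{n,i}\|>\tau\delta_i\}$, $$\mathfrak g_n=\sum_{i\in\Gamma_n}L_i(x_n^\delta)^*J_r^{\mathcal Y_i}(\mathfrak r_{n,i}),\quad \Phi_n=\sum_{i\in\Gamma_n}\big((1-\eta)\|\mathfrak r_{n,i}\|-(1+\eta)\delta_i\big)\|\mathfrak r_{n,i}\|^{r-1},\quad \Psi_n=\sum_{i\in\Gamma_n}\|\mathfrak r_{n,i}\|^r,$$ and let $t_n=\min\{\mu_0\Phi_n/\|\mathfrak g_n\|^2,\ \mu_1\Psi_n^{2/r-1}\}$ if $\Gamma_n\ne\emptyset$, $t_n=0$ otherwise. With $\mathfrak m_n=\xi_n^\delta-\xi_{n-1}^\delta$ and $\tilde\gamma_n^\delta=\langle\mathfrak m_n,x_n^\delta-x_{n-1}^\delta\rangle-t_{n-1}\Phi_{n-1}+\beta_{n-1}\tilde\gamma_{n-1}^\delta$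 for $n\ge1$, let $$\beta_n=\min\Big\{\frac{t_n\langle\mathfrak g_n,\mathfrak m_n\rangle-2\sigma\tilde\gamma_n^\delta}{\|\mathfrak m_n\|^2},\ \beta\Big\}\quad\text{if }\|\mathfrak m_n\|\ge\upsilon_0\delta_{\min}\text{ and }\tilde\gamma_n^\delta-\tfrac{t_n}{2\sigma}\langle\mathfrak g_n,\mathfrak m_n\rangle\le-\upsilon_1\delta_{\min}\|\mathfrak m_n\|^2,$$ and $\beta_n=0$ otherwise. Put $\xi_{n+1}^\delta=\xi_n^\delta-t_n\mathfrak g_n+\beta_n\mathfrak m_n$ and $x_{n+1}^\delta=\arg\min_x\{\Theta(x)-\langle\xi_{n+1}^\delta,x\rangle\}$. Let $\mathscr A_{n+1}=\mathscr A_n\setminus I_n$ if $\Gamma_n=\emptyset$ and $\beta_n=0$, and $\mathscr A_{n+1}=\{1,\dots,N\}$ otherwise. The stopping index $n_\delta$ is the first $n$ with $\mathscr A_n=\emptyset$. *Claim.* Let $y^{(l)}=(y_1^{(l)},\dots,y_N^{(l)})$, $l\in\mathbb N$, satisfy $\|y_i^{(l)}-y_i\|\le\delta_i^{(l)}$ with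 $\delta_i^{(l)}>0$ for all $i$ and $\delta^{(l)}=\max_i\delta_i^{(l)}\to0$ as $l\to\infty$. Run the method for every $l$ along the same random batches $I_0,I_1,\dots$, and let $n_l$ be the stopping index for $y^{(l)}$. Then each $n_l$ is finite almost surely, and there is a random solution $x_*\in B_{2\rho}(x_0)\cap\mathrm{dom}(\Theta)$ of the system such that, as $l\to\infty$, almost surely $$\big\|x_{n_l}^{\delta^{(l)}}-x_*\big\|\to0\quad\text{and}\quad D_{\xi_{n_l}^{\delta^{(l)}}}\Theta\big(x_*,x_{n_l}^{\delta^{(l)}}\big)\to0,$$ and $$\mathbb E\Big[\big\|x_{n_l}^{\delta^{(l)}}-x_*\big\|^2\Big]\to0\quad\text{and}\quad\mathbb E\Big[D_{\xi_{n_l}^{\delta^{(l)}}}\Theta\big(x_*,x_{n_l}^{\delta^{(l)}}\big)\Big]\to0,$$ all these expectations being finite. If, moreover, $\mathrm{Ran}(L_i(x)^*)\subset\overline{\mathrm{Ran}(L_i(x^\dagger)^*)}$ for all $x\in B_{2\rho}(x_0)$ and $i=1,\dots,N$, then $x_*=x^\dagger$ almost surely. -/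

import Mathlib

open Filter Topology MeasureTheory ProbabilityTheory

noncomputable section

namespace MinibatchSHB

/-! ### Convex analysis on a real Hilbert space -/

section Convex

variable {X : Type*} [NormedAddCommGroup X] [InnerProductSpace ℝ X]

/-- Effective domain of `Θ : X → (-∞, ∞]`. -/
def effDomain (Θ : X → EReal) : Set X := {x | Θ x < ⊤}

/-- `Θ` takes values in `(-∞, ∞]` and is finite somewhere. -/
def IsProper (Θ : X → EReal) : Prop := (∀ x, Θ x ≠ ⊥) ∧ (effDomain Θ).Nonempty

/-- Strong convexity with constant `κ`:
`Θ (t x + (1 - t) z) + κ t (1 - t) ‖x - z‖² ≤ t Θ x + (1 - t) Θ z`. -/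
def StronglyConvexWith (Θ : X → EReal) (κ : ℝ) : Prop :=
  ∀ (x z : X) (t : ℝ), 0 ≤ t → t ≤ 1 →
    Θ (t • x + (1 - t) • z) + ((κ * t * (1 - t) * ‖x - z‖ ^ 2 : ℝ) : EReal)
      ≤ (t : EReal) * Θ x + ((1 - t : ℝ) : EReal) * Θ z

/-- Bregman distance `D_ξ Θ (z, x) = Θ z - Θ x - ⟨ξ, z - x⟩`. -/
def bregman (Θ : X → EReal) (ξ z x : X) : EReal :=
  Θ z - Θ x - ((inner ℝ ξ (z - x) : ℝ) : EReal)

/-- Graph of the subdifferential: `x ∈ dom Θ` and `ξ` is a subgradient of `Θ` at `x`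
(the dual of the Hilbert space being identified with the space itself). -/
def subdiffGraph (Θ : X → EReal) : Set (X × X) :=
  {p | p.1 ∈ effDomain Θ ∧ ∀ z, 0 ≤ bregman Θ p.2 z p.1}

/-- `argmin_z {Θ z - ⟨ξ, z⟩}`. For a proper, lower semicontinuous, strongly convex `Θ` on a
Hilbert space there is exactly one minimizer, and this is it. -/
def argMin (Θ : X → EReal) (ξ : X) : X :=
  Classical.epsilon fun x =>
    IsMinOn (fun z => Θ z - ((inner ℝ ξ z : ℝ) : EReal)) Set.univ x

end Convex

/-! ### Banach spaces -/

section Banach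

variable {Y : Type*} [NormedAddCommGroup Y] [NormedSpace ℝ Y]

/-- Modulus of smoothness of a normed space. -/
def modulusOfSmoothness (Y : Type*) [NormedAddCommGroup Y] (ε : ℝ) : ℝ :=
  (1 / 2) * sSup {s : ℝ | ∃ u v : Y, ‖u‖ = 1 ∧ ‖v‖ ≤ ε ∧ s = ‖u + v‖ + ‖u - v‖ - 2}

/-- Uniform smoothness. -/
def IsUniformlySmooth (Y : Type*) [NormedAddCommGroup Y] : Prop :=
  Tendsto (fun ε : ℝ => modulusOfSmoothness Y ε / ε) (𝓝[>] 0) (𝓝 0)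

/-- The set-valued duality mapping with gauge function `t ↦ t ^ (r - 1)`. -/
def dualitySet (r : ℝ) (v : Y) : Set (StrongDual ℝ Y) :=
  {φ | ‖φ‖ = ‖v‖ ^ (r - 1) ∧ φ v = ‖v‖ ^ r}

theorem dualitySet_nonempty {r : ℝ} (hr : 1 < r) (v : Y) : (dualitySet r v).Nonempty := by
  rcases eq_or_ne v 0 with rfl | hv
  · exact ⟨0, by simp [Real.zero_rpow (by linarith : r - 1 ≠ 0)],
      by simp [Real.zero_rpow (by linarith : r ≠ 0)]⟩
  · obtain ⟨g, hg, hgv⟩ := exists_dual_vector ℝ v (norm_ne_zero_iff.mpr hv)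
    have hpos : 0 < ‖v‖ := norm_pos_iff.mpr hv
    refine ⟨(‖v‖ ^ (r - 1)) • g, ?_, ?_⟩
    · rw [norm_smul, hg, mul_one, Real.norm_of_nonneg (Real.rpow_nonneg hpos.le _)]
    · have h1 : g v = ‖v‖ := by simpa using hgv
      simp only [smul_apply, h1, smul_eq_mul]
      rw [← Real.rpow_add_one hpos.ne']
      ring_nf

/-- The duality mapping as a function: an element of `dualitySet r v`, which is the only one
when the space is uniformly smooth. -/
def dualityMap (r : ℝ) (v : Y) : StrongDual ℝ Y :=
  Classical.epsilon fun φ => φ ∈ dualitySet r v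

theorem dualityMap_mem {r : ℝ} (hr : 1 < r) (v : Y) : dualityMap r v ∈ dualitySet r v :=
  Classical.epsilon_spec (dualitySet_nonempty hr v)

/-- The adjoint `A* : Y* → X` of a bounded operator from a Hilbert space to a Banach space,
i.e. `⟨A* φ, x⟩ = φ (A x)`. -/
def adjointMap {X : Type*} [NormedAddCommGroup X] [InnerProductSpace ℝ X] [CompleteSpace X]
    (A : X →L[ℝ] Y) (φ : StrongDual ℝ Y) : X :=
  (InnerProductSpace.toDual ℝ X).symm (φ.comp A)

end Banach

/-! ### The system `F i x = y i`, its solutions and the standing assumptions -/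

section System

variable {X : Type*} [NormedAddCommGroup X] [InnerProductSpace ℝ X]
  {N : ℕ} {Y : Fin N → Type*} [∀ i, NormedAddCommGroup (Y i)] [∀ i, NormedSpace ℝ (Y i)]

/-- Solutions of the system `F i x = y i`; the operator `F i` is defined on `domF i`, and its
values outside `domF i` are irrelevant. -/
def solutionSet (domF : Fin N → Set X) (F : ∀ i, X → Y i) (y : ∀ i, Y i) : Set X :=
  {x | (∀ i, x ∈ domF i) ∧ ∀ i, F i x = y i}

/-- `xdag` is a solution in `dom Θ` of minimal Bregman distance to `x₀` in direction `ξ₀`. -/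
def IsMinimalDistanceSolution (Θ : X → EReal) (domF : Fin N → Set X) (F : ∀ i, X → Y i)
    (y : ∀ i, Y i) (x₀ ξ₀ xdag : X) : Prop :=
  xdag ∈ effDomain Θ ∩ solutionSet domF F y ∧
    ∀ x ∈ effDomain Θ ∩ solutionSet domF F y, bregman Θ ξ₀ xdag x₀ ≤ bregman Θ ξ₀ x x₀

/-- `Θ` is proper, lower semicontinuous, strongly convex, and
`D_ξ Θ (z, x) ≥ σ ‖z - x‖²` for all `z` and all `(x, ξ)` in the graph of the subdifferential. -/
structure RegularizerAssumption (Θ : X → EReal) (σ : ℝ) : Prop where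
  proper : IsProper Θ
  lsc : LowerSemicontinuous Θ
  stronglyConvex : ∃ κ : ℝ, 0 < κ ∧ StronglyConvexWith Θ κ
  sigma_pos : 0 < σ
  bregman_ge : ∀ p ∈ subdiffGraph Θ, ∀ z : X,
    ((σ * ‖z - p.1‖ ^ 2 : ℝ) : EReal) ≤ bregman Θ p.2 z p.1

/-- The assumptions on the system and the family `L i x` replacing the derivatives. -/
structure OperatorAssumption (Θ : X → EReal) (domF : Fin N → Set X) (F : ∀ i, X → Y i)
    (L : ∀ i, X → X →L[ℝ] Y i) (y : ∀ i, Y i) (x₀ ξ₀ : X) (σ ρ B₀ η : ℝ) : Prop where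
  smooth : ∀ i, IsUniformlySmooth (Y i)
  rho_pos : 0 < ρ
  ball_subset : ∀ i, Metric.closedBall x₀ (2 * ρ) ⊆ domF i
  exists_solution : ∃ x ∈ effDomain Θ ∩ solutionSet domF F y,
    bregman Θ ξ₀ x x₀ ≤ ((σ * ρ ^ 2 : ℝ) : EReal)
  continuousOn_L : ∀ i, ContinuousOn (L i) (Metric.closedBall x₀ (2 * ρ))
  B_pos : 0 < B₀
  norm_L_le : ∀ i, ∀ x ∈ Metric.closedBall x₀ (2 * ρ), ‖L i x‖ ≤ B₀
  eta_nonneg : 0 ≤ η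
  eta_lt_one : η < 1
  tangential_cone : ∀ i, ∀ x ∈ Metric.closedBall x₀ (2 * ρ),
    ∀ z ∈ Metric.closedBall x₀ (2 * ρ),
      ‖F i x - F i z - L i x (x - z)‖ ≤ η * ‖F i x - F i z‖

end System

/-! ### The mini-batch adaptive stochastic heavy ball method -/

/-- Numerical parameters of the method; `r` is the exponent of the gauge function. -/
structure Params where
  r : ℝ
  η : ℝ
  σ : ℝ
  μ₀ : ℝ
  μ₁ : ℝ
  τ : ℝ
  υ₀ : ℝ
  υ₁ : ℝ
  β : ℝ

/-- The quantities carried by the method at step `n`: `ξ n`, `ξ (n - 1)`, `x n`,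
`γ̃ n` and the set `𝒜 n` of equations not yet seen to satisfy the discrepancy principle. -/
structure State (X : Type*) (N : ℕ) where
  ξ : X
  ξprev : X
  x : X
  γ : ℝ
  active : Finset (Fin N)

section Algorithm

variable {X : Type*} [NormedAddCommGroup X] [InnerProductSpace ℝ X] [CompleteSpace X]
  {N : ℕ} {Y : Fin N → Type*} [∀ i, NormedAddCommGroup (Y i)] [∀ i, NormedSpace ℝ (Y i)]

open Classical in
/-- `Γ n`: the indices of the batch that violate the discrepancy principle. -/
def violating (q : Params) (F : ∀ i, X → Y i) (yδ : ∀ i, Y i) (δ : Fin N → ℝ)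
    (I : Finset (Fin N)) (x : X) : Finset (Fin N) :=
  I.filter fun i => q.τ * δ i < ‖F i x - yδ i‖

/-- `𝔤 n = ∑_{i ∈ Γ n} L i (x n)* J_r (F i (x n) - yδ i)`. -/
def gradTerm (q : Params) (F : ∀ i, X → Y i) (L : ∀ i, X → X →L[ℝ] Y i) (yδ : ∀ i, Y i)
    (δ : Fin N → ℝ) (I : Finset (Fin N)) (x : X) : X :=
  ∑ i ∈ violating q F yδ δ I x, adjointMap (L i x) (dualityMap q.r (F i x - yδ i))

/-- `Φ n`. -/
def phiTerm (q : Params) (F : ∀ i, X → Y i) (yδ : ∀ i, Y i)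
    (δ : Fin N → ℝ) (I : Finset (Fin N)) (x : X) : ℝ :=
  ∑ i ∈ violating q F yδ δ I x,
    ((1 - q.η) * ‖F i x - yδ i‖ - (1 + q.η) * δ i) * ‖F i x - yδ i‖ ^ (q.r - 1)

/-- `Ψ n`. -/
def psiTerm (q : Params) (F : ∀ i, X → Y i) (yδ : ∀ i, Y i)
    (δ : Fin N → ℝ) (I : Finset (Fin N)) (x : X) : ℝ :=
  ∑ i ∈ violating q F yδ δ I x, ‖F i x - yδ i‖ ^ q.r

open Classical in
/-- The step size `t n`. -/
def stepSize (q : Params) (F : ∀ i, X → Y i) (L : ∀ i, X → X →L[ℝ] Y i) (yδ : ∀ i, Y i)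
    (δ : Fin N → ℝ) (I : Finset (Fin N)) (x : X) : ℝ :=
  if (violating q F yδ δ I x).Nonempty then
    min (q.μ₀ * phiTerm q F yδ δ I x / ‖gradTerm q F L yδ δ I x‖ ^ 2)
      (q.μ₁ * psiTerm q F yδ δ I x ^ (2 / q.r - 1))
  else 0

open Classical in
/-- The momentum coefficient `β n`, computed from `t n`, `𝔤 n`, `𝔪 n`, `γ̃ n` and `δ_min`. -/
def momentumCoeff (q : Params) (δmin t : ℝ) (g m : X) (γ : ℝ) : ℝ :=
  if q.υ₀ * δmin ≤ ‖m‖ ∧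
      γ - t / (2 * q.σ) * inner ℝ g m ≤ -(q.υ₁ * δmin * ‖m‖ ^ 2) then
    min ((t * inner ℝ g m - 2 * q.σ * γ) / ‖m‖ ^ 2) q.β
  else 0

open Classical in
/-- One step of the method, using the batch `I`. -/
def step (q : Params) (Θ : X → EReal) (F : ∀ i, X → Y i) (L : ∀ i, X → X →L[ℝ] Y i)
    (yδ : ∀ i, Y i) (δ : Fin N → ℝ) (I : Finset (Fin N)) (s : State X N) : State X N :=
  let g := gradTerm q F L yδ δ I s.x
  let t := stepSize q F L yδ δ I s.x
  let m := s.ξ - s.ξprev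
  let βn := momentumCoeff q (⨅ i, δ i) t g m s.γ
  let ξ' := s.ξ - t • g + βn • m
  let x' := argMin Θ ξ'
  { ξ := ξ'
    ξprev := s.ξ
    x := x'
    γ := inner ℝ (ξ' - s.ξ) (x' - s.x) - t * phiTerm q F yδ δ I s.x + βn * s.γ
    active := if violating q F yδ δ I s.x = ∅ ∧ βn = 0 then s.active \ I else Finset.univ }

/-- The state after `n` steps along the sequence of batches `I 0, I 1, …`. -/
def iter (q : Params) (Θ : X → EReal) (F : ∀ i, X → Y i) (L : ∀ i, X → X →L[ℝ] Y i)
    (x₀ ξ₀ : X) (yδ : ∀ i, Y i) (δ : Fin N → ℝ) (I : ℕ → Finset (Fin N)) : ℕ → State X N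
  | 0 => { ξ := ξ₀, ξprev := ξ₀, x := x₀, γ := 0, active := Finset.univ }
  | n + 1 => step q Θ F L yδ δ (I n) (iter q Θ F L x₀ ξ₀ yδ δ I n)

/-- The stopping rule is met after finitely many steps along `I`. -/
def Terminates (q : Params) (Θ : X → EReal) (F : ∀ i, X → Y i) (L : ∀ i, X → X →L[ℝ] Y i)
    (x₀ ξ₀ : X) (yδ : ∀ i, Y i) (δ : Fin N → ℝ) (I : ℕ → Finset (Fin N)) : Prop :=
  ∃ n, (iter q Θ F L x₀ ξ₀ yδ δ I n).active = ∅

/-- The stopping index: the first `n` at which the set `𝒜 n` is empty (meaningful when the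
method terminates along `I`). -/
def stopIndex (q : Params) (Θ : X → EReal) (F : ∀ i, X → Y i) (L : ∀ i, X → X →L[ℝ] Y i)
    (x₀ ξ₀ : X) (yδ : ∀ i, Y i) (δ : Fin N → ℝ) (I : ℕ → Finset (Fin N)) : ℕ :=
  sInf {n | (iter q Θ F L x₀ ξ₀ yδ δ I n).active = ∅}

/-- The state at the stopping index. -/
def output (q : Params) (Θ : X → EReal) (F : ∀ i, X → Y i) (L : ∀ i, X → X →L[ℝ] Y i)
    (x₀ ξ₀ : X) (yδ : ∀ i, Y i) (δ : Fin N → ℝ) (I : ℕ → Finset (Fin N)) : State X N :=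
  iter q Θ F L x₀ ξ₀ yδ δ I (stopIndex q Θ F L x₀ ξ₀ yδ δ I)

end Algorithm

/-- The batches `I 0, I 1, …` are independent, each of them uniformly distributed on the
subsets of `{1, …, N}` of size `b`. -/
structure IsUniformBatchSequence {Ω : Type*} [MeasurableSpace Ω] (P : Measure Ω) {N : ℕ}
    (b : ℕ) (I : ℕ → Ω → Finset (Fin N)) : Prop where
  measurable : ∀ n s, MeasurableSet (I n ⁻¹' {s})
  indep : iIndepFun (m := fun _ => (⊤ : MeasurableSpace (Finset (Fin N)))) I P
  card_eq : ∀ n ω, (I n ω).card = b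
  uniform : ∀ n (s : Finset (Fin N)), s.card = b →
    P (I n ⁻¹' {s}) = ((N.choose b : ℕ) : ENNReal)⁻¹

end MinibatchSHB

end

/-!
The argument compares the method with noisy data to the method with exact data, run along the same
batches. The latter is the same recursion with zero noise levels, so every estimate of a single
step is proved once, for noise levels that may vanish.

*Descent.* If `z` is a solution in the ball then the Bregman distance from `z` to the iterate never
increases (`Setting.step_descent`). The step size is chosen so that the search direction
contributes a decrease proportional to `t Φ`. The momentum coefficient minimizes a quadratic model
in which the unknown number `⟨m, x - z⟩` is replaced by its computable upper bound `γ`; that `γ` is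
such a bound is part of the invariant `Admissible`. For positive noise levels each unsuccessful
step decreases the distance by a fixed amount, so there are finitely many of them, and the stopping
rule is met once every equation has been drawn again (`Setting.terminates`).

*Exact data.* Since a batch is independent of the current iterate, the descent inequality shows
that the squared residuals of all equations are summable in expectation
(`Setting.lintegral_tsum_residual_lt_top`). For a fixed sequence of batches with summable squared
residuals, evaluate the dual iterates at indices where the residual is at a record low: there the
change of the dual iterate, tested against the error, is bounded by sums of squared residuals, by
the tangential cone condition and the geometric decay of the momentum
(`Setting.abs_inner_iter_sub_le`). This yields a Cauchy sequence whose limit solves the system, and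
a bound on the Bregman distance from the initial guess to the limit that is integrable
(`Setting.exists_limit_of_summable`, `Setting.exists_random_limit`).

*Stability and stopping.* For a fixed number of steps the iterates depend continuously on the data
as the noise tends to zero (`Setting.tendsto_iter`). Two things could go wrong and do not: the
discrepancy test only switches contributions that vanish in the limit, and the case distinction in
the momentum coefficient is, up to the noise level, the projection of the unconstrained minimizer
onto an interval. The duality mappings are continuous by uniform smoothness
(`tendsto_dualityMap`). Monotonicity carries the estimate from a fixed late index to the stopping
index, and a stopping index that stays bounded forces an exact iterate to be a solution
(`Setting.tendsto_output_bregman`). Convergence of the expectations follows by domination.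

*Identification.* Under the range condition the dual iterates move orthogonally to differences of
solutions, which makes the limit the solution of minimal Bregman distance
(`Setting.eq_minimalDistanceSolution_of_range`).
-/

noncomputable section

namespace MinibatchSHB

/-! ### Regularizers: minimizers, subgradients and Bregman distances -/

section Convex

variable {X : Type*} [NormedAddCommGroup X] [InnerProductSpace ℝ X]
  {Θ : X → EReal} {σ : ℝ} {x x' z ξ ξ' x₀ ξ₀ : X}

/-- The Bregman distance as a real number; it agrees with `bregman` when both points lie in the
effective domain. -/
def realBregman (Θ : X → EReal) (ξ z x : X) : ℝ :=
  (Θ z).toReal - (Θ x).toReal - inner ℝ ξ (z - x)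

theorem coe_toReal_of_mem_effDomain {E : Type*} {Θ : E → EReal} {x : E} (hp : IsProper Θ)
    (hx : x ∈ effDomain Θ) :
    (((Θ x).toReal : ℝ) : EReal) = Θ x :=
  EReal.coe_toReal (ne_of_lt hx) (hp.1 x)

theorem bregman_eq_coe (hp : IsProper Θ) (ξ : X) (hz : z ∈ effDomain Θ) (hx : x ∈ effDomain Θ) :
    bregman Θ ξ z x = ((realBregman Θ ξ z x : ℝ) : EReal) := by
  rw [bregman, ← coe_toReal_of_mem_effDomain hp hz, ← coe_toReal_of_mem_effDomain hp hx]
  simp [realBregman]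

theorem realBregman_self (ξ x : X) : realBregman Θ ξ x x = 0 := by
  simp [realBregman]

theorem realBregman_ge (h : RegularizerAssumption Θ σ) (hx : (x, ξ) ∈ subdiffGraph Θ)
    (hz : z ∈ effDomain Θ) : σ * ‖z - x‖ ^ 2 ≤ realBregman Θ ξ z x := by
  have h1 := h.bregman_ge _ hx z
  rw [bregman_eq_coe h.proper ξ hz hx.1] at h1
  exact EReal.coe_le_coe_iff.1 h1

theorem realBregman_nonneg (h : RegularizerAssumption Θ σ) (hx : (x, ξ) ∈ subdiffGraph Θ)
    (hz : z ∈ effDomain Θ) : 0 ≤ realBregman Θ ξ z x :=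
  le_trans (mul_nonneg h.sigma_pos.le (sq_nonneg _)) (realBregman_ge h hx hz)

theorem eq_of_realBregman_nonpos (h : RegularizerAssumption Θ σ) (hx : (x, ξ) ∈ subdiffGraph Θ)
    (hz : z ∈ effDomain Θ) (h0 : realBregman Θ ξ z x ≤ 0) : x = z := by
  have h1 := realBregman_ge h hx hz
  have h2 : ‖z - x‖ ^ 2 ≤ 0 := by
    by_contra hc
    push Not at hc
    have := mul_pos h.sigma_pos hc
    linarith
  have h3 : ‖z - x‖ = 0 := by
    have := le_antisymm h2 (sq_nonneg _)
    exact pow_eq_zero_iff two_ne_zero |>.1 this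
  exact (sub_eq_zero.1 (norm_eq_zero.1 h3)).symm

/-- Three-point identity. -/
theorem realBregman_three_point (ξ ξ' z x x' : X) :
    realBregman Θ ξ' z x' - realBregman Θ ξ z x
      = realBregman Θ ξ' x x' + inner ℝ (ξ' - ξ) (x - z) := by
  simp only [realBregman, inner_sub_left, inner_sub_right]
  ring

theorem realBregman_le_norm_sq (h : RegularizerAssumption Θ σ) (hx : (x, ξ) ∈ subdiffGraph Θ)
    (hx' : (x', ξ') ∈ subdiffGraph Θ) :
    realBregman Θ ξ' x x' ≤ ‖ξ' - ξ‖ ^ 2 / (4 * σ) := by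
  have hσ := h.sigma_pos
  have h1 := realBregman_ge h hx hx'.1
  have h2 : realBregman Θ ξ' x x' + realBregman Θ ξ x' x = inner ℝ (ξ' - ξ) (x' - x) := by
    simp only [realBregman, inner_sub_left, inner_sub_right]
    ring
  have h3 := real_inner_le_norm (ξ' - ξ) (x' - x)
  rw [le_div_iff₀ (by positivity)]
  nlinarith [sq_nonneg (‖ξ' - ξ‖ - 2 * σ * ‖x' - x‖)]

/-- The inverse of the subdifferential is Lipschitz continuous. -/
theorem norm_sub_le_of_subdiffGraph (h : RegularizerAssumption Θ σ)
    (hx : (x, ξ) ∈ subdiffGraph Θ) (hx' : (x', ξ') ∈ subdiffGraph Θ) :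
    ‖x' - x‖ ≤ ‖ξ' - ξ‖ / (2 * σ) := by
  have hσ := h.sigma_pos
  have h1 := realBregman_ge h hx hx'.1
  have h1' := realBregman_ge h hx' hx.1
  have h2 : realBregman Θ ξ' x x' + realBregman Θ ξ x' x = inner ℝ (ξ' - ξ) (x' - x) := by
    simp only [realBregman, inner_sub_left, inner_sub_right]
    ring
  have h3 := real_inner_le_norm (ξ' - ξ) (x' - x)
  rw [norm_sub_rev x x'] at h1'
  rw [le_div_iff₀ (by positivity)]
  by_contra hc
  push Not at hc
  rcases (norm_nonneg (x' - x)).eq_or_lt with h0 | h0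
  · rw [← h0] at hc
    have := norm_nonneg (ξ' - ξ)
    linarith
  · nlinarith

/-- Lower semicontinuity along a filter: bounds on `Θ` that hold frequently pass to the limit. -/
theorem mem_effDomain_of_tendsto {E : Type*} [TopologicalSpace E] {Θ : E → EReal} {x : E}
    (hp : IsProper Θ) (hlsc : LowerSemicontinuous Θ) {ι : Type*} {l : Filter ι} {u : ι → E}
    {c : ι → ℝ} {c₀ : ℝ} (hu : Tendsto u l (𝓝 x))
    (hc : Tendsto c l (𝓝 c₀))
    (hle : ∃ᶠ n in l, u n ∈ effDomain Θ ∧ (Θ (u n)).toReal ≤ c n) :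
    x ∈ effDomain Θ ∧ (Θ x).toReal ≤ c₀ := by
  have key : ∀ c' : ℝ, c₀ < c' → Θ x ≤ (c' : EReal) := by
    intro c' hc'
    by_contra hlt
    push Not at hlt
    have h1 := hu.eventually (hlsc x _ hlt)
    have h2 := hc.eventually (gt_mem_nhds hc')
    obtain ⟨n, ⟨hn1, hn2⟩, hn3, hn4⟩ := (hle.and_eventually (h1.and h2)).exists
    rw [← coe_toReal_of_mem_effDomain hp hn1, gt_iff_lt, EReal.coe_lt_coe_iff] at hn3
    linarith
  have hdom : x ∈ effDomain Θ :=
    lt_of_le_of_lt (key (c₀ + 1) (by linarith)) (EReal.coe_lt_top _)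
  refine ⟨hdom, le_of_forall_gt_imp_ge_of_dense fun c' hc' => ?_⟩
  have := key c' hc'
  rw [← coe_toReal_of_mem_effDomain hp hdom] at this
  exact EReal.coe_le_coe_iff.1 this

theorem midpoint_of_stronglyConvex {κ : ℝ} (hp : IsProper Θ) (hκ : StronglyConvexWith Θ κ)
    (hx : x ∈ effDomain Θ) (hz : z ∈ effDomain Θ) :
    (1 / 2 : ℝ) • x + (1 / 2 : ℝ) • z ∈ effDomain Θ ∧
      (Θ ((1 / 2 : ℝ) • x + (1 / 2 : ℝ) • z)).toReal + κ / 4 * ‖x - z‖ ^ 2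
        ≤ ((Θ x).toReal + (Θ z).toReal) / 2 := by
  have h1 := hκ x z (1 / 2) (by norm_num) (by norm_num)
  rw [show (1 - 1 / 2 : ℝ) = 1 / 2 by norm_num, ← coe_toReal_of_mem_effDomain hp hx,
    ← coe_toReal_of_mem_effDomain hp hz, ← EReal.coe_mul, ← EReal.coe_mul, ← EReal.coe_add] at h1
  set w := (1 / 2 : ℝ) • x + (1 / 2 : ℝ) • z
  have hw : w ∈ effDomain Θ := by
    by_contra hc
    have htop : Θ w = ⊤ := not_lt_top_iff.1 hc
    rw [htop, EReal.top_add_coe] at h1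
    exact absurd h1 (not_le.2 (EReal.coe_lt_top _))
  refine ⟨hw, ?_⟩
  rw [← coe_toReal_of_mem_effDomain hp hw, ← EReal.coe_add, EReal.coe_le_coe_iff] at h1
  linarith

/-- A linear perturbation of the regularizer attains its minimum over a closed convex set meeting
the effective domain: by strong convexity every minimizing sequence is a Cauchy sequence. The
given subgradient serves to bound the functional below. -/
theorem exists_minimizer [CompleteSpace X] (h : RegularizerAssumption Θ σ)
    (h₀ : (x₀, ξ₀) ∈ subdiffGraph Θ) {C : Set X} (hC : IsClosed C) (hconv : Convex ℝ C)
    (hne : (C ∩ effDomain Θ).Nonempty) (ξ : X) :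
    ∃ x ∈ C ∩ effDomain Θ, ∀ z ∈ C ∩ effDomain Θ,
      (Θ x).toReal - inner ℝ ξ x ≤ (Θ z).toReal - inner ℝ ξ z := by
  have hσ := h.sigma_pos
  set f : X → ℝ := fun z => (Θ z).toReal - inner ℝ ξ z with hf
  have hbdd : BddBelow (f '' (C ∩ effDomain Θ)) := by
    refine ⟨(Θ x₀).toReal - inner ℝ ξ x₀ - ‖ξ₀ - ξ‖ ^ 2 / (4 * σ), ?_⟩
    rintro _ ⟨z, hz, rfl⟩
    have h1 := realBregman_ge h h₀ hz.2
    have h3 := neg_le_of_abs_le (abs_real_inner_le_norm (ξ₀ - ξ) (z - x₀))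
    have h4 : ‖ξ₀ - ξ‖ * ‖z - x₀‖ - σ * ‖z - x₀‖ ^ 2 ≤ ‖ξ₀ - ξ‖ ^ 2 / (4 * σ) := by
      rw [le_div_iff₀ (by positivity)]
      nlinarith [sq_nonneg (‖ξ₀ - ξ‖ - 2 * σ * ‖z - x₀‖)]
    simp only [realBregman, inner_sub_left, inner_sub_right, hf] at *
    linarith
  set m := sInf (f '' (C ∩ effDomain Θ)) with hm
  have hm_le : ∀ z ∈ C ∩ effDomain Θ, m ≤ f z := fun z hz => csInf_le hbdd ⟨z, hz, rfl⟩
  have hseq : ∀ n : ℕ, ∃ z ∈ C ∩ effDomain Θ, f z < m + 1 / ((n : ℝ) + 1) := by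
    intro n
    obtain ⟨_, ⟨z, hz, rfl⟩, hlt⟩ := exists_lt_of_csInf_lt (hne.image f)
      (show m < m + 1 / ((n : ℝ) + 1) by
        have : (0 : ℝ) < 1 / ((n : ℝ) + 1) := by positivity
        linarith)
    exact ⟨z, hz, hlt⟩
  choose u hu hum using hseq
  obtain ⟨κ, hκ, hsc⟩ := h.stronglyConvex
  have hone : Tendsto (fun n : ℕ => 1 / ((n : ℝ) + 1)) atTop (𝓝 0) :=
    tendsto_one_div_add_atTop_nhds_zero_nat
  have hdist : ∀ n k : ℕ, κ / 4 * ‖u n - u k‖ ^ 2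
      ≤ (1 / ((n : ℝ) + 1) + 1 / ((k : ℝ) + 1)) / 2 := by
    intro n k
    obtain ⟨h1, h2⟩ := midpoint_of_stronglyConvex h.proper hsc (hu n).2 (hu k).2
    have h3 := hm_le _ ⟨hconv (hu n).1 (hu k).1 (by norm_num) (by norm_num) (by norm_num), h1⟩
    have h4 := hum n
    have h5 := hum k
    simp only [hf, inner_add_right, inner_smul_right] at h3 h4 h5
    linarith
  have hcau : CauchySeq u := by
    rw [Metric.cauchySeq_iff']
    intro ε hε
    obtain ⟨n₀, hn₀⟩ := (hone.eventually (gt_mem_nhds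
      (show (0 : ℝ) < κ / 4 * ε ^ 2 by positivity))).exists_forall_of_atTop
    refine ⟨n₀, fun n hn => ?_⟩
    rw [dist_eq_norm]
    have h1 := hdist n n₀
    have h2 := hn₀ n hn
    have h3 := hn₀ n₀ le_rfl
    have h4 : ‖u n - u n₀‖ ^ 2 < ε ^ 2 := by
      have : κ / 4 * ‖u n - u n₀‖ ^ 2 < κ / 4 * ε ^ 2 := by linarith
      exact lt_of_mul_lt_mul_left this (by positivity)
    exact lt_of_pow_lt_pow_left₀ 2 hε.le h4
  obtain ⟨x, hx⟩ := cauchySeq_tendsto_of_complete hcau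
  have hxC : x ∈ C := hC.mem_of_tendsto hx (Eventually.of_forall fun n => (hu n).1)
  have hlim : Tendsto (fun n : ℕ => m + 1 / ((n : ℝ) + 1) + inner ℝ ξ (u n)) atTop
      (𝓝 (m + 0 + inner ℝ ξ x)) :=
    (tendsto_const_nhds.add hone).add (tendsto_const_nhds.inner hx)
  obtain ⟨hxd, hxm⟩ := mem_effDomain_of_tendsto h.proper h.lsc hx hlim
    (Frequently.of_forall fun n => ⟨(hu n).2, by
      have := hum n
      simp only [hf] at this
      linarith⟩)
  refine ⟨x, ⟨hxC, hxd⟩, fun z hz => ?_⟩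
  have := hm_le z hz
  simp only [hf] at this
  linarith

theorem mem_subdiffGraph_iff (hp : IsProper Θ) :
    (x, ξ) ∈ subdiffGraph Θ ↔
      x ∈ effDomain Θ ∧ ∀ z ∈ effDomain Θ, 0 ≤ realBregman Θ ξ z x := by
  constructor
  · rintro ⟨hx, hz⟩
    refine ⟨hx, fun z hzd => ?_⟩
    have := hz z
    rw [bregman_eq_coe hp ξ hzd hx] at this
    exact_mod_cast this
  · rintro ⟨hx, hz⟩
    refine ⟨hx, fun z => ?_⟩
    by_cases hzd : z ∈ effDomain Θ
    · rw [bregman_eq_coe hp ξ hzd hx]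
      exact_mod_cast hz z hzd
    · have htop : Θ z = ⊤ := not_lt_top_iff.1 hzd
      change (0 : EReal) ≤ Θ z - Θ x - _
      rw [htop, ← coe_toReal_of_mem_effDomain hp hx, EReal.top_sub_coe, EReal.top_sub_coe]
      exact le_top

theorem argMin_mem_subdiffGraph [CompleteSpace X] (h : RegularizerAssumption Θ σ)
    (h₀ : (x₀, ξ₀) ∈ subdiffGraph Θ) (ξ : X) : (argMin Θ ξ, ξ) ∈ subdiffGraph Θ := by
  have hp := h.proper
  have hex : ∃ x, IsMinOn (fun z => Θ z - ((inner ℝ ξ z : ℝ) : EReal)) Set.univ x := by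
    obtain ⟨x, hx, hmin⟩ := exists_minimizer h h₀ isClosed_univ convex_univ
      ⟨x₀, Set.mem_univ _, h₀.1⟩ ξ
    refine ⟨x, fun z _ => ?_⟩
    change Θ x - _ ≤ Θ z - _
    by_cases hzd : z ∈ effDomain Θ
    · rw [← coe_toReal_of_mem_effDomain hp hzd, ← coe_toReal_of_mem_effDomain hp hx.2,
        ← EReal.coe_sub, ← EReal.coe_sub, EReal.coe_le_coe_iff]
      exact hmin z ⟨Set.mem_univ _, hzd⟩
    · rw [show Θ z = ⊤ from not_lt_top_iff.1 hzd, EReal.top_sub_coe]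
      exact le_top
  have hmin : ∀ z, Θ (argMin Θ ξ) - ((inner ℝ ξ (argMin Θ ξ) : ℝ) : EReal)
      ≤ Θ z - ((inner ℝ ξ z : ℝ) : EReal) := fun z => Classical.epsilon_spec hex (Set.mem_univ z)
  have hdom : argMin Θ ξ ∈ effDomain Θ := by
    by_contra hc
    have h1 := hmin x₀
    rw [show Θ (argMin Θ ξ) = ⊤ from not_lt_top_iff.1 hc, EReal.top_sub_coe,
      ← coe_toReal_of_mem_effDomain hp h₀.1,
      ← EReal.coe_sub] at h1
    exact absurd h1 (not_le.2 (EReal.coe_lt_top _))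
  refine (mem_subdiffGraph_iff hp).2 ⟨hdom, fun z hz => ?_⟩
  have h1 := hmin z
  rw [← coe_toReal_of_mem_effDomain hp hz, ← coe_toReal_of_mem_effDomain hp hdom,
    ← EReal.coe_sub, ← EReal.coe_sub, EReal.coe_le_coe_iff] at h1
  simp only [realBregman, inner_sub_right]
  linarith

theorem argMin_eq [CompleteSpace X] (h : RegularizerAssumption Θ σ)
    (hx : (x, ξ) ∈ subdiffGraph Θ) : argMin Θ ξ = x := by
  have h1 := norm_sub_le_of_subdiffGraph h hx (argMin_mem_subdiffGraph h hx ξ)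
  rw [sub_self, norm_zero, zero_div] at h1
  exact sub_eq_zero.1 (norm_le_zero_iff.1 h1)

theorem tendsto_argMin [CompleteSpace X] (h : RegularizerAssumption Θ σ)
    (h₀ : (x₀, ξ₀) ∈ subdiffGraph Θ) {ι : Type*} {l : Filter ι} {u : ι → X}
    (hu : Tendsto u l (𝓝 ξ)) : Tendsto (fun n => argMin Θ (u n)) l (𝓝 (argMin Θ ξ)) := by
  rw [tendsto_iff_norm_sub_tendsto_zero] at hu ⊢
  refine squeeze_zero (fun _ => norm_nonneg _) (fun n => norm_sub_le_of_subdiffGraph h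
    (argMin_mem_subdiffGraph h h₀ ξ) (argMin_mem_subdiffGraph h h₀ (u n))) ?_
  simpa using hu.div_const (2 * σ)

/-- Along convergent subgradients the Bregman distances to a fixed point converge. -/
theorem tendsto_realBregman_argMin [CompleteSpace X] (h : RegularizerAssumption Θ σ)
    (h₀ : (x₀, ξ₀) ∈ subdiffGraph Θ) {ι : Type*} {l : Filter ι} {u : ι → X}
    (hu : Tendsto u l (𝓝 ξ)) (z : X) :
    Tendsto (fun n => realBregman Θ (u n) z (argMin Θ (u n))) l
      (𝓝 (realBregman Θ ξ z (argMin Θ ξ))) := by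
  have hx := tendsto_argMin h h₀ hu
  have hθ : Tendsto (fun n => (Θ (argMin Θ (u n))).toReal) l (𝓝 (Θ (argMin Θ ξ)).toReal) := by
    have h1 : Tendsto (fun n => (Θ (argMin Θ ξ)).toReal
        + inner ℝ ξ (argMin Θ (u n) - argMin Θ ξ)) l (𝓝 ((Θ (argMin Θ ξ)).toReal + 0)) := by
      refine tendsto_const_nhds.add ?_
      simpa using (tendsto_const_nhds (x := ξ)).inner (hx.sub_const (argMin Θ ξ))
    have h2 : Tendsto (fun n => (Θ (argMin Θ ξ)).toReal
        - inner ℝ (u n) (argMin Θ ξ - argMin Θ (u n))) l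
        (𝓝 ((Θ (argMin Θ ξ)).toReal - 0)) := by
      refine tendsto_const_nhds.sub ?_
      simpa using hu.inner (hx.const_sub (argMin Θ ξ))
    rw [add_zero] at h1
    rw [sub_zero] at h2
    have hξ := argMin_mem_subdiffGraph h h₀ ξ
    refine tendsto_of_tendsto_of_tendsto_of_le_of_le h1 h2 (fun n => ?_) (fun n => ?_)
    · have := realBregman_nonneg h hξ (argMin_mem_subdiffGraph h h₀ (u n)).1
      simp only [realBregman] at this
      change _ ≤ _
      simp only
      linarith
    · have := realBregman_nonneg h (argMin_mem_subdiffGraph h h₀ (u n)) hξ.1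
      simp only [realBregman] at this
      change _ ≤ _
      simp only
      linarith
  simp only [realBregman]
  exact (tendsto_const_nhds.sub hθ).sub (hu.inner (tendsto_const_nhds.sub hx))

end Convex

/-! ### Duality mappings and adjoints -/

section Banach

variable {Y : Type*} [NormedAddCommGroup Y] [NormedSpace ℝ Y]

theorem norm_dualityMap {r : ℝ} (hr : 1 < r) (v : Y) : ‖dualityMap r v‖ = ‖v‖ ^ (r - 1) :=
  (dualityMap_mem hr v).1

theorem dualityMap_self {r : ℝ} (hr : 1 < r) (v : Y) : dualityMap r v v = ‖v‖ ^ r :=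
  (dualityMap_mem hr v).2

theorem le_modulusOfSmoothness {Y : Type*} [NormedAddCommGroup Y] {u v : Y} {ε : ℝ}
    (hu : ‖u‖ = 1) (hv : ‖v‖ ≤ ε) :
    ‖u + v‖ + ‖u - v‖ - 2 ≤ 2 * modulusOfSmoothness Y ε := by
  have hbdd : BddAbove {s : ℝ | ∃ u v : Y, ‖u‖ = 1 ∧ ‖v‖ ≤ ε ∧ s = ‖u + v‖ + ‖u - v‖ - 2} := by
    refine ⟨2 * ε, ?_⟩
    rintro _ ⟨u, v, hu, hv, rfl⟩
    have h1 := norm_add_le u v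
    have h2 := norm_sub_le u v
    linarith
  have := le_csSup hbdd ⟨u, v, hu, hv, rfl⟩
  rw [modulusOfSmoothness]
  linarith

/-- The modulus of smoothness controls the distance of norming functionals. For `‖v‖ ≤ ε`, add
`‖u + v‖ ≥ ψ (u + v)` and `‖u - v‖ ≥ φ (u - v)`. -/
theorem norm_sub_le_of_norming {u w : Y} {φ ψ : StrongDual ℝ Y} (hu : ‖u‖ = 1) (hφ : ‖φ‖ ≤ 1)
    (hφu : φ u = 1) (hψ : ‖ψ‖ ≤ 1) (hψw : ψ w = 1) {ε : ℝ} (hε : 0 < ε) :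
    ‖ψ - φ‖ ≤ 2 * (modulusOfSmoothness Y ε / ε) + ‖u - w‖ / ε := by
  have hle : ∀ (χ : StrongDual ℝ Y), ‖χ‖ ≤ 1 → ∀ v, |χ v| ≤ ‖v‖ := fun χ hχ v => by
    have := χ.le_of_opNorm_le hχ v
    rwa [one_mul, Real.norm_eq_abs] at this
  have key : ∀ v : Y, ‖v‖ ≤ ε → (ψ - φ) v ≤ 2 * modulusOfSmoothness Y ε + ‖u - w‖ := by
    intro v hv
    have h1 := le_modulusOfSmoothness hu hv
    have h2 := le_of_abs_le (hle ψ hψ (u + v))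
    have h3 := le_of_abs_le (hle φ hφ (u - v))
    have h4 := neg_le_of_abs_le (hle ψ hψ (u - w))
    rw [map_add] at h2
    rw [map_sub] at h3 h4
    rw [sub_apply]
    linarith
  have h0 : 0 ≤ 2 * modulusOfSmoothness Y ε + ‖u - w‖ := by simpa using key 0 (by simpa using hε.le)
  have hCeq : 2 * (modulusOfSmoothness Y ε / ε) + ‖u - w‖ / ε
      = (2 * modulusOfSmoothness Y ε + ‖u - w‖) / ε := by ring
  rw [hCeq]
  refine ContinuousLinearMap.opNorm_le_bound _ (by positivity) fun v => ?_
  rcases eq_or_ne v 0 with rfl | hv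
  · simp
  have hv' : 0 < ‖v‖ := norm_pos_iff.2 hv
  have hsc : ‖(ε / ‖v‖) • v‖ ≤ ε := by
    rw [norm_smul, Real.norm_of_nonneg (by positivity), div_mul_cancel₀ _ hv'.ne']
  have h1 := key _ hsc
  have h2 := key (-((ε / ‖v‖) • v)) (by rwa [norm_neg])
  rw [map_neg] at h2
  rw [map_smul, smul_eq_mul] at h1 h2
  have h3 : ε / ‖v‖ * |(ψ - φ) v| ≤ 2 * modulusOfSmoothness Y ε + ‖u - w‖ := by
    rw [← abs_of_pos (show 0 < ε / ‖v‖ by positivity), ← abs_mul]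
    exact abs_le.2 ⟨by linarith, h1⟩
  rw [Real.norm_eq_abs, div_mul_eq_mul_div, le_div_iff₀ hε]
  rw [div_mul_eq_mul_div, div_le_iff₀ hv'] at h3
  linarith

/-- In a uniformly smooth space the duality mapping is norm continuous away from the origin. -/
theorem tendsto_dualityMap (hY : IsUniformlySmooth Y) {r : ℝ} (hr : 1 < r) {v : Y} (hv : v ≠ 0)
    {ι : Type*} {l : Filter ι} {u : ι → Y} (hu : Tendsto u l (𝓝 v)) :
    Tendsto (fun n => dualityMap r (u n)) l (𝓝 (dualityMap r v)) := by
  -- normalized functionals and vectors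
  let G : Y → StrongDual ℝ Y := fun w => (‖w‖ ^ (r - 1))⁻¹ • dualityMap r w
  let U : Y → Y := fun w => ‖w‖⁻¹ • w
  have hG1 : ∀ w : Y, w ≠ 0 → ‖G w‖ ≤ 1 := by
    intro w hw
    have hw' : 0 < ‖w‖ ^ (r - 1) := Real.rpow_pos_of_pos (norm_pos_iff.2 hw) _
    simp only [G]
    rw [norm_smul, norm_inv, Real.norm_of_nonneg hw'.le, norm_dualityMap hr,
      inv_mul_cancel₀ hw'.ne']
  have hU1 : ∀ w : Y, w ≠ 0 → ‖U w‖ = 1 := by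
    intro w hw
    simp only [U]
    rw [norm_smul, norm_inv, norm_norm, inv_mul_cancel₀ (norm_ne_zero_iff.2 hw)]
  have hGU : ∀ w : Y, w ≠ 0 → G w (U w) = 1 := by
    intro w hw
    have hn : 0 < ‖w‖ := norm_pos_iff.2 hw
    have hw' : 0 < ‖w‖ ^ (r - 1) := Real.rpow_pos_of_pos hn _
    simp only [G, U, smul_apply, map_smul, dualityMap_self hr, smul_eq_mul]
    rw [show r = (r - 1) + 1 by ring, Real.rpow_add_one hn.ne', add_sub_cancel_right]
    field_simp
  have hJ : ∀ w : Y, w ≠ 0 → dualityMap r w = ‖w‖ ^ (r - 1) • G w := by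
    intro w hw
    have hw' : 0 < ‖w‖ ^ (r - 1) := Real.rpow_pos_of_pos (norm_pos_iff.2 hw) _
    simp only [G]
    rw [smul_smul, mul_inv_cancel₀ hw'.ne', one_smul]
  have hne : ∀ᶠ n in l, u n ≠ 0 := hu.eventually_ne hv
  have hUlim : Tendsto (fun n => U (u n)) l (𝓝 (U v)) :=
    (hu.norm.inv₀ (norm_ne_zero_iff.2 hv)).smul hu
  have hGlim : Tendsto (fun n => G (u n)) l (𝓝 (G v)) := by
    rw [Metric.tendsto_nhds]
    intro e he
    obtain ⟨ε, hε, hε0⟩ := ((hY.eventually (gt_mem_nhds (show (0 : ℝ) < e / 4 by positivity))).and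
      self_mem_nhdsWithin).exists
    have hε0 : 0 < ε := hε0
    have hd : Tendsto (fun n => ‖U v - U (u n)‖ / ε) l (𝓝 0) := by
      simpa using ((tendsto_const_nhds (x := U v)).sub hUlim).norm.div_const ε
    filter_upwards [hne, hd.eventually (gt_mem_nhds (show (0 : ℝ) < e / 2 by positivity))]
      with n hn hn2
    rw [dist_eq_norm]
    have := norm_sub_le_of_norming (hU1 v hv) (hG1 v hv) (hGU v hv) (hG1 _ hn) (hGU _ hn) hε0
    linarith
  rw [hJ v hv]
  have : Tendsto (fun n => ‖u n‖ ^ (r - 1) • G (u n)) l (𝓝 (‖v‖ ^ (r - 1) • G v)) :=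
    (hu.norm.rpow_const (Or.inl (norm_ne_zero_iff.2 hv))).smul hGlim
  refine this.congr' ?_
  filter_upwards [hne] with n hn
  rw [hJ _ hn]

variable {X : Type*} [NormedAddCommGroup X] [InnerProductSpace ℝ X] [CompleteSpace X]

theorem inner_adjointMap (A : X →L[ℝ] Y) (φ : StrongDual ℝ Y) (z : X) :
    inner ℝ (adjointMap A φ) z = φ (A z) := by
  rw [adjointMap, InnerProductSpace.toDual_symm_apply]
  rfl

theorem norm_adjointMap_le (A : X →L[ℝ] Y) (φ : StrongDual ℝ Y) :
    ‖adjointMap A φ‖ ≤ ‖A‖ * ‖φ‖ := by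
  rw [adjointMap, LinearIsometryEquiv.norm_map, mul_comm]
  exact ContinuousLinearMap.opNorm_comp_le _ _

theorem tendsto_adjointMap {ι : Type*} {l : Filter ι} {A : ι → X →L[ℝ] Y} {A₀ : X →L[ℝ] Y}
    {φ : ι → StrongDual ℝ Y} {φ₀ : StrongDual ℝ Y} (hA : Tendsto A l (𝓝 A₀))
    (hφ : Tendsto φ l (𝓝 φ₀)) :
    Tendsto (fun n => adjointMap (A n) (φ n)) l (𝓝 (adjointMap A₀ φ₀)) := by
  simp only [adjointMap]
  refine ((InnerProductSpace.toDual ℝ X).symm.continuous.tendsto _).comp ?_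
  exact ((isBoundedBilinearMap_comp (𝕜 := ℝ)).continuous.tendsto (φ₀, A₀)).comp
    (hφ.prodMk_nhds hA)

end Banach

/-! ### The standing assumptions and the geometry of the solution set -/

section Setting

variable {X : Type*} [NormedAddCommGroup X] [InnerProductSpace ℝ X]
  {N : ℕ} {Y : Fin N → Type*} [∀ i, NormedAddCommGroup (Y i)] [∀ i, NormedSpace ℝ (Y i)]

/-- All deterministic assumptions: the initial pair, the regularizer, the operators and the
parameters of the method. -/
structure Setting (Θ : X → EReal) (domF : Fin N → Set X) (F : ∀ i, X → Y i)
    (L : ∀ i, X → X →L[ℝ] Y i) (y : ∀ i, Y i) (x₀ ξ₀ : X) (ρ B₀ : ℝ) (q : Params) : Prop where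
  init : (x₀, ξ₀) ∈ subdiffGraph Θ
  reg : RegularizerAssumption Θ q.σ
  op : OperatorAssumption Θ domF F L y x₀ ξ₀ q.σ ρ B₀ q.η
  r_gt : 1 < q.r
  mu0_pos : 0 < q.μ₀
  mu0_lt : q.μ₀ < 4 * q.σ
  mu1_pos : 0 < q.μ₁
  ups0_pos : 0 < q.υ₀
  ups1_pos : 0 < q.υ₁
  beta_nonneg : 0 ≤ q.β
  beta_lt : q.β < 1
  tau_gt : (1 + q.η) / (1 - q.η) < q.τ
  N_pos : 0 < N

/-- Noise levels `δ`, possibly zero, and data within the noise levels of the exact ones. The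
choice `δ = 0` gives the method with exact data. -/
structure IsNoisyData {N : ℕ} {Y : Fin N → Type*} [∀ i, NormedAddCommGroup (Y i)]
    (y yδ : ∀ i, Y i) (δ : Fin N → ℝ) : Prop where
  nonneg : ∀ i, 0 ≤ δ i
  norm_sub_le : ∀ i, ‖yδ i - y i‖ ≤ δ i

theorem IsNoisyData.exact {N : ℕ} {Y : Fin N → Type*} [∀ i, NormedAddCommGroup (Y i)]
    (y : ∀ i, Y i) : IsNoisyData y y 0 :=
  ⟨fun _ => le_rfl, fun i => by simp⟩

theorem IsNoisyData.iInf_nonneg {N : ℕ} {Y : Fin N → Type*} [∀ i, NormedAddCommGroup (Y i)]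
    {y yδ : ∀ i, Y i} {δ : Fin N → ℝ} (hd : IsNoisyData y yδ δ) : 0 ≤ ⨅ i, δ i :=
  Real.iInf_nonneg hd.nonneg

theorem norm_sub_le_of_mem_closedBall {E : Type*} [SeminormedAddCommGroup E] {a u v : E} {R : ℝ}
    (hu : u ∈ Metric.closedBall a R) (hv : v ∈ Metric.closedBall a R) : ‖u - v‖ ≤ 2 * R := by
  have h1 := dist_triangle_right u v a
  rw [Metric.mem_closedBall] at hu hv
  rw [← dist_eq_norm]
  linarith

/-- The solutions in the ball where the assumptions on the operators hold, with finite value of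
the regularizer. -/
def localSolutions (Θ : X → EReal) (domF : Fin N → Set X) (F : ∀ i, X → Y i) (y : ∀ i, Y i)
    (x₀ : X) (ρ : ℝ) : Set X :=
  Metric.closedBall x₀ (2 * ρ) ∩ effDomain Θ ∩ solutionSet domF F y

variable {Θ : X → EReal} {domF : Fin N → Set X} {F : ∀ i, X → Y i}
  {L : ∀ i, X → X →L[ℝ] Y i} {y yδ : ∀ i, Y i} {x₀ ξ₀ : X} {ρ B₀ : ℝ} {q : Params}
  {δ : Fin N → ℝ} {x z : X} {i : Fin N}

namespace Setting

variable (S : Setting Θ domF F L y x₀ ξ₀ ρ B₀ q)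
include S

theorem sigma_pos : 0 < q.σ := S.reg.sigma_pos

theorem tau_pos : 0 < q.τ :=
  lt_of_le_of_lt (div_nonneg (by linarith [S.op.eta_nonneg]) (by linarith [S.op.eta_lt_one]))
    S.tau_gt

theorem exists_near_solution : ∃ x ∈ localSolutions Θ domF F y x₀ ρ,
    realBregman Θ ξ₀ x x₀ ≤ q.σ * ρ ^ 2 := by
  obtain ⟨x, hx, hD⟩ := S.op.exists_solution
  rw [bregman_eq_coe S.reg.proper ξ₀ hx.1 S.init.1, EReal.coe_le_coe_iff] at hD
  refine ⟨x, ⟨⟨?_, hx.1⟩, hx.2⟩, hD⟩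
  have h1 := (realBregman_ge S.reg S.init hx.1).trans hD
  have h2 : ‖x - x₀‖ ≤ ρ :=
    le_of_sq_le_sq (le_of_mul_le_mul_left h1 S.sigma_pos) S.op.rho_pos.le
  rw [mem_closedBall_iff_norm]
  linarith [S.op.rho_pos]

theorem norm_L_apply_le (hx : x ∈ Metric.closedBall x₀ (2 * ρ))
    (hz : z ∈ Metric.closedBall x₀ (2 * ρ)) (i : Fin N) :
    ‖L i x (x - z)‖ ≤ (1 + q.η) * ‖F i x - F i z‖ := by
  have h1 := S.op.tangential_cone i x hx z hz
  have h2 := norm_sub_norm_le (L i x (x - z)) (F i x - F i z)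
  rw [norm_sub_rev (L i x (x - z))] at h2
  linarith

theorem norm_F_sub_le (hx : x ∈ Metric.closedBall x₀ (2 * ρ))
    (hz : z ∈ Metric.closedBall x₀ (2 * ρ)) (i : Fin N) :
    ‖F i x - F i z‖ ≤ B₀ / (1 - q.η) * ‖x - z‖ := by
  have h1 := S.op.tangential_cone i x hx z hz
  have h2 := norm_sub_norm_le (F i x - F i z) (L i x (x - z))
  have h3 := (L i x).le_of_opNorm_le (S.op.norm_L_le i x hx) (x - z)
  have h4 := S.op.eta_lt_one
  rw [div_mul_eq_mul_div, le_div_iff₀ (by linarith)]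
  linarith

theorem tendsto_F {ι : Type*} {l : Filter ι} {u : ι → X}
    (hu : ∀ n, u n ∈ Metric.closedBall x₀ (2 * ρ)) (hx : x ∈ Metric.closedBall x₀ (2 * ρ))
    (hlim : Tendsto u l (𝓝 x)) (i : Fin N) : Tendsto (fun n => F i (u n)) l (𝓝 (F i x)) := by
  rw [tendsto_iff_norm_sub_tendsto_zero] at hlim ⊢
  refine squeeze_zero (fun _ => norm_nonneg _) (fun n => S.norm_F_sub_le (hu n) hx i) ?_
  simpa using hlim.const_mul (B₀ / (1 - q.η))

/-- By the tangential cone condition, the fibres of `F i` in the ball are cut out by the kernel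
of `L i x`. -/
theorem F_eq_iff (hx : x ∈ Metric.closedBall x₀ (2 * ρ))
    (hz : z ∈ Metric.closedBall x₀ (2 * ρ)) (i : Fin N) :
    F i x = F i z ↔ L i x (x - z) = 0 := by
  constructor
  · intro h
    have := S.norm_L_apply_le hx hz i
    rw [h, sub_self, norm_zero, mul_zero] at this
    exact norm_le_zero_iff.1 this
  · intro h
    have h1 := S.op.tangential_cone i x hx z hz
    rw [h, sub_zero] at h1
    have h4 := S.op.eta_lt_one
    have h5 := norm_nonneg (F i x - F i z)
    have h6 : ‖F i x - F i z‖ ≤ 0 := by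
      by_contra hc
      push Not at hc
      nlinarith
    exact sub_eq_zero.1 (norm_le_zero_iff.1 h6)

theorem mem_solutionSet_of_ball (hx : x ∈ Metric.closedBall x₀ (2 * ρ))
    (h : ∀ i, F i x = y i) : x ∈ solutionSet domF F y :=
  ⟨fun i => S.op.ball_subset i hx, h⟩

theorem isClosed_convex_ball_inter_solutionSet :
    IsClosed (Metric.closedBall x₀ (2 * ρ) ∩ solutionSet domF F y) ∧
      Convex ℝ (Metric.closedBall x₀ (2 * ρ) ∩ solutionSet domF F y) := by
  obtain ⟨a, ⟨⟨ha, -⟩, ha2⟩, -⟩ := S.exists_near_solution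
  have heq : Metric.closedBall x₀ (2 * ρ) ∩ solutionSet domF F y
      = Metric.closedBall x₀ (2 * ρ) ∩ ⋂ i, {x | L i a x = L i a a} := by
    ext x
    simp only [Set.mem_inter_iff, Set.mem_iInter, Set.mem_ofPred_eq, and_congr_right_iff]
    intro hx
    have hi : ∀ i, F i x = y i ↔ L i a x = L i a a := by
      intro i
      rw [← ha2.2 i, eq_comm, S.F_eq_iff ha hx i, map_sub, sub_eq_zero, eq_comm]
    constructor
    · intro h i
      exact (hi i).1 (h.2 i)
    · intro h
      exact S.mem_solutionSet_of_ball hx fun i => (hi i).2 (h i)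
  rw [heq]
  refine ⟨Metric.isClosed_closedBall.inter (isClosed_iInter fun i =>
    isClosed_eq (L i a).continuous continuous_const), (convex_closedBall _ _).inter
      (convex_iInter fun i => ?_)⟩
  intro u hu v hv s t hs ht hst
  simp only [Set.mem_ofPred_eq, map_add, map_smul] at *
  rw [hu, hv, ← add_smul, hst, one_smul]

theorem mem_localSolutions_of_minimal (h : IsMinimalDistanceSolution Θ domF F y x₀ ξ₀ x) :
    x ∈ localSolutions Θ domF F y x₀ ρ := by
  obtain ⟨a, ha, hD⟩ := S.exists_near_solution
  have h1 := h.2 a ⟨ha.1.2, ha.2⟩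
  rw [bregman_eq_coe S.reg.proper ξ₀ h.1.1 S.init.1,
    bregman_eq_coe S.reg.proper ξ₀ ha.1.2 S.init.1, EReal.coe_le_coe_iff] at h1
  have h2 := (realBregman_ge S.reg S.init h.1.1).trans (h1.trans hD)
  have h3 : ‖x - x₀‖ ≤ ρ :=
    le_of_sq_le_sq (le_of_mul_le_mul_left h2 S.sigma_pos) S.op.rho_pos.le
  refine ⟨⟨?_, h.1.1⟩, h.1.2⟩
  rw [mem_closedBall_iff_norm]
  linarith [S.op.rho_pos]

/-- There is exactly one solution of minimal Bregman distance: every candidate lies in the ball,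
where the solutions form a closed convex set. -/
theorem existsUnique_minimalDistanceSolution [CompleteSpace X] :
    ∃! xdag, IsMinimalDistanceSolution Θ domF F y x₀ ξ₀ xdag := by
  have hp := S.reg.proper
  obtain ⟨hclosed, hconv⟩ := S.isClosed_convex_ball_inter_solutionSet
  obtain ⟨a, ha, hD⟩ := S.exists_near_solution
  obtain ⟨x, hx, hmin⟩ := exists_minimizer S.reg S.init hclosed hconv
    ⟨a, ⟨ha.1.1, ha.2⟩, ha.1.2⟩ ξ₀
  have hmin' : ∀ z ∈ localSolutions Θ domF F y x₀ ρ,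
      realBregman Θ ξ₀ x x₀ ≤ realBregman Θ ξ₀ z x₀ := by
    intro z hz
    have := hmin z ⟨⟨hz.1.1, hz.2⟩, hz.1.2⟩
    simp only [realBregman, inner_sub_right]
    linarith
  refine ⟨x, ⟨⟨hx.2, hx.1.2⟩, fun z hz => ?_⟩, ?_⟩
  · rw [bregman_eq_coe hp ξ₀ hx.2 S.init.1, bregman_eq_coe hp ξ₀ hz.1 S.init.1,
      EReal.coe_le_coe_iff]
    by_cases hzb : z ∈ Metric.closedBall x₀ (2 * ρ)
    · exact hmin' z ⟨⟨hzb, hz.1⟩, hz.2⟩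
    · -- a solution outside the ball is too far from `x₀` to compete
      rw [mem_closedBall_iff_norm, not_le] at hzb
      have h1 := realBregman_ge S.reg S.init hz.1
      have h2 := hmin' a ha
      have h3 : q.σ * ρ ^ 2 ≤ q.σ * ‖z - x₀‖ ^ 2 := by
        have := S.op.rho_pos
        refine mul_le_mul_of_nonneg_left ?_ S.sigma_pos.le
        exact pow_le_pow_left₀ this.le (by linarith) 2
      linarith
  · intro w hw
    have hwl := S.mem_localSolutions_of_minimal hw
    obtain ⟨κ, hκ, hsc⟩ := S.reg.stronglyConvex
    obtain ⟨h1, h2⟩ := midpoint_of_stronglyConvex hp hsc hwl.1.2 hx.2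
    have h3 := hmin _ ⟨hconv ⟨hwl.1.1, hwl.2⟩ hx.1 (by norm_num) (by norm_num) (by norm_num), h1⟩
    have h4 := hw.2 x ⟨hx.2, hx.1.2⟩
    rw [bregman_eq_coe hp ξ₀ hx.2 S.init.1, bregman_eq_coe hp ξ₀ hwl.1.2 S.init.1,
      EReal.coe_le_coe_iff] at h4
    simp only [realBregman, inner_sub_right, inner_add_right, inner_smul_right] at h3 h4
    have h5 : κ / 4 * ‖w - x‖ ^ 2 ≤ 0 := by linarith
    have h6 : ‖w - x‖ ^ 2 ≤ 0 := by
      by_contra hc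
      push Not at hc
      have : 0 < κ / 4 * ‖w - x‖ ^ 2 := by positivity
      linarith
    exact sub_eq_zero.1 (norm_eq_zero.1
      (pow_eq_zero_iff two_ne_zero |>.1 (le_antisymm h6 (sq_nonneg _))))

end Setting

end Setting

/-! ### Estimates for a single batch -/

section Step

variable {X : Type*} [NormedAddCommGroup X] [InnerProductSpace ℝ X] [CompleteSpace X]
  {N : ℕ} {Y : Fin N → Type*} [∀ i, NormedAddCommGroup (Y i)] [∀ i, NormedSpace ℝ (Y i)]
  {Θ : X → EReal} {domF : Fin N → Set X} {F : ∀ i, X → Y i}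
  {L : ∀ i, X → X →L[ℝ] Y i} {y yδ : ∀ i, Y i} {x₀ ξ₀ : X} {ρ B₀ : ℝ} {q : Params}
  {δ : Fin N → ℝ} {J : Finset (Fin N)} {x z : X} {i : Fin N}

omit [NormedAddCommGroup X] [InnerProductSpace ℝ X] [CompleteSpace X]
  [∀ i, NormedSpace ℝ (Y i)] in
theorem psiTerm_nonneg : 0 ≤ psiTerm q F yδ δ J x :=
  Finset.sum_nonneg fun _ _ => Real.rpow_nonneg (norm_nonneg _) _

omit [NormedAddCommGroup X] [InnerProductSpace ℝ X] [CompleteSpace X]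
  [∀ i, NormedSpace ℝ (Y i)] in
theorem mem_violating : i ∈ violating q F yδ δ J x ↔ i ∈ J ∧ q.τ * δ i < ‖F i x - yδ i‖ := by
  simp [violating]

theorem stepSize_of_empty (h : violating q F yδ δ J x = ∅) : stepSize q F L yδ δ J x = 0 := by
  simp [stepSize, h]

namespace Setting

/-- The constant `c` in `c Ψ ≤ Φ`; it is positive by the choice of `τ`. -/
def gap (q : Params) : ℝ := (1 - q.η) - (1 + q.η) / q.τ

variable (S : Setting Θ domF F L y x₀ ξ₀ ρ B₀ q)
include S

omit [CompleteSpace X] in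
theorem gap_pos : 0 < gap q := by
  have h1 := S.tau_gt
  have h2 := S.tau_pos
  have h3 := S.op.eta_lt_one
  rw [div_lt_iff₀ (by linarith)] at h1
  rw [gap, sub_pos, div_lt_iff₀ h2]
  linarith

variable (hd : IsNoisyData y yδ δ)
include hd

omit [CompleteSpace X] in
theorem residual_pos (hi : i ∈ violating q F yδ δ J x) : 0 < ‖F i x - yδ i‖ :=
  lt_of_le_of_lt (mul_nonneg S.tau_pos.le (hd.nonneg i)) (mem_violating.1 hi).2

omit [CompleteSpace X] hd in
theorem gap_mul_residual_le (hi : i ∈ violating q F yδ δ J x) :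
    gap q * ‖F i x - yδ i‖ ≤ (1 - q.η) * ‖F i x - yδ i‖ - (1 + q.η) * δ i := by
  have h2 := S.tau_pos
  have h1 := (mem_violating.1 hi).2.le
  have h3 : δ i ≤ ‖F i x - yδ i‖ / q.τ := by
    rw [le_div_iff₀ h2]
    linarith
  have h4 := mul_le_mul_of_nonneg_left h3 (by linarith [S.op.eta_nonneg] : 0 ≤ 1 + q.η)
  rw [gap]
  calc _ = (1 - q.η) * ‖F i x - yδ i‖ - (1 + q.η) * (‖F i x - yδ i‖ / q.τ) := by ring
    _ ≤ _ := by linarith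

omit [CompleteSpace X] in
theorem gap_mul_psiTerm_le : gap q * psiTerm q F yδ δ J x ≤ phiTerm q F yδ δ J x := by
  rw [psiTerm, phiTerm, Finset.mul_sum]
  refine Finset.sum_le_sum fun i hi => ?_
  have h1 := S.residual_pos hd hi
  have h2 := mul_le_mul_of_nonneg_right (S.gap_mul_residual_le hi)
    (Real.rpow_nonneg h1.le (q.r - 1))
  rwa [mul_assoc, mul_comm ‖F i x - yδ i‖, ← Real.rpow_add_one h1.ne', sub_add_cancel] at h2

omit [CompleteSpace X] in
theorem phiTerm_le_psiTerm : phiTerm q F yδ δ J x ≤ psiTerm q F yδ δ J x := by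
  rw [psiTerm, phiTerm]
  refine Finset.sum_le_sum fun i hi => ?_
  have h1 := S.residual_pos hd hi
  have h0 := hd.nonneg i
  have h3 := S.op.eta_nonneg
  have h2 : (1 - q.η) * ‖F i x - yδ i‖ - (1 + q.η) * δ i ≤ ‖F i x - yδ i‖ := by nlinarith
  have h4 := mul_le_mul_of_nonneg_right h2 (Real.rpow_nonneg h1.le (q.r - 1))
  rwa [mul_comm ‖F i x - yδ i‖ (_ ^ _), ← Real.rpow_add_one h1.ne', sub_add_cancel] at h4

omit [CompleteSpace X] in
theorem phiTerm_nonneg : 0 ≤ phiTerm q F yδ δ J x :=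
  (mul_nonneg S.gap_pos.le psiTerm_nonneg).trans (S.gap_mul_psiTerm_le hd)

omit [CompleteSpace X] in
theorem psiTerm_pos (h : (violating q F yδ δ J x).Nonempty) : 0 < psiTerm q F yδ δ J x :=
  Finset.sum_pos (fun _ hi => Real.rpow_pos_of_pos (S.residual_pos hd hi) _) h

omit [CompleteSpace X] in
theorem phiTerm_pos (h : (violating q F yδ δ J x).Nonempty) : 0 < phiTerm q F yδ δ J x :=
  (mul_pos S.gap_pos (S.psiTerm_pos hd h)).trans_le (S.gap_mul_psiTerm_le hd)

/-- The search direction points towards every solution in the ball. -/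
theorem phiTerm_le_inner_gradTerm (hx : x ∈ Metric.closedBall x₀ (2 * ρ))
    (hz : z ∈ localSolutions Θ domF F y x₀ ρ) :
    phiTerm q F yδ δ J x ≤ inner ℝ (gradTerm q F L yδ δ J x) (x - z) := by
  rw [phiTerm, gradTerm, sum_inner]
  refine Finset.sum_le_sum fun i hi => ?_
  have hr := S.residual_pos hd hi
  rw [inner_adjointMap]
  set φ := dualityMap q.r (F i x - yδ i)
  have h1 := S.op.tangential_cone i x hx z hz.1.1
  rw [hz.2.2 i] at h1
  have h2 : L i x (x - z) = (F i x - yδ i) + (yδ i - y i)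
      - (F i x - y i - L i x (x - z)) := by abel
  have hφ : ∀ v, |φ v| ≤ ‖F i x - yδ i‖ ^ (q.r - 1) * ‖v‖ := fun v =>
    φ.le_of_opNorm_le (norm_dualityMap S.r_gt _).le v
  have h3 := neg_le_of_abs_le (hφ (yδ i - y i))
  have h4 := le_of_abs_le (hφ (F i x - y i - L i x (x - z)))
  have h5 : φ (F i x - yδ i) = ‖F i x - yδ i‖ * ‖F i x - yδ i‖ ^ (q.r - 1) := by
    rw [dualityMap_self S.r_gt, mul_comm, ← Real.rpow_add_one hr.ne', sub_add_cancel]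
  rw [h2, map_sub, map_add, h5]
  have h6 := hd.norm_sub_le i
  have h7 : ‖F i x - y i‖ ≤ ‖F i x - yδ i‖ + δ i := by
    calc _ = ‖(F i x - yδ i) + (yδ i - y i)‖ := by congr 1; abel
      _ ≤ _ := (norm_add_le _ _).trans (by linarith)
  have h8 : ‖F i x - y i - L i x (x - z)‖ ≤ q.η * (‖F i x - yδ i‖ + δ i) :=
    h1.trans (mul_le_mul_of_nonneg_left h7 S.op.eta_nonneg)
  have h9 := Real.rpow_nonneg hr.le (q.r - 1)
  have h10 := mul_le_mul_of_nonneg_left h8 h9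
  have h11 := mul_le_mul_of_nonneg_left h6 h9
  linarith

theorem gradTerm_ne_zero (hx : x ∈ Metric.closedBall x₀ (2 * ρ))
    (h : (violating q F yδ δ J x).Nonempty) : gradTerm q F L yδ δ J x ≠ 0 := by
  obtain ⟨z, hz, -⟩ := S.exists_near_solution
  intro h0
  have h1 := S.phiTerm_le_inner_gradTerm hd hx hz (J := J)
  rw [h0, inner_zero_left] at h1
  exact absurd h1 (not_le.2 (S.phiTerm_pos hd h))

theorem stepSize_nonneg : 0 ≤ stepSize q F L yδ δ J x := by
  rw [stepSize]
  split_ifs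
  · exact le_min (div_nonneg (mul_nonneg S.mu0_pos.le (S.phiTerm_nonneg hd)) (sq_nonneg _))
      (mul_nonneg S.mu1_pos.le (Real.rpow_nonneg psiTerm_nonneg _))
  · exact le_rfl

/-- A vanishing search direction does no harm: the quotient in the step size is then zero. -/
theorem stepSize_mul_norm_sq_le :
    stepSize q F L yδ δ J x * ‖gradTerm q F L yδ δ J x‖ ^ 2 ≤ q.μ₀ * phiTerm q F yδ δ J x := by
  have h0 := mul_nonneg S.mu0_pos.le (S.phiTerm_nonneg hd (J := J) (x := x))
  rcases eq_or_ne (gradTerm q F L yδ δ J x) 0 with hg | hg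
  · rw [hg, norm_zero]
    simpa using h0
  have hg' : 0 < ‖gradTerm q F L yδ δ J x‖ ^ 2 := by
    have := norm_pos_iff.2 hg
    positivity
  rw [← le_div_iff₀ hg', stepSize]
  split_ifs
  · exact min_le_left _ _
  · exact div_nonneg h0 hg'.le

omit hd in
theorem stepSize_le : stepSize q F L yδ δ J x ≤ q.μ₁ * psiTerm q F yδ δ J x ^ (2 / q.r - 1) := by
  rw [stepSize]
  split_ifs
  · exact min_le_right _ _
  · exact mul_nonneg S.mu1_pos.le (Real.rpow_nonneg psiTerm_nonneg _)

omit [CompleteSpace X] hd in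
theorem residual_le_psiTerm_rpow (hi : i ∈ violating q F yδ δ J x) :
    ‖F i x - yδ i‖ ≤ psiTerm q F yδ δ J x ^ (1 / q.r) := by
  have hr0 : 0 < q.r := by linarith [S.r_gt]
  have h1 : ‖F i x - yδ i‖ ^ q.r ≤ psiTerm q F yδ δ J x :=
    Finset.single_le_sum (f := fun i => ‖F i x - yδ i‖ ^ q.r)
      (fun _ _ => Real.rpow_nonneg (norm_nonneg _) _) hi
  have h2 := Real.rpow_le_rpow (Real.rpow_nonneg (norm_nonneg _) _) h1
    (by positivity : 0 ≤ 1 / q.r)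
  rwa [← Real.rpow_mul (norm_nonneg _), mul_one_div_cancel hr0.ne', Real.rpow_one] at h2

omit hd in
theorem norm_gradTerm_le_sum (hx : x ∈ Metric.closedBall x₀ (2 * ρ)) :
    ‖gradTerm q F L yδ δ J x‖
      ≤ B₀ * ∑ i ∈ violating q F yδ δ J x, ‖F i x - yδ i‖ ^ (q.r - 1) := by
  rw [gradTerm, Finset.mul_sum]
  refine (norm_sum_le _ _).trans (Finset.sum_le_sum fun i _ => ?_)
  refine (norm_adjointMap_le _ _).trans ?_
  rw [norm_dualityMap S.r_gt]
  exact mul_le_mul_of_nonneg_right (S.op.norm_L_le i x hx) (Real.rpow_nonneg (norm_nonneg _) _)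

omit hd in
theorem norm_gradTerm_le (hx : x ∈ Metric.closedBall x₀ (2 * ρ)) :
    ‖gradTerm q F L yδ δ J x‖
      ≤ B₀ * N * (psiTerm q F yδ δ J x ^ (1 / q.r)) ^ (q.r - 1) := by
  refine (S.norm_gradTerm_le_sum hx).trans ?_
  rw [mul_assoc]
  refine mul_le_mul_of_nonneg_left ?_ S.op.B_pos.le
  have h1 : ∀ i ∈ violating q F yδ δ J x, ‖F i x - yδ i‖ ^ (q.r - 1)
      ≤ (psiTerm q F yδ δ J x ^ (1 / q.r)) ^ (q.r - 1) := fun i hi =>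
    Real.rpow_le_rpow (norm_nonneg _) (S.residual_le_psiTerm_rpow hi) (by linarith [S.r_gt])
  refine (Finset.sum_le_card_nsmul _ _ _ h1).trans ?_
  rw [nsmul_eq_mul]
  refine mul_le_mul_of_nonneg_right ?_
    (Real.rpow_nonneg (Real.rpow_nonneg psiTerm_nonneg _) _)
  have := Finset.card_le_univ (violating q F yδ δ J x)
  rw [Fintype.card_fin] at this
  exact_mod_cast this

/-- The guaranteed decrease `t Φ` dominates the squared residuals of the violated equations. -/
theorem residual_sq_le (hx : x ∈ Metric.closedBall x₀ (2 * ρ))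
    (hi : i ∈ violating q F yδ δ J x) :
    gap q * min (q.μ₀ * gap q / (B₀ * N) ^ 2) q.μ₁ * ‖F i x - yδ i‖ ^ 2
      ≤ stepSize q F L yδ δ J x * phiTerm q F yδ δ J x := by
  have hne : (violating q F yδ δ J x).Nonempty := ⟨i, hi⟩
  have hr0 : 0 < q.r := by linarith [S.r_gt]
  have hgap := S.gap_pos
  have hB : 0 < B₀ * N := mul_pos S.op.B_pos (by exact_mod_cast S.N_pos)
  have hμ₀ := S.mu0_pos
  have hμ₁ := S.mu1_pos
  set Ψ := psiTerm q F yδ δ J x with hΨ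
  have hΨ0 : 0 < Ψ := S.psiTerm_pos hd hne
  -- `M` is an `ℓ^r` norm of the residuals; all quantities of the step are powers of it
  set M := Ψ ^ (1 / q.r) with hM
  have hM0 : 0 < M := Real.rpow_pos_of_pos hΨ0 _
  have hΨM : Ψ = M ^ q.r := by
    rw [hM, ← Real.rpow_mul hΨ0.le, one_div_mul_cancel hr0.ne', Real.rpow_one]
  have hpow : Ψ ^ (2 / q.r - 1) = M ^ (2 - q.r) := by
    rw [hM, ← Real.rpow_mul hΨ0.le]
    congr 1
    field_simp
  have hg : 0 < ‖gradTerm q F L yδ δ J x‖ := norm_pos_iff.2 (S.gradTerm_ne_zero hd hx hne)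
  have ht : min (q.μ₀ * gap q / (B₀ * N) ^ 2) q.μ₁ * M ^ (2 - q.r)
      ≤ stepSize q F L yδ δ J x := by
    rw [stepSize, if_pos hne, ← hΨ, hpow]
    refine le_min ?_ (mul_le_mul_of_nonneg_right (min_le_right _ _) (by positivity))
    refine (mul_le_mul_of_nonneg_right (min_le_left _ _) (by positivity)).trans ?_
    have h1 := S.norm_gradTerm_le (yδ := yδ) (δ := δ) hx (J := J)
    rw [← hΨ, ← hM] at h1
    have h2 : ‖gradTerm q F L yδ δ J x‖ ^ 2 ≤ (B₀ * N) ^ 2 * (M ^ (q.r - 1)) ^ 2 := by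
      rw [← mul_pow]
      exact pow_le_pow_left₀ hg.le h1 2
    have h3 : M ^ (2 - q.r) * (M ^ (q.r - 1)) ^ 2 = M ^ q.r := by
      rw [← Real.rpow_natCast (M ^ (q.r - 1)) 2, ← Real.rpow_mul hM0.le, ← Real.rpow_add hM0]
      congr 1
      push_cast
      ring
    rw [le_div_iff₀ (by positivity), div_mul_eq_mul_div, div_mul_eq_mul_div,
      div_le_iff₀ (by positivity)]
    calc q.μ₀ * gap q * M ^ (2 - q.r) * ‖gradTerm q F L yδ δ J x‖ ^ 2
        ≤ q.μ₀ * gap q * M ^ (2 - q.r) * ((B₀ * N) ^ 2 * (M ^ (q.r - 1)) ^ 2) :=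
          mul_le_mul_of_nonneg_left h2 (by positivity)
      _ = q.μ₀ * (gap q * (M ^ (2 - q.r) * (M ^ (q.r - 1)) ^ 2)) * (B₀ * N) ^ 2 := by ring
      _ ≤ q.μ₀ * phiTerm q F yδ δ J x * (B₀ * N) ^ 2 := by
          rw [h3, ← hΨM]
          refine mul_le_mul_of_nonneg_right (mul_le_mul_of_nonneg_left ?_ hμ₀.le) (by positivity)
          exact S.gap_mul_psiTerm_le hd
  have h4 := mul_le_mul ht (S.gap_mul_psiTerm_le hd (J := J) (x := x))
    (mul_nonneg hgap.le psiTerm_nonneg) (S.stepSize_nonneg hd)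
  refine le_trans ?_ h4
  have h5 : M ^ (2 - q.r) * Ψ = M ^ 2 := by
    rw [hΨM, ← Real.rpow_add hM0, sub_add_cancel]
    exact_mod_cast Real.rpow_natCast M 2
  have h6 : ‖F i x - yδ i‖ ^ 2 ≤ M ^ 2 :=
    pow_le_pow_left₀ (norm_nonneg _) (S.residual_le_psiTerm_rpow hi) 2
  have hmin : 0 < min (q.μ₀ * gap q / (B₀ * N) ^ 2) q.μ₁ := lt_min (by positivity) hμ₁
  calc _ ≤ gap q * min (q.μ₀ * gap q / (B₀ * N) ^ 2) q.μ₁ * M ^ 2 :=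
        mul_le_mul_of_nonneg_left h6 (by positivity)
    _ = _ := by rw [← h5]; ring

/-- If `K` bounds the residuals then the step, weighted by one residual functional, is of
order `K`, for every gauge exponent. -/
theorem stepSize_mul_rpow_le {K : ℝ} (hK : ∀ i ∈ violating q F yδ δ J x, ‖F i x - yδ i‖ ≤ K)
    (hi : i ∈ violating q F yδ δ J x) :
    stepSize q F L yδ δ J x * ‖F i x - yδ i‖ ^ (q.r - 1) ≤ q.μ₁ * (N * K) := by
  have hne : (violating q F yδ δ J x).Nonempty := ⟨i, hi⟩
  have hr1 := S.r_gt
  have hr0 : 0 < q.r := by linarith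
  have hμ₁ := S.mu1_pos
  set Ψ := psiTerm q F yδ δ J x with hΨ
  have hΨ0 : 0 < Ψ := S.psiTerm_pos hd hne
  set M := Ψ ^ (1 / q.r) with hM
  have hM0 : 0 < M := Real.rpow_pos_of_pos hΨ0 _
  have hpow : Ψ ^ (2 / q.r - 1) = M ^ (2 - q.r) := by
    rw [hM, ← Real.rpow_mul hΨ0.le]
    congr 1
    field_simp
  have hK0 : 0 ≤ K := (norm_nonneg _).trans (hK i hi)
  have hN1 : (1 : ℝ) ≤ N := by exact_mod_cast S.N_pos
  have hMK : M ≤ N * K := by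
    have h1 : Ψ ≤ N * K ^ q.r := by
      have h2 : ∀ i ∈ violating q F yδ δ J x, ‖F i x - yδ i‖ ^ q.r ≤ K ^ q.r := fun i hi =>
        Real.rpow_le_rpow (norm_nonneg _) (hK i hi) hr0.le
      refine (Finset.sum_le_card_nsmul _ _ _ h2).trans ?_
      rw [nsmul_eq_mul]
      refine mul_le_mul_of_nonneg_right ?_ (Real.rpow_nonneg hK0 _)
      have := Finset.card_le_univ (violating q F yδ δ J x)
      rw [Fintype.card_fin] at this
      exact_mod_cast this
    have h3 : M ≤ (N * K ^ q.r) ^ (1 / q.r) := Real.rpow_le_rpow hΨ0.le h1 (by positivity)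
    rw [Real.mul_rpow (by positivity) (Real.rpow_nonneg hK0 _), ← Real.rpow_mul hK0,
      mul_one_div_cancel hr0.ne', Real.rpow_one] at h3
    refine h3.trans (mul_le_mul_of_nonneg_right ?_ hK0)
    calc (N : ℝ) ^ (1 / q.r) ≤ (N : ℝ) ^ (1 : ℝ) :=
          Real.rpow_le_rpow_of_exponent_le hN1 (by rw [div_le_one hr0]; exact hr1.le)
      _ = N := Real.rpow_one _
  have h4 := S.stepSize_le (yδ := yδ) (δ := δ) (J := J) (x := x)
  rw [← hΨ, hpow] at h4
  have h5 : ‖F i x - yδ i‖ ^ (q.r - 1) ≤ M ^ (q.r - 1) :=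
    Real.rpow_le_rpow (norm_nonneg _) (S.residual_le_psiTerm_rpow hi) (by linarith)
  calc _ ≤ q.μ₁ * M ^ (2 - q.r) * M ^ (q.r - 1) :=
        mul_le_mul h4 h5 (Real.rpow_nonneg (norm_nonneg _) _) (by positivity)
    _ = q.μ₁ * M := by
        rw [mul_assoc, ← Real.rpow_add hM0]
        norm_num
    _ ≤ q.μ₁ * (N * K) := mul_le_mul_of_nonneg_left hMK hμ₁.le

theorem stepSize_mul_sum_le {K A : ℝ} (hA : 0 ≤ A) (a : Fin N → ℝ)
    (hK : ∀ i ∈ violating q F yδ δ J x, ‖F i x - yδ i‖ ≤ K)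
    (ha : ∀ i ∈ violating q F yδ δ J x, a i ≤ A) (hK0 : 0 ≤ K) :
    stepSize q F L yδ δ J x * ∑ i ∈ violating q F yδ δ J x, ‖F i x - yδ i‖ ^ (q.r - 1) * a i
      ≤ q.μ₁ * N ^ 2 * K * A := by
  rw [Finset.mul_sum]
  have h1 : ∀ i ∈ violating q F yδ δ J x,
      stepSize q F L yδ δ J x * (‖F i x - yδ i‖ ^ (q.r - 1) * a i) ≤ q.μ₁ * (N * K) * A := by
    intro i hi
    have h2 := S.stepSize_mul_rpow_le hd hK hi (L := L)
    have h3 : 0 ≤ stepSize q F L yδ δ J x * ‖F i x - yδ i‖ ^ (q.r - 1) :=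
      mul_nonneg (S.stepSize_nonneg hd) (Real.rpow_nonneg (norm_nonneg _) _)
    rw [← mul_assoc]
    exact (mul_le_mul_of_nonneg_left (ha i hi) h3).trans (mul_le_mul_of_nonneg_right h2 hA)
  refine (Finset.sum_le_card_nsmul _ _ _ h1).trans ?_
  rw [nsmul_eq_mul]
  have h4 : ((violating q F yδ δ J x).card : ℝ) ≤ N := by
    have := Finset.card_le_univ (violating q F yδ δ J x)
    rw [Fintype.card_fin] at this
    exact_mod_cast this
  have hμ₁ := S.mu1_pos
  calc _ ≤ (N : ℝ) * (q.μ₁ * (N * K) * A) := mul_le_mul_of_nonneg_right h4 (by positivity)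
    _ = _ := by ring

theorem stepSize_mul_norm_gradTerm_le (hx : x ∈ Metric.closedBall x₀ (2 * ρ)) {K : ℝ}
    (hK : ∀ i ∈ violating q F yδ δ J x, ‖F i x - yδ i‖ ≤ K) (hK0 : 0 ≤ K) :
    stepSize q F L yδ δ J x * ‖gradTerm q F L yδ δ J x‖ ≤ q.μ₁ * N ^ 2 * K * B₀ := by
  have h1 := S.stepSize_mul_sum_le hd S.op.B_pos.le (fun _ => B₀) hK (fun _ _ => le_rfl) hK0
    (L := L)
  refine (mul_le_mul_of_nonneg_left (S.norm_gradTerm_le_sum hx) (S.stepSize_nonneg hd)).trans ?_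
  rwa [← Finset.sum_mul, mul_comm _ B₀] at h1

theorem stepSize_mul_phiTerm_le {K : ℝ}
    (hK : ∀ i ∈ violating q F yδ δ J x, ‖F i x - yδ i‖ ≤ K) (hK0 : 0 ≤ K) :
    stepSize q F L yδ δ J x * phiTerm q F yδ δ J x ≤ q.μ₁ * N ^ 2 * K * K := by
  have h1 := S.stepSize_mul_sum_le hd hK0 (fun i => ‖F i x - yδ i‖) hK hK hK0 (L := L)
  refine (mul_le_mul_of_nonneg_left (S.phiTerm_le_psiTerm hd) (S.stepSize_nonneg hd)).trans ?_
  refine le_trans (le_of_eq ?_) h1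
  rw [psiTerm]
  congr 1
  refine Finset.sum_congr rfl fun i hi => ?_
  rw [← Real.rpow_add_one (S.residual_pos hd hi).ne', sub_add_cancel]

end Setting

end Step

/-! ### Momentum coefficient and descent of the Bregman distance -/

section Momentum

variable {X : Type*} [NormedAddCommGroup X] [InnerProductSpace ℝ X]
  {q : Params} {δmin t γ : ℝ} {g m : X}

theorem momentumCoeff_le (hβ : 0 ≤ q.β) : momentumCoeff q δmin t g m γ ≤ q.β := by
  rw [momentumCoeff]
  split_ifs
  · exact min_le_right _ _
  · exact hβ

/-- Without noise the first condition in the definition admits `m = 0`; the quotient is then zero,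
by the convention for division. -/
theorem momentumCoeff_zero_right (hβ : 0 ≤ q.β) : momentumCoeff q δmin t g (0 : X) γ = 0 := by
  rw [momentumCoeff]
  split_ifs
  · simpa using hβ
  · rfl

theorem le_of_momentumCoeff_ne_zero (h : momentumCoeff q δmin t g m γ ≠ 0) :
    q.υ₀ * δmin ≤ ‖m‖ ∧ γ - t / (2 * q.σ) * inner ℝ g m ≤ -(q.υ₁ * δmin * ‖m‖ ^ 2) := by
  rw [momentumCoeff] at h
  exact (ite_ne_right_iff.1 h).1

/-- The unconstrained minimizer of the quadratic model in `β`. -/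
theorem momentum_quotient_eq (hσ : 0 < q.σ) :
    (t * inner ℝ g m - 2 * q.σ * γ) / ‖m‖ ^ 2
      = 2 * q.σ * -(γ - t / (2 * q.σ) * inner ℝ g m) / ‖m‖ ^ 2 := by
  congr 1
  field_simp
  ring

theorem momentumCoeff_nonneg (hσ : 0 < q.σ) (hβ : 0 ≤ q.β) (hυ₁ : 0 ≤ q.υ₁) (hδ : 0 ≤ δmin) :
    0 ≤ momentumCoeff q δmin t g m γ := by
  rw [momentumCoeff]
  split_ifs with h
  · refine le_min ?_ hβ
    rw [momentum_quotient_eq hσ]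
    have : 0 ≤ q.υ₁ * δmin * ‖m‖ ^ 2 := by positivity
    exact div_nonneg (mul_nonneg (by positivity) (by linarith [h.2])) (sq_nonneg _)
  · exact le_rfl

/-- The momentum term makes the quadratic model decrease. -/
theorem momentumCoeff_model_le (hσ : 0 < q.σ) (hβ : 0 ≤ q.β) (hυ₁ : 0 ≤ q.υ₁) (hδ : 0 ≤ δmin) :
    momentumCoeff q δmin t g m γ ^ 2 * ‖m‖ ^ 2 / (4 * q.σ)
        + momentumCoeff q δmin t g m γ * (γ - t / (2 * q.σ) * inner ℝ g m)
      ≤ -(momentumCoeff q δmin t g m γ * (q.υ₁ * δmin * ‖m‖ ^ 2) / 2) := by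
  rcases eq_or_ne m 0 with rfl | hm
  · rw [momentumCoeff_zero_right hβ]
    simp
  have hm' : 0 < ‖m‖ ^ 2 := by
    have := norm_pos_iff.2 hm
    positivity
  have h0 := momentumCoeff_nonneg (t := t) (γ := γ) (g := g) (m := m) hσ hβ hυ₁ hδ
  by_cases h : momentumCoeff q δmin t g m γ = 0
  · rw [h]
    simp
  obtain ⟨h1, h2⟩ := le_of_momentumCoeff_ne_zero h
  have h3 : momentumCoeff q δmin t g m γ * ‖m‖ ^ 2
      ≤ 2 * q.σ * -(γ - t / (2 * q.σ) * inner ℝ g m) := by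
    rw [← le_div_iff₀ hm', ← momentum_quotient_eq hσ, momentumCoeff, if_pos ⟨h1, h2⟩]
    exact min_le_left _ _
  set β := momentumCoeff q δmin t g m γ
  set w := γ - t / (2 * q.σ) * inner ℝ g m
  have h4 : β ^ 2 * ‖m‖ ^ 2 / (4 * q.σ) ≤ β * -w / 2 := by
    rw [div_le_iff₀ (by positivity)]
    have := mul_le_mul_of_nonneg_left h3 h0
    linarith
  have h5 := mul_le_mul_of_nonneg_left h2 h0
  linarith

/-- For positive noise level a nonzero momentum coefficient is bounded away from zero. -/
theorem exists_pos_le_momentumCoeff (hσ : 0 < q.σ) (hβ : 0 ≤ q.β) (hυ₀ : 0 < q.υ₀)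
    (hυ₁ : 0 < q.υ₁) (hδ : 0 < δmin) :
    ∃ b > 0, ∀ (t γ : ℝ) (g m : X), momentumCoeff q δmin t g m γ ≠ 0 →
      b ≤ momentumCoeff q δmin t g m γ := by
  have key : ∀ (t γ : ℝ) (g m : X), momentumCoeff q δmin t g m γ ≠ 0 →
      min (2 * q.σ * (q.υ₁ * δmin)) q.β ≤ momentumCoeff q δmin t g m γ := by
    intro t γ g m h
    obtain ⟨h1, h2⟩ := le_of_momentumCoeff_ne_zero h
    rw [momentumCoeff, if_pos ⟨h1, h2⟩]
    refine min_le_min_right _ ?_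
    have hm : 0 < ‖m‖ ^ 2 := by
      have : 0 < ‖m‖ := lt_of_lt_of_le (by positivity) h1
      positivity
    rw [momentum_quotient_eq hσ, le_div_iff₀ hm, mul_assoc]
    exact mul_le_mul_of_nonneg_left (by linarith) (by positivity)
  rcases hβ.eq_or_lt with h0 | h0
  · refine ⟨1, one_pos, fun t γ g m h => absurd ?_ h⟩
    have h1 := momentumCoeff_le (δmin := δmin) (t := t) (γ := γ) (g := g) (m := m) hβ
    have h2 := momentumCoeff_nonneg (t := t) (γ := γ) (g := g) (m := m) hσ hβ hυ₁.le hδ.le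
    linarith
  · exact ⟨_, lt_min (by positivity) h0, key⟩

end Momentum

section Iteration

variable {X : Type*} [NormedAddCommGroup X] [InnerProductSpace ℝ X] [CompleteSpace X]
  {N : ℕ} {Y : Fin N → Type*} [∀ i, NormedAddCommGroup (Y i)] [∀ i, NormedSpace ℝ (Y i)]
  {Θ : X → EReal} {domF : Fin N → Set X} {F : ∀ i, X → Y i}
  {L : ∀ i, X → X →L[ℝ] Y i} {y yδ : ∀ i, Y i} {x₀ ξ₀ : X} {ρ B₀ : ℝ} {q : Params}
  {δ : Fin N → ℝ} {J : Finset (Fin N)} {I : ℕ → Finset (Fin N)} {x z : X} {i : Fin N}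
  {s : State X N}

/-- The momentum coefficient used by the method in state `s` with batch `J`. -/
def stateMomentum (q : Params) (F : ∀ i, X → Y i) (L : ∀ i, X → X →L[ℝ] Y i)
    (yδ : ∀ i, Y i) (δ : Fin N → ℝ) (J : Finset (Fin N)) (s : State X N) : ℝ :=
  momentumCoeff q (⨅ i, δ i) (stepSize q F L yδ δ J s.x) (gradTerm q F L yδ δ J s.x)
    (s.ξ - s.ξprev) s.γ

theorem step_ξ : (step q Θ F L yδ δ J s).ξ = s.ξ
    - stepSize q F L yδ δ J s.x • gradTerm q F L yδ δ J s.x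
    + stateMomentum q F L yδ δ J s • (s.ξ - s.ξprev) := rfl

theorem step_ξprev : (step q Θ F L yδ δ J s).ξprev = s.ξ := rfl

theorem step_x : (step q Θ F L yδ δ J s).x = argMin Θ (step q Θ F L yδ δ J s).ξ := rfl

theorem step_γ : (step q Θ F L yδ δ J s).γ
    = inner ℝ ((step q Θ F L yδ δ J s).ξ - s.ξ) ((step q Θ F L yδ δ J s).x - s.x)
      - stepSize q F L yδ δ J s.x * phiTerm q F yδ δ J s.x
      + stateMomentum q F L yδ δ J s * s.γ := rfl

open Classical in
theorem step_active : (step q Θ F L yδ δ J s).active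
    = if violating q F yδ δ J s.x = ∅ ∧ stateMomentum q F L yδ δ J s = 0 then s.active \ J
      else Finset.univ := rfl

/-- The invariants of the method: the iterate belongs to the dual iterate, it has not moved away
from any solution in the ball, it lies in the ball, and `γ` bounds the inner products that the
momentum step would need to know. -/
structure Admissible (Θ : X → EReal) (domF : Fin N → Set X) (F : ∀ i, X → Y i) (y : ∀ i, Y i)
    (x₀ ξ₀ : X) (ρ : ℝ) (s : State X N) : Prop where
  x_eq : s.x = argMin Θ s.ξ
  mem_ball : s.x ∈ Metric.closedBall x₀ (2 * ρ)
  bregman_le : ∀ z ∈ localSolutions Θ domF F y x₀ ρ,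
    realBregman Θ s.ξ z s.x ≤ realBregman Θ ξ₀ z x₀
  inner_le : ∀ z ∈ localSolutions Θ domF F y x₀ ρ, inner ℝ (s.ξ - s.ξprev) (s.x - z) ≤ s.γ

namespace Setting

variable (S : Setting Θ domF F L y x₀ ξ₀ ρ B₀ q)
include S

theorem mem_subdiffGraph (hs : Admissible Θ domF F y x₀ ξ₀ ρ s) :
    (s.x, s.ξ) ∈ subdiffGraph Θ := by
  rw [hs.x_eq]
  exact argMin_mem_subdiffGraph S.reg S.init _

variable (hd : IsNoisyData y yδ δ)
include hd

theorem stateMomentum_nonneg : 0 ≤ stateMomentum q F L yδ δ J s :=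
  momentumCoeff_nonneg S.sigma_pos S.beta_nonneg S.ups1_pos.le hd.iInf_nonneg

omit hd in
theorem stateMomentum_le : stateMomentum q F L yδ δ J s ≤ q.β :=
  momentumCoeff_le S.beta_nonneg

/-- Every step decreases the Bregman distance to every solution in the ball. -/
theorem step_descent (hs : Admissible Θ domF F y x₀ ξ₀ ρ s)
    (hz : z ∈ localSolutions Θ domF F y x₀ ρ) :
    realBregman Θ (step q Θ F L yδ δ J s).ξ z (step q Θ F L yδ δ J s).x
        + (1 - q.μ₀ / (4 * q.σ)) * (stepSize q F L yδ δ J s.x * phiTerm q F yδ δ J s.x)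
        + stateMomentum q F L yδ δ J s * (q.υ₁ * (⨅ i, δ i) * ‖s.ξ - s.ξprev‖ ^ 2) / 2
      ≤ realBregman Θ s.ξ z s.x := by
  have hσ := S.sigma_pos
  have h1 := realBregman_three_point (Θ := Θ) s.ξ (step q Θ F L yδ δ J s).ξ z s.x
    (step q Θ F L yδ δ J s).x
  have h2 := realBregman_le_norm_sq S.reg (S.mem_subdiffGraph hs)
    (argMin_mem_subdiffGraph S.reg S.init (step q Θ F L yδ δ J s).ξ)
  rw [← step_x] at h2
  have h3 := momentumCoeff_model_le (t := stepSize q F L yδ δ J s.x) (γ := s.γ)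
    (g := gradTerm q F L yδ δ J s.x) (m := s.ξ - s.ξprev) hσ S.beta_nonneg S.ups1_pos.le
    hd.iInf_nonneg
  rw [← stateMomentum] at h3
  have h4 := S.phiTerm_le_inner_gradTerm hd hs.mem_ball hz (J := J)
  have h5 := S.stepSize_nonneg hd (J := J) (x := s.x) (L := L)
  have h6 := S.stepSize_mul_norm_sq_le hd (J := J) (x := s.x)
  have h7 := hs.inner_le z hz
  have h8 := S.stateMomentum_nonneg hd (J := J) (s := s)
  have hΔ : (step q Θ F L yδ δ J s).ξ - s.ξ
      = stateMomentum q F L yδ δ J s • (s.ξ - s.ξprev)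
        - stepSize q F L yδ δ J s.x • gradTerm q F L yδ δ J s.x := by
    rw [step_ξ]
    abel
  rw [hΔ] at h1 h2
  set t := stepSize q F L yδ δ J s.x
  set g := gradTerm q F L yδ δ J s.x
  set β := stateMomentum q F L yδ δ J s
  set m := s.ξ - s.ξprev
  rw [inner_sub_left, real_inner_smul_left, real_inner_smul_left] at h1
  rw [@norm_sub_sq_real, norm_smul, norm_smul, real_inner_smul_left, real_inner_smul_right,
    mul_pow, mul_pow, Real.norm_eq_abs, Real.norm_eq_abs, sq_abs, sq_abs,
    real_inner_comm] at h2
  have h9 := mul_le_mul_of_nonneg_left h4 h5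
  have h10 := mul_le_mul_of_nonneg_left h7 h8
  have h11 := mul_le_mul_of_nonneg_left h6 h5
  have e1 : (β ^ 2 * ‖m‖ ^ 2 - 2 * (β * (t * inner ℝ g m)) + t ^ 2 * ‖g‖ ^ 2) / (4 * q.σ)
      = β ^ 2 * ‖m‖ ^ 2 / (4 * q.σ) - β * (t / (2 * q.σ) * inner ℝ g m)
        + t * (t * ‖g‖ ^ 2) / (4 * q.σ) := by
    field_simp
    ring
  have e2 : t * (t * ‖g‖ ^ 2) / (4 * q.σ)
      ≤ q.μ₀ / (4 * q.σ) * (t * phiTerm q F yδ δ J s.x) := by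
    rw [div_mul_eq_mul_div]
    exact div_le_div_of_nonneg_right (by linarith) (by positivity)
  rw [e1] at h2
  linarith

omit [CompleteSpace X] hd in
theorem one_sub_mu0_div_pos : 0 < 1 - q.μ₀ / (4 * q.σ) := by
  rw [sub_pos, div_lt_one (by linarith [S.sigma_pos])]
  exact S.mu0_lt

theorem step_bregman_le (hs : Admissible Θ domF F y x₀ ξ₀ ρ s)
    (hz : z ∈ localSolutions Θ domF F y x₀ ρ) :
    realBregman Θ (step q Θ F L yδ δ J s).ξ z (step q Θ F L yδ δ J s).x
      ≤ realBregman Θ s.ξ z s.x := by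
  have h1 := S.step_descent hd hs hz (J := J)
  have h2 := mul_nonneg S.one_sub_mu0_div_pos.le
    (mul_nonneg (S.stepSize_nonneg hd (J := J) (x := s.x) (L := L))
      (S.phiTerm_nonneg hd (J := J) (x := s.x)))
  have h3 := mul_nonneg (S.stateMomentum_nonneg hd (J := J) (s := s))
    (mul_nonneg (mul_nonneg S.ups1_pos.le hd.iInf_nonneg)
      (sq_nonneg ‖s.ξ - s.ξprev‖))
  linarith

theorem step_admissible (hs : Admissible Θ domF F y x₀ ξ₀ ρ s) :
    Admissible Θ domF F y x₀ ξ₀ ρ (step q Θ F L yδ δ J s) where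
  x_eq := rfl
  mem_ball := by
    obtain ⟨z, hz, hD⟩ := S.exists_near_solution
    have h1 := realBregman_ge S.reg
      (argMin_mem_subdiffGraph S.reg S.init (step q Θ F L yδ δ J s).ξ) hz.1.2
    rw [← step_x] at h1
    have h2 := (h1.trans (S.step_bregman_le hd hs hz)).trans ((hs.bregman_le z hz).trans hD)
    have h3 := le_of_sq_le_sq (le_of_mul_le_mul_left h2 S.sigma_pos) S.op.rho_pos.le
    have h4 := (realBregman_ge S.reg S.init hz.1.2).trans hD
    have h5 := le_of_sq_le_sq (le_of_mul_le_mul_left h4 S.sigma_pos) S.op.rho_pos.le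
    rw [Metric.mem_closedBall]
    refine (dist_triangle_left _ _ z).trans ?_
    rw [dist_eq_norm, dist_eq_norm]
    linarith
  bregman_le := fun z hz => (S.step_bregman_le hd hs hz).trans (hs.bregman_le z hz)
  inner_le := by
    intro z hz
    have h4 := S.phiTerm_le_inner_gradTerm hd hs.mem_ball hz (J := J)
    have h9 := mul_le_mul_of_nonneg_left h4 (S.stepSize_nonneg hd (J := J) (x := s.x) (L := L))
    have h10 := mul_le_mul_of_nonneg_left (hs.inner_le z hz)
      (S.stateMomentum_nonneg hd (J := J) (s := s))
    have hΔ : (step q Θ F L yδ δ J s).ξ - s.ξ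
        = stateMomentum q F L yδ δ J s • (s.ξ - s.ξprev)
          - stepSize q F L yδ δ J s.x • gradTerm q F L yδ δ J s.x := by
      rw [step_ξ]
      abel
    have h11 : inner ℝ ((step q Θ F L yδ δ J s).ξ - s.ξ) (s.x - z)
        = stateMomentum q F L yδ δ J s * inner ℝ (s.ξ - s.ξprev) (s.x - z)
          - stepSize q F L yδ δ J s.x * inner ℝ (gradTerm q F L yδ δ J s.x) (s.x - z) := by
      rw [hΔ, inner_sub_left, real_inner_smul_left, real_inner_smul_left]
    have h12 : inner ℝ ((step q Θ F L yδ δ J s).ξ - s.ξ) ((step q Θ F L yδ δ J s).x - z)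
        = inner ℝ ((step q Θ F L yδ δ J s).ξ - s.ξ) ((step q Θ F L yδ δ J s).x - s.x)
          + inner ℝ ((step q Θ F L yδ δ J s).ξ - s.ξ) (s.x - z) := by
      rw [← inner_add_right]
      congr 1
      abel
    rw [step_ξprev, step_γ, h12, h11]
    linarith

theorem iter_admissible (n : ℕ) :
    Admissible Θ domF F y x₀ ξ₀ ρ (iter q Θ F L x₀ ξ₀ yδ δ I n) := by
  induction n with
  | zero =>
    exact ⟨(argMin_eq S.reg S.init).symm,
      Metric.mem_closedBall_self (by linarith [S.op.rho_pos]), fun _ _ => le_rfl,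
      fun z _ => by simp [iter]⟩
  | succ n ih => exact S.step_admissible hd ih

theorem iter_bregman_antitone (hz : z ∈ localSolutions Θ domF F y x₀ ρ) :
    Antitone fun n => realBregman Θ (iter q Θ F L x₀ ξ₀ yδ δ I n).ξ z
      (iter q Θ F L x₀ ξ₀ yδ δ I n).x :=
  antitone_nat_of_succ_le fun n => S.step_bregman_le hd (S.iter_admissible hd n) hz

theorem iter_bregman_nonneg (hz : z ∈ localSolutions Θ domF F y x₀ ρ) (n : ℕ) :
    0 ≤ realBregman Θ (iter q Θ F L x₀ ξ₀ yδ δ I n).ξ z (iter q Θ F L x₀ ξ₀ yδ δ I n).x :=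
  realBregman_nonneg S.reg (S.mem_subdiffGraph (S.iter_admissible hd n)) hz.1.2

/-! ### Termination -/

/-- At an unsuccessful step with positive noise levels the Bregman distance decreases by at least
a fixed amount. -/
theorem exists_step_progress (hδ : ∀ i, 0 < δ i) : ∃ ε > 0, ∀ (J : Finset (Fin N)) (s : State X N),
    Admissible Θ domF F y x₀ ξ₀ ρ s → ∀ z ∈ localSolutions Θ domF F y x₀ ρ,
      ¬(violating q F yδ δ J s.x = ∅ ∧ stateMomentum q F L yδ δ J s = 0) →
      realBregman Θ (step q Θ F L yδ δ J s).ξ z (step q Θ F L yδ δ J s).x + ε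
        ≤ realBregman Θ s.ξ z s.x := by
  have : Nonempty (Fin N) := ⟨⟨0, S.N_pos⟩⟩
  have hmin : 0 < ⨅ i, δ i := by
    obtain ⟨i, hi⟩ := exists_eq_ciInf_of_finite (f := δ)
    rw [← hi]
    exact hδ i
  have hσ := S.sigma_pos
  have hυ₀ := S.ups0_pos
  have hυ₁ := S.ups1_pos
  have hτ := S.tau_pos
  have hgap := S.gap_pos
  have hμ₀ := S.mu0_pos
  have hB : 0 < B₀ * N := mul_pos S.op.B_pos (by exact_mod_cast S.N_pos)
  have hc := S.one_sub_mu0_div_pos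
  have hmm : 0 < min (q.μ₀ * gap q / (B₀ * N) ^ 2) q.μ₁ :=
    lt_min (by positivity) S.mu1_pos
  obtain ⟨b, hb, hbm⟩ := exists_pos_le_momentumCoeff (X := X) hσ S.beta_nonneg hυ₀ hυ₁ hmin
  refine ⟨min ((1 - q.μ₀ / (4 * q.σ)) * (gap q * min (q.μ₀ * gap q / (B₀ * N) ^ 2) q.μ₁
      * (q.τ * ⨅ i, δ i) ^ 2)) (b * (q.υ₁ * (⨅ i, δ i) * (q.υ₀ * ⨅ i, δ i) ^ 2) / 2),
    lt_min (by positivity) (by positivity), fun J s hs z hz hact => ?_⟩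
  have h1 := S.step_descent hd hs hz (J := J)
  have h2 := mul_nonneg hc.le
    (mul_nonneg (S.stepSize_nonneg hd (J := J) (x := s.x) (L := L))
      (S.phiTerm_nonneg hd (J := J) (x := s.x)))
  have h3 := mul_nonneg (S.stateMomentum_nonneg hd (J := J) (s := s))
    (mul_nonneg (mul_nonneg S.ups1_pos.le hd.iInf_nonneg)
      (sq_nonneg ‖s.ξ - s.ξprev‖))
  by_cases hΓ : violating q F yδ δ J s.x = ∅
  · have hne : stateMomentum q F L yδ δ J s ≠ 0 := fun h => hact ⟨hΓ, h⟩
    have h4 := hbm _ _ _ _ hne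
    have h5 := (le_of_momentumCoeff_ne_zero hne).1
    rw [← stateMomentum] at h4
    have h6 : b * (q.υ₁ * (⨅ i, δ i) * (q.υ₀ * ⨅ i, δ i) ^ 2)
        ≤ stateMomentum q F L yδ δ J s * (q.υ₁ * (⨅ i, δ i) * ‖s.ξ - s.ξprev‖ ^ 2) := by
      gcongr
      exact S.stateMomentum_nonneg hd
    have h7 := min_le_right ((1 - q.μ₀ / (4 * q.σ)) * (gap q *
      min (q.μ₀ * gap q / (B₀ * N) ^ 2) q.μ₁ * (q.τ * ⨅ i, δ i) ^ 2))
      (b * (q.υ₁ * (⨅ i, δ i) * (q.υ₀ * ⨅ i, δ i) ^ 2) / 2)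
    linarith
  · obtain ⟨i, hi⟩ := Finset.nonempty_iff_ne_empty.2 hΓ
    have h4 := S.residual_sq_le hd hs.mem_ball hi
    have h5 : q.τ * (⨅ i, δ i) ≤ ‖F i s.x - yδ i‖ :=
      (mul_le_mul_of_nonneg_left (ciInf_le (Set.finite_range δ).bddBelow i) hτ.le).trans
        (mem_violating.1 hi).2.le
    have h6 : gap q * min (q.μ₀ * gap q / (B₀ * N) ^ 2) q.μ₁ * (q.τ * ⨅ i, δ i) ^ 2
        ≤ gap q * min (q.μ₀ * gap q / (B₀ * N) ^ 2) q.μ₁ * ‖F i s.x - yδ i‖ ^ 2 := by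
      gcongr
    have h7 := mul_le_mul_of_nonneg_left (h6.trans h4) hc.le
    have h8 := min_le_left ((1 - q.μ₀ / (4 * q.σ)) * (gap q *
      min (q.μ₀ * gap q / (B₀ * N) ^ 2) q.μ₁ * (q.τ * ⨅ i, δ i) ^ 2))
      (b * (q.υ₁ * (⨅ i, δ i) * (q.υ₀ * ⨅ i, δ i) ^ 2) / 2)
    linarith

/-- With positive noise levels the method stops as soon as every equation is drawn infinitely
often: unsuccessful steps are finite in number, and afterwards each batch is removed from the
active set. -/
theorem terminates (hδ : ∀ i, 0 < δ i) (hI : ∀ i, ∃ᶠ n in atTop, i ∈ I n) :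
    Terminates q Θ F L x₀ ξ₀ yδ δ I := by
  obtain ⟨z, hz, -⟩ := S.exists_near_solution
  obtain ⟨ε, hε, hprog⟩ := S.exists_step_progress hd hδ
  have hanti := S.iter_bregman_antitone hd hz (I := I)
  have hlim := tendsto_atTop_ciInf hanti
    ⟨0, by rintro _ ⟨n, rfl⟩; exact S.iter_bregman_nonneg hd hz n⟩
  have hdiff := hlim.sub (hlim.comp (tendsto_add_atTop_nat 1))
  rw [sub_self] at hdiff
  obtain ⟨n₀, hn₀⟩ := (hdiff.eventually (gt_mem_nhds hε)).exists_forall_of_atTop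
  have hstep : ∀ n ≥ n₀, (iter q Θ F L x₀ ξ₀ yδ δ I (n + 1)).active
      = (iter q Θ F L x₀ ξ₀ yδ δ I n).active \ I n := by
    intro n hn
    have h1 := hn₀ n hn
    rw [iter, step_active, if_pos]
    by_contra hc
    have h2 := hprog (I n) _ (S.iter_admissible hd n) z hz hc
    simp only [Function.comp_apply, iter] at h1
    linarith
  have hmono : ∀ n ≥ n₀, ∀ k, (iter q Θ F L x₀ ξ₀ yδ δ I (n + k)).active
      ⊆ (iter q Θ F L x₀ ξ₀ yδ δ I n).active := by
    intro n hn k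
    induction k with
    | zero => exact subset_rfl
    | succ k ih =>
      rw [← add_assoc, hstep _ (by omega)]
      exact Finset.sdiff_subset.trans ih
  have hout : ∀ i, ∃ n ≥ n₀, i ∉ (iter q Θ F L x₀ ξ₀ yδ δ I n).active := by
    intro i
    obtain ⟨n, hn, hi⟩ := (frequently_atTop.1 (hI i)) n₀
    refine ⟨n + 1, by omega, ?_⟩
    rw [hstep n hn]
    simp [hi]
  choose k hk hki using hout
  refine ⟨n₀ + ∑ i, k i, Finset.eq_empty_iff_forall_notMem.2 fun i hi => hki i ?_⟩
  have h1 : k i ≤ n₀ + ∑ i, k i :=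
    (Finset.single_le_sum (f := k) (fun _ _ => Nat.zero_le _) (Finset.mem_univ i)).trans
      (Nat.le_add_left _ _)
  obtain ⟨j, hj⟩ := Nat.exists_eq_add_of_le h1
  rw [hj] at hi
  exact hmono _ (hk i) j hi

/-- Indices outside the active set satisfy the discrepancy principle at the current iterate,
since the iterate does not move in successful steps. -/
theorem residual_le_of_notMem_active (n : ℕ)
    (hi : i ∉ (iter q Θ F L x₀ ξ₀ yδ δ I n).active) :
    ‖F i (iter q Θ F L x₀ ξ₀ yδ δ I n).x - yδ i‖ ≤ q.τ * δ i := by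
  induction n with
  | zero => simp [iter] at hi
  | succ n ih =>
    rw [iter, step_active] at hi
    split_ifs at hi with h
    · have hx : (iter q Θ F L x₀ ξ₀ yδ δ I (n + 1)).x = (iter q Θ F L x₀ ξ₀ yδ δ I n).x := by
        rw [iter, step_x, step_ξ, h.2, stepSize_of_empty h.1, zero_smul, zero_smul, sub_zero,
          add_zero, ← (S.iter_admissible hd n).x_eq]
      rw [hx]
      by_cases hin : i ∈ (iter q Θ F L x₀ ξ₀ yδ δ I n).active
      · have hiI : i ∈ I n := by
          by_contra hc
          exact hi (Finset.mem_sdiff.2 ⟨hin, hc⟩)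
        by_contra hc
        push Not at hc
        have : i ∈ violating q F yδ δ (I n) (iter q Θ F L x₀ ξ₀ yδ δ I n).x :=
          mem_violating.2 ⟨hiI, hc⟩
        rw [h.1] at this
        exact absurd this (Finset.notMem_empty i)
      · exact ih hin
    · exact absurd (Finset.mem_univ i) hi

end Setting

end Iteration

/-! ### Stability: iterates with noisy data converge to those with exact data -/

section MomentumLimit

variable {X : Type*} [NormedAddCommGroup X] [InnerProductSpace ℝ X] {q : Params}

/-- Up to an error of the order of the noise level, the momentum coefficient is the projection of
the unconstrained minimizer onto `[0, β]`; the case distinction in its definition therefore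
causes no discontinuity as the noise level tends to zero. -/
theorem abs_momentumCoeff_sub_le {δmin t γ : ℝ} {g m : X} (hσ : 0 < q.σ) (hβ : 0 ≤ q.β)
    (hυ₁ : 0 ≤ q.υ₁) (hδ : 0 ≤ δmin) (hm : m ≠ 0) (hυ : q.υ₀ * δmin ≤ ‖m‖) :
    |momentumCoeff q δmin t g m γ
        - max 0 (min ((inner ℝ (t • g) m - 2 * q.σ * γ) / ‖m‖ ^ 2) q.β)|
      ≤ 2 * q.σ * (q.υ₁ * δmin) := by
  have hm' : 0 < ‖m‖ ^ 2 := by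
    have := norm_pos_iff.2 hm
    positivity
  have herr : 0 ≤ 2 * q.σ * (q.υ₁ * δmin) := by positivity
  rw [real_inner_smul_left]
  by_cases h : γ - t / (2 * q.σ) * inner ℝ g m ≤ -(q.υ₁ * δmin * ‖m‖ ^ 2)
  · have h0 := momentumCoeff_nonneg (t := t) (γ := γ) (g := g) (m := m) hσ hβ hυ₁ hδ
    rw [momentumCoeff, if_pos ⟨hυ, h⟩] at h0 ⊢
    rwa [max_eq_right h0, sub_self, abs_zero]
  · rw [momentumCoeff, if_neg fun hc => h hc.2, zero_sub, abs_neg,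
      abs_of_nonneg (le_max_left _ _)]
    push Not at h
    refine max_le herr ((min_le_left _ _).trans ?_)
    rw [momentum_quotient_eq hσ, div_le_iff₀ hm', mul_assoc (2 * q.σ)]
    exact mul_le_mul_of_nonneg_left (by linarith) (by positivity)

theorem tendsto_momentumCoeff {ι : Type*} {l : Filter ι} (hσ : 0 < q.σ) (hβ : 0 ≤ q.β)
    (hυ₁ : 0 ≤ q.υ₁) {δmin t γ : ι → ℝ} {g m : ι → X} {t₀ γ₀ : ℝ} {g₀ m₀ : X}
    (hδ : ∀ n, 0 ≤ δmin n) (hδ0 : Tendsto δmin l (𝓝 0)) (hγ : Tendsto γ l (𝓝 γ₀))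
    (hm : Tendsto m l (𝓝 m₀)) (htg : Tendsto (fun n => t n • g n) l (𝓝 (t₀ • g₀)))
    (hm₀ : m₀ ≠ 0) :
    Tendsto (fun n => momentumCoeff q (δmin n) (t n) (g n) (m n) (γ n)) l
      (𝓝 (momentumCoeff q 0 t₀ g₀ m₀ γ₀)) := by
  have hexact : momentumCoeff q 0 t₀ g₀ m₀ γ₀
      = max 0 (min ((inner ℝ (t₀ • g₀) m₀ - 2 * q.σ * γ₀) / ‖m₀‖ ^ 2) q.β) := by
    have := abs_momentumCoeff_sub_le (t := t₀) (γ := γ₀) (g := g₀) hσ hβ hυ₁ (le_refl (0 : ℝ)) hm₀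
      (by simp)
    rw [mul_zero, mul_zero] at this
    exact sub_eq_zero.1 (abs_nonpos_iff.1 this)
  have hproj : Tendsto
      (fun n => max 0 (min ((inner ℝ (t n • g n) (m n) - 2 * q.σ * γ n) / ‖m n‖ ^ 2) q.β)) l
      (𝓝 (momentumCoeff q 0 t₀ g₀ m₀ γ₀)) := by
    rw [hexact]
    refine tendsto_const_nhds.max (Tendsto.min ?_ tendsto_const_nhds)
    exact ((htg.inner hm).sub (hγ.const_mul _)).div (hm.norm.pow 2)
      (pow_ne_zero 2 (norm_ne_zero_iff.2 hm₀))
  have herr : Tendsto (fun n => 2 * q.σ * (q.υ₁ * δmin n)) l (𝓝 0) := by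
    simpa using (hδ0.const_mul q.υ₁).const_mul (2 * q.σ)
  have hev : ∀ᶠ n in l, q.υ₀ * δmin n < ‖m n‖ := by
    have h0 : Tendsto (fun n => q.υ₀ * δmin n) l (𝓝 0) := by simpa using hδ0.const_mul q.υ₀
    exact h0.eventually_lt hm.norm (norm_pos_iff.2 hm₀)
  have hdiff : Tendsto (fun n => momentumCoeff q (δmin n) (t n) (g n) (m n) (γ n)
      - max 0 (min ((inner ℝ (t n • g n) (m n) - 2 * q.σ * γ n) / ‖m n‖ ^ 2) q.β)) l (𝓝 0) := by
    refine squeeze_zero_norm' ?_ herr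
    filter_upwards [hev, hm.eventually_ne hm₀] with n h1 h2
    exact abs_momentumCoeff_sub_le hσ hβ hυ₁ (hδ n) h2 h1.le
  simpa using hdiff.add hproj

end MomentumLimit

section Stability

variable {X : Type*} [NormedAddCommGroup X] [InnerProductSpace ℝ X] [CompleteSpace X]
  {N : ℕ} {Y : Fin N → Type*} [∀ i, NormedAddCommGroup (Y i)] [∀ i, NormedSpace ℝ (Y i)]
  {Θ : X → EReal} {domF : Fin N → Set X} {F : ∀ i, X → Y i}
  {L : ∀ i, X → X →L[ℝ] Y i} {y : ∀ i, Y i} {x₀ ξ₀ : X} {ρ B₀ : ℝ} {q : Params}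
  {J : Finset (Fin N)} {I : ℕ → Finset (Fin N)} {x : X} {i : Fin N}
  {ι : Type*} {l : Filter ι} {yδ : ι → ∀ i, Y i} {δ : ι → Fin N → ℝ}
  {u : ι → X} {s : ι → State X N} {s₀ : State X N}

/-- Convergence of the analytic components of the states of the method. -/
structure StatesTendsto (s : ι → State X N) (l : Filter ι) (s₀ : State X N) : Prop where
  ξ : Tendsto (fun n => (s n).ξ) l (𝓝 s₀.ξ)
  ξprev : Tendsto (fun n => (s n).ξprev) l (𝓝 s₀.ξprev)
  x : Tendsto (fun n => (s n).x) l (𝓝 s₀.x)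
  γ : Tendsto (fun n => (s n).γ) l (𝓝 s₀.γ)

namespace Setting

variable (S : Setting Θ domF F L y x₀ ξ₀ ρ B₀ q)
include S

variable (hd : ∀ n, IsNoisyData y (yδ n) (δ n)) (hδ : ∀ i, Tendsto (fun n => δ n i) l (𝓝 0))
  (hu : ∀ n, u n ∈ Metric.closedBall x₀ (2 * ρ)) (hx : x ∈ Metric.closedBall x₀ (2 * ρ))
  (hlim : Tendsto u l (𝓝 x))
include hd hδ hu hx hlim

omit [CompleteSpace X] in
theorem tendsto_residual (i : Fin N) :
    Tendsto (fun n => F i (u n) - yδ n i) l (𝓝 (F i x - y i)) := by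
  refine (S.tendsto_F hu hx hlim i).sub ?_
  rw [tendsto_iff_norm_sub_tendsto_zero]
  exact squeeze_zero (fun _ => norm_nonneg _) (fun n => (hd n).norm_sub_le i) (hδ i)

omit [CompleteSpace X] in
theorem eventually_mem_violating (hi : i ∈ J) (hne : F i x - y i ≠ 0) :
    ∀ᶠ n in l, i ∈ violating q F (yδ n) (δ n) J (u n) := by
  have h1 : Tendsto (fun n => q.τ * δ n i) l (𝓝 0) := by simpa using (hδ i).const_mul q.τ
  filter_upwards [h1.eventually_lt (S.tendsto_residual hd hδ hu hx hlim i).norm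
    (norm_pos_iff.2 hne)] with n hn
  exact mem_violating.2 ⟨hi, hn⟩

omit [CompleteSpace X] in
/-- Sums over the violated equations pass to the limit if the summands of equations solved in
the limit vanish; it does not matter which of those are still violated before. -/
theorem tendsto_sum_violating {E : Type*} [NormedAddCommGroup E] {f : ι → Fin N → E}
    {f₀ : Fin N → E} (h1 : ∀ i ∈ J, F i x - y i ≠ 0 → Tendsto (fun n => f n i) l (𝓝 (f₀ i)))
    (h2 : ∀ i ∈ J, F i x - y i = 0 → Tendsto (fun n => f n i) l (𝓝 0)) :
    Tendsto (fun n => ∑ i ∈ violating q F (yδ n) (δ n) J (u n), f n i) l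
      (𝓝 (∑ i ∈ violating q F y 0 J x, f₀ i)) := by
  classical
  simp only [violating, Finset.sum_filter]
  refine tendsto_finsetSum _ fun i hi => ?_
  by_cases hr : F i x - y i = 0
  · have hneg : ¬ q.τ * (0 : Fin N → ℝ) i < ‖F i x - y i‖ := by simp [hr]
    rw [if_neg hneg]
    refine squeeze_zero_norm (fun n => ?_) (tendsto_norm_zero.comp (h2 i hi hr))
    split_ifs <;> simp
  · have hpos : q.τ * (0 : Fin N → ℝ) i < ‖F i x - y i‖ := by simpa using norm_pos_iff.2 hr
    rw [if_pos hpos]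
    refine (h1 i hi hr).congr' ?_
    filter_upwards [S.eventually_mem_violating hd hδ hu hx hlim hi hr] with n hn
    rw [if_pos (mem_violating.1 hn).2]

omit [CompleteSpace X] in
theorem tendsto_phiTerm :
    Tendsto (fun n => phiTerm q F (yδ n) (δ n) J (u n)) l (𝓝 (phiTerm q F y 0 J x)) := by
  have hr0 : 0 < q.r - 1 := by linarith [S.r_gt]
  have key : ∀ i, Tendsto (fun n => ((1 - q.η) * ‖F i (u n) - yδ n i‖ - (1 + q.η) * δ n i)
      * ‖F i (u n) - yδ n i‖ ^ (q.r - 1)) l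
      (𝓝 (((1 - q.η) * ‖F i x - y i‖ - (1 + q.η) * 0) * ‖F i x - y i‖ ^ (q.r - 1))) := fun i =>
    (((S.tendsto_residual hd hδ hu hx hlim i).norm.const_mul _).sub ((hδ i).const_mul _)).mul
      ((S.tendsto_residual hd hδ hu hx hlim i).norm.rpow_const (Or.inr hr0.le))
  refine S.tendsto_sum_violating hd hδ hu hx hlim (fun i _ _ => key i) fun i _ h => ?_
  have := key i
  rwa [h, norm_zero, mul_zero, mul_zero, sub_zero, zero_mul] at this

omit [CompleteSpace X] in
theorem tendsto_psiTerm :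
    Tendsto (fun n => psiTerm q F (yδ n) (δ n) J (u n)) l (𝓝 (psiTerm q F y 0 J x)) := by
  have hr0 : 0 < q.r := by linarith [S.r_gt]
  have key : ∀ i, Tendsto (fun n => ‖F i (u n) - yδ n i‖ ^ q.r) l (𝓝 (‖F i x - y i‖ ^ q.r)) :=
    fun i => (S.tendsto_residual hd hδ hu hx hlim i).norm.rpow_const (Or.inr hr0.le)
  refine S.tendsto_sum_violating hd hδ hu hx hlim (fun i _ _ => key i) fun i _ h => ?_
  have := key i
  rwa [h, norm_zero, Real.zero_rpow hr0.ne'] at this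

theorem tendsto_gradTerm :
    Tendsto (fun n => gradTerm q F L (yδ n) (δ n) J (u n)) l (𝓝 (gradTerm q F L y 0 J x)) := by
  have hr0 : 0 < q.r - 1 := by linarith [S.r_gt]
  refine S.tendsto_sum_violating hd hδ hu hx hlim (fun i _ h => ?_) fun i _ h => ?_
  · have hL : Tendsto (fun n => L i (u n)) l (𝓝 (L i x)) :=
      (S.op.continuousOn_L i x hx).tendsto.comp
        (tendsto_nhdsWithin_iff.2 ⟨hlim, Eventually.of_forall hu⟩)
    exact tendsto_adjointMap hL (tendsto_dualityMap (S.op.smooth i) S.r_gt h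
      (S.tendsto_residual hd hδ hu hx hlim i))
  · have h1 : Tendsto (fun n => B₀ * ‖F i (u n) - yδ n i‖ ^ (q.r - 1)) l (𝓝 0) := by
      have := ((S.tendsto_residual hd hδ hu hx hlim i).norm.rpow_const (Or.inr hr0.le)
        (p := q.r - 1)).const_mul B₀
      rwa [h, norm_zero, Real.zero_rpow hr0.ne', mul_zero] at this
    refine squeeze_zero_norm (fun n => (norm_adjointMap_le _ _).trans ?_) h1
    rw [norm_dualityMap S.r_gt]
    exact mul_le_mul_of_nonneg_right (S.op.norm_L_le i _ (hu n))
      (Real.rpow_nonneg (norm_nonneg _) _)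

/-- If some equation of the batch is violated in the limit then the step size converges;
otherwise it may blow up, but its products with the search direction and with `Φ` vanish. -/
theorem tendsto_stepSize_smul :
    Tendsto (fun n => stepSize q F L (yδ n) (δ n) J (u n) • gradTerm q F L (yδ n) (δ n) J (u n)) l
        (𝓝 (stepSize q F L y 0 J x • gradTerm q F L y 0 J x)) ∧
      Tendsto (fun n => stepSize q F L (yδ n) (δ n) J (u n) * phiTerm q F (yδ n) (δ n) J (u n)) l
        (𝓝 (stepSize q F L y 0 J x * phiTerm q F y 0 J x)) := by
  by_cases h : (violating q F y 0 J x).Nonempty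
  · have hΨ := S.psiTerm_pos (IsNoisyData.exact y) h
    have hg := S.gradTerm_ne_zero (IsNoisyData.exact y) hx h
    have hΦlim := S.tendsto_phiTerm hd hδ hu hx hlim (J := J)
    have hglim := S.tendsto_gradTerm hd hδ hu hx hlim (J := J)
    have hΨlim := S.tendsto_psiTerm hd hδ hu hx hlim (J := J)
    have hne : ∀ᶠ n in l, (violating q F (yδ n) (δ n) J (u n)).Nonempty := by
      obtain ⟨i, hi⟩ := h
      have h1 := mem_violating.1 hi
      have h2 : F i x - y i ≠ 0 := by
        rw [← norm_pos_iff]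
        simpa using h1.2
      filter_upwards [S.eventually_mem_violating hd hδ hu hx hlim h1.1 h2] with n hn
      exact ⟨i, hn⟩
    have ht : Tendsto (fun n => stepSize q F L (yδ n) (δ n) J (u n)) l
        (𝓝 (stepSize q F L y 0 J x)) := by
      have h1 : stepSize q F L y 0 J x
          = min (q.μ₀ * phiTerm q F y 0 J x / ‖gradTerm q F L y 0 J x‖ ^ 2)
            (q.μ₁ * psiTerm q F y 0 J x ^ (2 / q.r - 1)) := if_pos h
      rw [h1]
      refine (((hΦlim.const_mul q.μ₀).div (hglim.norm.pow 2)
        (pow_ne_zero 2 (norm_ne_zero_iff.2 hg))).min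
        ((hΨlim.rpow_const (Or.inl hΨ.ne')).const_mul q.μ₁)).congr' ?_
      filter_upwards [hne] with n hn
      rw [stepSize, if_pos hn]
      rfl
    exact ⟨ht.smul hglim, ht.mul hΦlim⟩
  · have h0 : violating q F y 0 J x = ∅ := Finset.not_nonempty_iff_eq_empty.1 h
    rw [stepSize_of_empty h0, zero_smul, zero_mul]
    have hres : ∀ i ∈ J, F i x - y i = 0 := by
      intro i hi
      by_contra hc
      refine h ⟨i, mem_violating.2 ⟨hi, ?_⟩⟩
      simpa using norm_pos_iff.2 hc
    let K : ι → ℝ := fun n => ∑ i ∈ J, ‖F i (u n) - yδ n i‖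
    have hK0 : ∀ n, 0 ≤ K n := fun n => Finset.sum_nonneg fun _ _ => norm_nonneg _
    have hK : ∀ n, ∀ i ∈ violating q F (yδ n) (δ n) J (u n), ‖F i (u n) - yδ n i‖ ≤ K n :=
      fun n i hi => Finset.single_le_sum (f := fun i => ‖F i (u n) - yδ n i‖)
        (fun _ _ => norm_nonneg _) (mem_violating.1 hi).1
    have hKlim : Tendsto K l (𝓝 0) := by
      have : Tendsto K l (𝓝 (∑ i ∈ J, ‖F i x - y i‖)) :=
        tendsto_finsetSum _ fun i _ => (S.tendsto_residual hd hδ hu hx hlim i).norm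
      rwa [Finset.sum_eq_zero fun i hi => by rw [hres i hi, norm_zero]] at this
    constructor
    · refine squeeze_zero_norm (a := fun n => q.μ₁ * N ^ 2 * K n * B₀) (fun n => ?_) ?_
      · rw [norm_smul, Real.norm_of_nonneg (S.stepSize_nonneg (hd n))]
        exact S.stepSize_mul_norm_gradTerm_le (hd n) (hu n) (hK n) (hK0 n)
      · simpa using (hKlim.const_mul (q.μ₁ * N ^ 2)).mul_const B₀
    · refine squeeze_zero (g := fun n => q.μ₁ * N ^ 2 * K n * K n) (fun n => ?_) (fun n => ?_) ?_
      · exact mul_nonneg (S.stepSize_nonneg (hd n)) (S.phiTerm_nonneg (hd n))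
      · exact S.stepSize_mul_phiTerm_le (hd n) (hK n) (hK0 n)
      · simpa using (hKlim.const_mul (q.μ₁ * N ^ 2)).mul hKlim

omit hu hx hlim

omit [CompleteSpace X] in
theorem tendsto_iInf_noise : Tendsto (fun n => ⨅ i, δ n i) l (𝓝 0) := by
  have i₀ : Fin N := ⟨0, S.N_pos⟩
  exact squeeze_zero (fun n => (hd n).iInf_nonneg)
    (fun n => ciInf_le (Set.finite_range (δ n)).bddBelow i₀) (hδ i₀)

/-- If the limiting momentum vanishes, the coefficients need not converge, but their products do:
a nonzero coefficient forces `γ` to be small. -/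
theorem tendsto_stateMomentum_smul (hs : ∀ n, Admissible Θ domF F y x₀ ξ₀ ρ (s n))
    (hs₀ : Admissible Θ domF F y x₀ ξ₀ ρ s₀) (hlim : StatesTendsto s l s₀) :
    Tendsto (fun n => stateMomentum q F L (yδ n) (δ n) J (s n) • ((s n).ξ - (s n).ξprev)) l
        (𝓝 (stateMomentum q F L y 0 J s₀ • (s₀.ξ - s₀.ξprev))) ∧
      Tendsto (fun n => stateMomentum q F L (yδ n) (δ n) J (s n) * (s n).γ) l
        (𝓝 (stateMomentum q F L y 0 J s₀ * s₀.γ)) := by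
  have hm := hlim.ξ.sub hlim.ξprev
  have hinf := S.tendsto_iInf_noise hd hδ
  have htg := (S.tendsto_stepSize_smul hd hδ (fun n => (hs n).mem_ball) hs₀.mem_ball hlim.x
    (J := J)).1
  have hzero : (⨅ i : Fin N, (0 : Fin N → ℝ) i) = 0 := by simp
  by_cases h : s₀.ξ - s₀.ξprev = 0
  · have hmom : stateMomentum q F L y 0 J s₀ = 0 := by
      rw [stateMomentum, h]
      exact momentumCoeff_zero_right S.beta_nonneg
    rw [hmom, zero_smul, zero_mul]
    rw [h] at hm
    have hbd : ∀ n, |stateMomentum q F L (yδ n) (δ n) J (s n)| ≤ 1 := fun n => by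
      rw [abs_of_nonneg (S.stateMomentum_nonneg (hd n))]
      exact S.stateMomentum_le.trans S.beta_lt.le
    constructor
    · refine squeeze_zero_norm (fun n => ?_) (tendsto_norm_zero.comp hm)
      rw [norm_smul, Real.norm_eq_abs]
      exact mul_le_of_le_one_left (norm_nonneg _) (hbd n)
    · obtain ⟨z, hz, -⟩ := S.exists_near_solution
      have hA : Tendsto (fun n => |inner ℝ ((s n).ξ - (s n).ξprev) ((s n).x - z)|
          + |inner ℝ (stepSize q F L (yδ n) (δ n) J (s n).x
            • gradTerm q F L (yδ n) (δ n) J (s n).x) ((s n).ξ - (s n).ξprev)| / (2 * q.σ))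
          l (𝓝 0) := by
        have h1 := (hm.inner (hlim.x.sub_const z) (𝕜 := ℝ)).abs
        have h2 := ((htg.inner hm (𝕜 := ℝ)).abs).div_const (2 * q.σ)
        simpa using h1.add h2
      refine squeeze_zero_norm (fun n => ?_) hA
      rw [Real.norm_eq_abs, abs_mul]
      have hσ := S.sigma_pos
      by_cases hne : stateMomentum q F L (yδ n) (δ n) J (s n) = 0
      · rw [hne, abs_zero, zero_mul]
        positivity
      refine (mul_le_of_le_one_left (abs_nonneg _) (hbd n)).trans ?_
      have h1 := (le_of_momentumCoeff_ne_zero hne).2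
      have h2 : 0 ≤ q.υ₁ * (⨅ i, δ n i) * ‖(s n).ξ - (s n).ξprev‖ ^ 2 :=
        mul_nonneg (mul_nonneg S.ups1_pos.le ((hd n).iInf_nonneg)) (sq_nonneg _)
      have h3 := (hs n).inner_le z hz
      have h4 := neg_abs_le (inner ℝ ((s n).ξ - (s n).ξprev) ((s n).x - z))
      have h5 : stepSize q F L (yδ n) (δ n) J (s n).x / (2 * q.σ)
            * inner ℝ (gradTerm q F L (yδ n) (δ n) J (s n).x) ((s n).ξ - (s n).ξprev)
          ≤ |inner ℝ (stepSize q F L (yδ n) (δ n) J (s n).x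
            • gradTerm q F L (yδ n) (δ n) J (s n).x) ((s n).ξ - (s n).ξprev)| / (2 * q.σ) := by
        rw [real_inner_smul_left, div_mul_eq_mul_div]
        exact div_le_div_of_nonneg_right (le_abs_self _) (by positivity)
      have h6 : 0 ≤ |inner ℝ (stepSize q F L (yδ n) (δ n) J (s n).x
            • gradTerm q F L (yδ n) (δ n) J (s n).x) ((s n).ξ - (s n).ξprev)| / (2 * q.σ) := by
        positivity
      have h7 := abs_nonneg (inner ℝ ((s n).ξ - (s n).ξprev) ((s n).x - z))
      exact abs_le.2 ⟨by linarith, by linarith⟩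
  · have hβ : Tendsto (fun n => stateMomentum q F L (yδ n) (δ n) J (s n)) l
        (𝓝 (stateMomentum q F L y 0 J s₀)) := by
      have := tendsto_momentumCoeff S.sigma_pos S.beta_nonneg S.ups1_pos.le
        (fun n => (hd n).iInf_nonneg) hinf hlim.γ hm htg h
      rw [← hzero] at this
      exact this
    exact ⟨hβ.smul hm, hβ.mul hlim.γ⟩

theorem tendsto_step (hs : ∀ n, Admissible Θ domF F y x₀ ξ₀ ρ (s n))
    (hs₀ : Admissible Θ domF F y x₀ ξ₀ ρ s₀) (hlim : StatesTendsto s l s₀) :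
    StatesTendsto (fun n => step q Θ F L (yδ n) (δ n) J (s n)) l (step q Θ F L y 0 J s₀) := by
  obtain ⟨htg, htΦ⟩ := S.tendsto_stepSize_smul hd hδ (fun n => (hs n).mem_ball) hs₀.mem_ball
    hlim.x (J := J)
  obtain ⟨hβm, hβγ⟩ := S.tendsto_stateMomentum_smul hd hδ hs hs₀ hlim (J := J)
  have hξ : Tendsto (fun n => (step q Θ F L (yδ n) (δ n) J (s n)).ξ) l
      (𝓝 (step q Θ F L y 0 J s₀).ξ) := by
    simp only [step_ξ]
    exact (hlim.ξ.sub htg).add hβm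
  have hx : Tendsto (fun n => (step q Θ F L (yδ n) (δ n) J (s n)).x) l
      (𝓝 (step q Θ F L y 0 J s₀).x) := tendsto_argMin S.reg S.init hξ
  refine ⟨hξ, hlim.ξ, hx, ?_⟩
  simp only [step_γ]
  exact (((hξ.sub hlim.ξ).inner (hx.sub hlim.x)).sub htΦ).add hβγ

/-- For a fixed number of steps along fixed batches, the iterates converge to those with exact
data as the noise level tends to zero. -/
theorem tendsto_iter (n : ℕ) :
    StatesTendsto (fun k => iter q Θ F L x₀ ξ₀ (yδ k) (δ k) I n) l
      (iter q Θ F L x₀ ξ₀ y 0 I n) := by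
  induction n with
  | zero =>
    exact ⟨tendsto_const_nhds, tendsto_const_nhds, tendsto_const_nhds, tendsto_const_nhds⟩
  | succ n ih =>
    exact S.tendsto_step hd hδ (fun k => S.iter_admissible (hd k) n)
      (S.iter_admissible (IsNoisyData.exact y) n) ih

theorem tendsto_iter_bregman (n : ℕ) (z : X) :
    Tendsto (fun k => realBregman Θ (iter q Θ F L x₀ ξ₀ (yδ k) (δ k) I n).ξ z
      (iter q Θ F L x₀ ξ₀ (yδ k) (δ k) I n).x) l
      (𝓝 (realBregman Θ (iter q Θ F L x₀ ξ₀ y 0 I n).ξ z (iter q Θ F L x₀ ξ₀ y 0 I n).x)) := by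
  have h1 := tendsto_realBregman_argMin S.reg S.init (S.tendsto_iter hd hδ n (I := I)).ξ z
  rw [← (S.iter_admissible (IsNoisyData.exact y) n).x_eq] at h1
  refine h1.congr fun k => ?_
  rw [← (S.iter_admissible (hd k) n).x_eq]

end Setting

end Stability

/-! ### Convergence with exact data along a fixed sequence of batches -/

/-- Summation of a linear recursion with factor `β < 1`. -/
theorem sum_succ_le_of_recursion {a b : ℕ → ℝ} {β : ℝ} (hβ0 : 0 ≤ β) (hβ : β < 1)
    (ha : ∀ j, 0 ≤ a j) (k : ℕ) {n : ℕ} (hn : k ≤ n)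
    (hrec : ∀ j, k ≤ j → j < n → a (j + 1) ≤ b j + β * a j) :
    ∑ j ∈ Finset.Ico k n, a (j + 1) ≤ (a k + ∑ j ∈ Finset.Ico k n, b j) / (1 - β) := by
  have key : (1 - β) * ∑ j ∈ Finset.Ico k n, a (j + 1) + β * a n
      ≤ ∑ j ∈ Finset.Ico k n, b j + β * a k := by
    induction n, hn using Nat.le_induction with
    | base => simp
    | succ n hn ih =>
      have h1 := ih fun j h1 h2 => hrec j h1 (by omega)
      have h2 := hrec n hn (by omega)
      rw [Finset.sum_Ico_succ_top hn, Finset.sum_Ico_succ_top hn]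
      linarith
  rw [le_div_iff₀ (by linarith)]
  have h1 := mul_nonneg hβ0 (ha n)
  have h2 := mul_le_of_le_one_left (ha k) hβ.le
  linarith

theorem tendsto_zero_of_recursion {u v : ℕ → ℝ} {β : ℝ} (hβ0 : 0 ≤ β) (hβ : β < 1)
    (hu : ∀ j, 0 ≤ u j) (hv : Summable fun j => v j ^ 2)
    (hrec : ∀ j, u (j + 1) ≤ v j + β * u j) : Tendsto u atTop (𝓝 0) := by
  -- by convexity the squares satisfy a recursion with the same factor
  have hsq : ∀ j, u (j + 1) ^ 2 ≤ v j ^ 2 / (1 - β) + β * u j ^ 2 := by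
    intro j
    have h0 : 0 < 1 - β := by linarith
    have h1 : u (j + 1) ^ 2 ≤ (v j + β * u j) ^ 2 := pow_le_pow_left₀ (hu _) (hrec j) 2
    refine h1.trans ?_
    rw [← sub_le_iff_le_add, le_div_iff₀ h0]
    nlinarith [mul_nonneg hβ0 (sq_nonneg (v j - (1 - β) * u j))]
  have hbd : ∀ n, ∑ j ∈ Finset.range n, u (j + 1) ^ 2
      ≤ (u 0 ^ 2 + ∑' j, v j ^ 2 / (1 - β)) / (1 - β) := by
    intro n
    have h1 := sum_succ_le_of_recursion (a := fun j => u j ^ 2) hβ0 hβ (fun _ => sq_nonneg _) 0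
      (Nat.zero_le n) fun j _ _ => hsq j
    rw [← Finset.range_eq_Ico] at h1
    refine h1.trans (div_le_div_of_nonneg_right ?_ (by linarith))
    have h2 := (hv.div_const (1 - β)).sum_le_tsum (Finset.range n)
      fun j _ => div_nonneg (sq_nonneg _) (by linarith)
    linarith
  have hsum := summable_of_sum_range_le (fun j => sq_nonneg (u (j + 1))) hbd
  have h1 := (tendsto_add_atTop_iff_nat (f := fun j => u j ^ 2) 1).1 hsum.tendsto_atTop_zero
  have h2 := h1.sqrt
  rw [Real.sqrt_zero] at h2
  exact h2.congr fun j => Real.sqrt_sq (hu j)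

section Exact

variable {X : Type*} [NormedAddCommGroup X] [InnerProductSpace ℝ X] [CompleteSpace X]
  {N : ℕ} {Y : Fin N → Type*} [∀ i, NormedAddCommGroup (Y i)] [∀ i, NormedSpace ℝ (Y i)]
  {Θ : X → EReal} {domF : Fin N → Set X} {F : ∀ i, X → Y i}
  {L : ∀ i, X → X →L[ℝ] Y i} {y yδ : ∀ i, Y i} {x₀ ξ₀ : X} {ρ B₀ : ℝ} {q : Params}
  {δ : Fin N → ℝ} {J : Finset (Fin N)} {I : ℕ → Finset (Fin N)} {x z p v : X}
  {e : ℕ → ℝ}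

namespace Setting

variable (S : Setting Θ domF F L y x₀ ξ₀ ρ B₀ q)
include S

/-- If the residuals at `x` and at `p` are at most `K`, then a step from `x` tests `p - z`, for a
solution `z`, only to the order `K ^ 2`. -/
theorem stepSize_mul_abs_inner_le (hx : x ∈ Metric.closedBall x₀ (2 * ρ))
    (hp : p ∈ Metric.closedBall x₀ (2 * ρ)) (hz : z ∈ localSolutions Θ domF F y x₀ ρ) {K : ℝ}
    (hK0 : 0 ≤ K) (hxK : ∀ i, ‖F i x - y i‖ ≤ K) (hpK : ∀ i, ‖F i p - y i‖ ≤ K) :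
    stepSize q F L y 0 J x * |inner ℝ (gradTerm q F L y 0 J x) (p - z)|
      ≤ q.μ₁ * N ^ 2 * (3 * (1 + q.η)) * K ^ 2 := by
  have hd := IsNoisyData.exact y
  have hη : 0 ≤ 1 + q.η := by linarith [S.op.eta_nonneg]
  have h1 : |inner ℝ (gradTerm q F L y 0 J x) (p - z)|
      ≤ ∑ i ∈ violating q F y 0 J x, ‖F i x - y i‖ ^ (q.r - 1) * ‖L i x (p - z)‖ := by
    rw [gradTerm, sum_inner]
    refine (Finset.abs_sum_le_sum_abs _ _).trans (Finset.sum_le_sum fun i _ => ?_)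
    rw [inner_adjointMap]
    exact (dualityMap q.r (F i x - y i)).le_of_opNorm_le (norm_dualityMap S.r_gt _).le _
  have h2 : ∀ i, ‖L i x (p - z)‖ ≤ 3 * (1 + q.η) * K := by
    intro i
    have h3 := S.norm_L_apply_le hx hz.1.1 i
    have h4 := S.norm_L_apply_le hx hp i
    rw [hz.2.2 i] at h3
    have h5 : ‖F i x - F i p‖ ≤ 2 * K := by
      have := norm_sub_le_norm_sub_add_norm_sub (F i x) (y i) (F i p)
      rw [norm_sub_rev (y i)] at this
      linarith [hxK i, hpK i]
    have h6 : L i x (p - z) = L i x (x - z) - L i x (x - p) := by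
      rw [← map_sub]
      congr 1
      abel
    rw [h6]
    have h7 := norm_sub_le (L i x (x - z)) (L i x (x - p))
    have h8 := mul_le_mul_of_nonneg_left h5 hη
    have h9 := mul_le_mul_of_nonneg_left (hxK i) hη
    linarith
  refine (mul_le_mul_of_nonneg_left h1 (S.stepSize_nonneg hd)).trans ?_
  refine (S.stepSize_mul_sum_le hd (K := K) (A := 3 * (1 + q.η) * K) (by positivity)
    (fun i => ‖L i x (p - z)‖) (fun i _ => hxK i) (fun i _ => h2 i) hK0).trans
    (le_of_eq (by ring))

theorem iter_momentum_succ (hd : IsNoisyData y yδ δ) (n : ℕ) (w : X) :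
    |inner ℝ ((iter q Θ F L x₀ ξ₀ yδ δ I (n + 1)).ξ
        - (iter q Θ F L x₀ ξ₀ yδ δ I (n + 1)).ξprev) w|
      ≤ stepSize q F L yδ δ (I n) (iter q Θ F L x₀ ξ₀ yδ δ I n).x
          * |inner ℝ (gradTerm q F L yδ δ (I n) (iter q Θ F L x₀ ξ₀ yδ δ I n).x) w|
        + q.β * |inner ℝ ((iter q Θ F L x₀ ξ₀ yδ δ I n).ξ
          - (iter q Θ F L x₀ ξ₀ yδ δ I n).ξprev) w| := by
  set s := iter q Θ F L x₀ ξ₀ yδ δ I n with hs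
  have h1 : (iter q Θ F L x₀ ξ₀ yδ δ I (n + 1)).ξ - (iter q Θ F L x₀ ξ₀ yδ δ I (n + 1)).ξprev
      = stateMomentum q F L yδ δ (I n) s • (s.ξ - s.ξprev)
        - stepSize q F L yδ δ (I n) s.x • gradTerm q F L yδ δ (I n) s.x := by
    rw [iter, step_ξ, step_ξprev, ← hs]
    abel
  rw [h1, inner_sub_left, real_inner_smul_left, real_inner_smul_left]
  refine (abs_sub _ _).trans ?_
  rw [abs_mul, abs_mul, abs_of_nonneg (S.stepSize_nonneg hd),
    abs_of_nonneg (S.stateMomentum_nonneg hd), add_comm]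
  exact add_le_add le_rfl (mul_le_mul_of_nonneg_right S.stateMomentum_le (abs_nonneg _))

theorem iter_momentum_norm_succ (hd : IsNoisyData y yδ δ) (n : ℕ) :
    ‖(iter q Θ F L x₀ ξ₀ yδ δ I (n + 1)).ξ - (iter q Θ F L x₀ ξ₀ yδ δ I (n + 1)).ξprev‖
      ≤ stepSize q F L yδ δ (I n) (iter q Θ F L x₀ ξ₀ yδ δ I n).x
          * ‖gradTerm q F L yδ δ (I n) (iter q Θ F L x₀ ξ₀ yδ δ I n).x‖
        + q.β * ‖(iter q Θ F L x₀ ξ₀ yδ δ I n).ξ - (iter q Θ F L x₀ ξ₀ yδ δ I n).ξprev‖ := by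
  set s := iter q Θ F L x₀ ξ₀ yδ δ I n with hs
  have h1 : (iter q Θ F L x₀ ξ₀ yδ δ I (n + 1)).ξ - (iter q Θ F L x₀ ξ₀ yδ δ I (n + 1)).ξprev
      = stateMomentum q F L yδ δ (I n) s • (s.ξ - s.ξprev)
        - stepSize q F L yδ δ (I n) s.x • gradTerm q F L yδ δ (I n) s.x := by
    rw [iter, step_ξ, step_ξprev, ← hs]
    abel
  rw [h1]
  refine (norm_sub_le _ _).trans ?_
  rw [norm_smul, norm_smul, Real.norm_of_nonneg (S.stepSize_nonneg hd),
    Real.norm_of_nonneg (S.stateMomentum_nonneg hd), add_comm]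
  exact add_le_add le_rfl (mul_le_mul_of_nonneg_right S.stateMomentum_le (norm_nonneg _))

theorem tendsto_exact_momentum (hes : Summable fun j => e j ^ 2) (he : ∀ j, 0 < e j)
    (hres : ∀ j i, ‖F i (iter q Θ F L x₀ ξ₀ y 0 I j).x - y i‖ ≤ e j) :
    Tendsto (fun j => ‖(iter q Θ F L x₀ ξ₀ y 0 I j).ξ - (iter q Θ F L x₀ ξ₀ y 0 I j).ξprev‖)
      atTop (𝓝 0) := by
  have hd := IsNoisyData.exact y
  refine tendsto_zero_of_recursion (v := fun j => q.μ₁ * N ^ 2 * B₀ * e j) S.beta_nonneg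
    S.beta_lt (fun _ => norm_nonneg _) ?_ fun j => ?_
  · simp only [mul_pow (q.μ₁ * N ^ 2 * B₀)]
    exact hes.mul_left _
  · refine (S.iter_momentum_norm_succ hd j).trans (add_le_add ?_ le_rfl)
    refine (S.stepSize_mul_norm_gradTerm_le hd (S.iter_admissible hd j).mem_ball (K := e j)
      (fun i _ => hres j i) (he j).le).trans (le_of_eq (by ring))

/-- The key estimate: at an index `n` where the residual bound attains a record low, the change
of the dual iterates since step `k`, tested against the error, is controlled by squared
residuals. -/
theorem abs_inner_iter_sub_le (he : ∀ j, 0 < e j)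
    (hres : ∀ j i, ‖F i (iter q Θ F L x₀ ξ₀ y 0 I j).x - y i‖ ≤ e j)
    (hz : z ∈ localSolutions Θ domF F y x₀ ρ) {k n : ℕ} (hkn : k ≤ n)
    (hrec : ∀ j < n, e n ≤ e j) :
    |inner ℝ ((iter q Θ F L x₀ ξ₀ y 0 I n).ξ - (iter q Θ F L x₀ ξ₀ y 0 I k).ξ)
        ((iter q Θ F L x₀ ξ₀ y 0 I n).x - z)|
      ≤ (4 * ρ * ‖(iter q Θ F L x₀ ξ₀ y 0 I k).ξ - (iter q Θ F L x₀ ξ₀ y 0 I k).ξprev‖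
        + q.μ₁ * N ^ 2 * (3 * (1 + q.η)) * ∑ j ∈ Finset.Ico k n, e j ^ 2) / (1 - q.β) := by
  have hd := IsNoisyData.exact y
  set s := iter q Θ F L x₀ ξ₀ y 0 I with hs
  set w := (s n).x - z with hw
  have hball : ∀ j, (s j).x ∈ Metric.closedBall x₀ (2 * ρ) := fun j =>
    (S.iter_admissible hd j).mem_ball
  have h1 : (s n).ξ - (s k).ξ = ∑ j ∈ Finset.Ico k n, ((s (j + 1)).ξ - (s (j + 1)).ξprev) := by
    have : ∀ j, (s (j + 1)).ξprev = (s j).ξ := fun j => by rw [hs, iter, step_ξprev]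
    simp only [this]
    exact (Finset.sum_Ico_sub (fun j => (s j).ξ) hkn).symm
  rw [h1, sum_inner]
  refine (Finset.abs_sum_le_sum_abs _ _).trans ?_
  have h2 := sum_succ_le_of_recursion
    (a := fun j => |inner ℝ ((s j).ξ - (s j).ξprev) w|)
    (b := fun j => q.μ₁ * N ^ 2 * (3 * (1 + q.η)) * e j ^ 2) S.beta_nonneg S.beta_lt
    (fun _ => abs_nonneg _) k hkn fun j _ hj => by
      refine (S.iter_momentum_succ hd j w).trans (add_le_add ?_ le_rfl)
      exact S.stepSize_mul_abs_inner_le (hball j) (hball n) hz (he j).le (hres j)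
        fun i => (hres n i).trans (hrec j hj)
  refine h2.trans (div_le_div_of_nonneg_right ?_ (by linarith [S.beta_lt]))
  rw [← Finset.mul_sum]
  refine add_le_add ?_ le_rfl
  refine (abs_real_inner_le_norm _ _).trans ?_
  rw [mul_comm]
  refine mul_le_mul_of_nonneg_right ?_ (norm_nonneg _)
  have := norm_sub_le_of_mem_closedBall (hball n) hz.1.1
  linarith

/-- With exact data and square summable residuals the method converges to a solution, in norm
and in Bregman distance. The bound on the Bregman distance from the initial guess to the limit
serves as a dominating function later. -/
theorem exists_limit_of_summable (he : ∀ j, 0 < e j) (hes : Summable fun j => e j ^ 2)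
    (hres : ∀ j i, ‖F i (iter q Θ F L x₀ ξ₀ y 0 I j).x - y i‖ ≤ e j)
    (hz : z ∈ localSolutions Θ domF F y x₀ ρ) :
    ∃ p ∈ localSolutions Θ domF F y x₀ ρ,
      Tendsto (fun n => (iter q Θ F L x₀ ξ₀ y 0 I n).x) atTop (𝓝 p) ∧
      Tendsto (fun n => realBregman Θ (iter q Θ F L x₀ ξ₀ y 0 I n).ξ p
        (iter q Θ F L x₀ ξ₀ y 0 I n).x) atTop (𝓝 0) ∧
      realBregman Θ ξ₀ p x₀ ≤ realBregman Θ ξ₀ z x₀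
        + q.μ₁ * N ^ 2 * (3 * (1 + q.η)) * (∑' j, e j ^ 2) / (1 - q.β) := by
  have hd := IsNoisyData.exact y
  have hσ := S.sigma_pos
  have hβ : 0 < 1 - q.β := by linarith [S.beta_lt]
  have hC : 0 ≤ q.μ₁ * N ^ 2 * (3 * (1 + q.η)) := by
    have := S.mu1_pos
    have := S.op.eta_nonneg
    positivity
  set C := q.μ₁ * N ^ 2 * (3 * (1 + q.η)) with hCdef
  set s := iter q Θ F L x₀ ξ₀ y 0 I with hs
  have hadm : ∀ j, Admissible Θ domF F y x₀ ξ₀ ρ (s j) := fun j => S.iter_admissible hd j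
  have hgraph : ∀ j, ((s j).x, (s j).ξ) ∈ subdiffGraph Θ := fun j => S.mem_subdiffGraph (hadm j)
  set Δ : ℕ → ℝ := fun n => realBregman Θ (s n).ξ z (s n).x with hΔ
  have hΔnn : ∀ n, 0 ≤ Δ n := fun n => S.iter_bregman_nonneg hd hz n
  have hΔbdd : BddBelow (Set.range Δ) := ⟨0, by rintro _ ⟨n, rfl⟩; exact hΔnn n⟩
  have hΔlim : Tendsto Δ atTop (𝓝 (⨅ n, Δ n)) :=
    tendsto_atTop_ciInf (S.iter_bregman_antitone hd hz) hΔbdd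
  have hΔinf : 0 ≤ ⨅ n, Δ n := Real.iInf_nonneg hΔnn
  -- modulus of the Cauchy property
  set ε : ℕ → ℝ := fun k => Δ k - (⨅ n, Δ n)
    + (4 * ρ * ‖(s k).ξ - (s k).ξprev‖ + C * ∑' j, e (j + k) ^ 2) / (1 - q.β) with hε
  have hεlim : Tendsto ε atTop (𝓝 0) := by
    have h1 := (S.tendsto_exact_momentum hes he hres).const_mul (4 * ρ)
    have h2 := (tendsto_sum_nat_add fun j => e j ^ 2).const_mul C
    have h3 := (hΔlim.sub_const (⨅ n, Δ n)).add ((h1.add h2).div_const (1 - q.β))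
    simpa using h3
  have hε0 : ε 0 ≤ realBregman Θ ξ₀ z x₀ + C * (∑' j, e j ^ 2) / (1 - q.β) := by
    have h1 : Δ 0 = realBregman Θ ξ₀ z x₀ := rfl
    have h2 : (s 0).ξ - (s 0).ξprev = 0 := sub_self _
    simp only [hε, h1, h2, norm_zero, mul_zero, zero_add, add_zero]
    linarith
  have hmain : ∀ k n, k ≤ n → (∀ j < n, e n ≤ e j) →
      realBregman Θ (s k).ξ (s n).x (s k).x ≤ ε k := by
    intro k n hkn hrec
    have h1 := S.abs_inner_iter_sub_le he hres hz hkn hrec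
    have h2 := le_of_abs_le h1
    have h3 : realBregman Θ (s k).ξ (s n).x (s k).x
        = Δ k - Δ n + inner ℝ ((s n).ξ - (s k).ξ) ((s n).x - z) := by
      simp only [hΔ, realBregman, inner_sub_left, inner_sub_right]
      ring
    have h4 : ∑ j ∈ Finset.Ico k n, e j ^ 2 ≤ ∑' j, e (j + k) ^ 2 := by
      rw [Finset.sum_Ico_eq_sum_range]
      simp only [add_comm k]
      exact ((summable_nat_add_iff k).2 hes).sum_le_tsum _ fun _ _ => sq_nonneg _
    have h5 : (4 * ρ * ‖(s k).ξ - (s k).ξprev‖ + C * ∑ j ∈ Finset.Ico k n, e j ^ 2) / (1 - q.β)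
        ≤ (4 * ρ * ‖(s k).ξ - (s k).ξprev‖ + C * ∑' j, e (j + k) ^ 2) / (1 - q.β) :=
      div_le_div_of_nonneg_right (add_le_add le_rfl (mul_le_mul_of_nonneg_left h4 hC)) hβ.le
    have h6 := ciInf_le hΔbdd n
    simp only [hε]
    linarith
  have helim : Tendsto e atTop (𝓝 0) := by
    have h2 := hes.tendsto_atTop_zero.sqrt
    rw [Real.sqrt_zero] at h2
    exact h2.congr fun j => Real.sqrt_sq (he j).le
  have hrecord : ∃ᶠ n in atTop, ∀ j < n, e n ≤ e j := by
    have h1 : Tendsto (fun n => (e n)⁻¹) atTop atTop :=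
      (tendsto_nhdsWithin_iff.2 ⟨helim, Eventually.of_forall he⟩).inv_tendsto_nhdsGT_zero
    exact (frequently_high_scores h1).mono fun n hn j hj =>
      ((inv_lt_inv₀ (he j) (he n)).1 (hn j hj)).le
  have hdist : ∀ k n, k ≤ n → (∀ j < n, e n ≤ e j) → q.σ * ‖(s n).x - (s k).x‖ ^ 2 ≤ ε k :=
    fun k n hkn hrec => (realBregman_ge S.reg (hgraph k) (hgraph n).1).trans (hmain k n hkn hrec)
  have hcau : CauchySeq fun n => (s n).x := by
    rw [Metric.cauchySeq_iff']
    intro c hc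
    obtain ⟨k₀, hk₀⟩ := (hεlim.eventually (gt_mem_nhds
      (show (0 : ℝ) < q.σ * (c / 2) ^ 2 by positivity))).exists_forall_of_atTop
    have hclose : ∀ k n, k₀ ≤ k → k ≤ n → (∀ j < n, e n ≤ e j) → ‖(s n).x - (s k).x‖ < c / 2 := by
      intro k n hk hkn hrec
      have h1 := (hdist k n hkn hrec).trans_lt (hk₀ k hk)
      exact lt_of_pow_lt_pow_left₀ 2 (by positivity) (lt_of_mul_lt_mul_left h1 hσ.le)
    refine ⟨k₀, fun k hk => ?_⟩
    obtain ⟨n, hn, hrec⟩ := (frequently_atTop.1 hrecord) k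
    have h1 := hclose k n hk hn hrec
    have h2 := hclose k₀ n le_rfl (hk.trans hn) hrec
    have h3 := dist_triangle_left (s k).x (s k₀).x (s n).x
    simp only [dist_eq_norm] at h3 ⊢
    linarith
  obtain ⟨p, hp⟩ := cauchySeq_tendsto_of_complete hcau
  have hpball : p ∈ Metric.closedBall x₀ (2 * ρ) :=
    Metric.isClosed_closedBall.mem_of_tendsto hp
      (Eventually.of_forall fun n => (hadm n).mem_ball)
  have hFp : ∀ i, F i p = y i := by
    intro i
    have h1 := (S.tendsto_F (fun n => (hadm n).mem_ball) hpball hp i).sub_const (y i)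
    have h2 : Tendsto (fun n => F i (s n).x - y i) atTop (𝓝 0) :=
      squeeze_zero_norm (fun n => hres n i) helim
    exact sub_eq_zero.1 (tendsto_nhds_unique h1 h2)
  have hdom : ∀ k, p ∈ effDomain Θ ∧ (Θ p).toReal
      ≤ (Θ (s k).x).toReal + inner ℝ (s k).ξ (p - (s k).x) + ε k := by
    intro k
    refine mem_effDomain_of_tendsto S.reg.proper S.reg.lsc hp
      (c := fun n => (Θ (s k).x).toReal + inner ℝ (s k).ξ ((s n).x - (s k).x) + ε k) ?_ ?_
    · exact (tendsto_const_nhds.add (tendsto_const_nhds.inner (hp.sub_const _))).add_const _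
    · refine (hrecord.and_eventually (eventually_ge_atTop k)).mono fun n hn => ⟨(hgraph n).1, ?_⟩
      have := hmain k n hn.2 hn.1
      simp only [realBregman] at this
      linarith
  have hDp : ∀ k, realBregman Θ (s k).ξ p (s k).x ≤ ε k := by
    intro k
    have := (hdom k).2
    simp only [realBregman]
    linarith
  refine ⟨p, ⟨⟨hpball, (hdom 0).1⟩, S.mem_solutionSet_of_ball hpball hFp⟩, hp, ?_, ?_⟩
  · exact squeeze_zero (fun n => realBregman_nonneg S.reg (hgraph n) (hdom 0).1) hDp hεlim
  · exact (hDp 0).trans hε0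

/-- An iterate that solves the system is never left again. -/
theorem eq_limit_of_mem_localSolutions {n : ℕ}
    (hn : (iter q Θ F L x₀ ξ₀ y 0 I n).x ∈ localSolutions Θ domF F y x₀ ρ)
    (hp : Tendsto (fun n => (iter q Θ F L x₀ ξ₀ y 0 I n).x) atTop (𝓝 p)) :
    p = (iter q Θ F L x₀ ξ₀ y 0 I n).x := by
  have hd := IsNoisyData.exact y
  refine tendsto_nhds_unique hp (tendsto_const_nhds.congr' ?_)
  filter_upwards [eventually_ge_atTop n] with k hk
  have h1 := S.iter_bregman_antitone hd hn (I := I) hk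
  simp only [realBregman_self] at h1
  exact (eq_of_realBregman_nonpos S.reg (S.mem_subdiffGraph (S.iter_admissible hd k)) hn.1.2
    h1).symm

theorem inner_iter_eq (hd : IsNoisyData y yδ δ)
    (hv : ∀ i, ∀ x ∈ Metric.closedBall x₀ (2 * ρ), ∀ φ, inner ℝ (adjointMap (L i x) φ) v = 0)
    (n : ℕ) :
    inner ℝ (iter q Θ F L x₀ ξ₀ yδ δ I n).ξ v = inner ℝ ξ₀ v ∧
      inner ℝ (iter q Θ F L x₀ ξ₀ yδ δ I n).ξprev v = inner ℝ ξ₀ v := by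
  induction n with
  | zero => exact ⟨rfl, rfl⟩
  | succ n ih =>
    refine ⟨?_, ih.1⟩
    have hg : inner ℝ (gradTerm q F L yδ δ (I n) (iter q Θ F L x₀ ξ₀ yδ δ I n).x) v = 0 := by
      rw [gradTerm, sum_inner]
      exact Finset.sum_eq_zero fun i _ => hv i _ (S.iter_admissible hd n).mem_ball _
    rw [iter, step_ξ, inner_add_left, inner_sub_left, real_inner_smul_left, real_inner_smul_left,
      inner_sub_left, hg, ih.1, ih.2]
    ring

/-- Under the range condition the limit is the solution of minimal Bregman distance: the dual
iterates move orthogonally to the difference of any two solutions. -/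
theorem eq_minimalDistanceSolution_of_range {xdag : X}
    (hp : p ∈ localSolutions Θ domF F y x₀ ρ)
    (hlim : Tendsto (fun n => (iter q Θ F L x₀ ξ₀ y 0 I n).x) atTop (𝓝 p))
    (hD : Tendsto (fun n => realBregman Θ (iter q Θ F L x₀ ξ₀ y 0 I n).ξ p
        (iter q Θ F L x₀ ξ₀ y 0 I n).x) atTop (𝓝 0))
    (hdag : IsMinimalDistanceSolution Θ domF F y x₀ ξ₀ xdag)
    (hran : ∀ i, ∀ x ∈ Metric.closedBall x₀ (2 * ρ),
      Set.range (adjointMap (L i x)) ⊆ closure (Set.range (adjointMap (L i xdag)))) :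
    p = xdag := by
  have hd := IsNoisyData.exact y
  have hdl := S.mem_localSolutions_of_minimal hdag
  have hker : ∀ i, L i xdag (p - xdag) = 0 := by
    intro i
    have h1 := (S.F_eq_iff hdl.1.1 hp.1.1 i).1 (by rw [hdl.2.2 i, hp.2.2 i])
    rw [← neg_sub, map_neg, h1, neg_zero]
  have hv : ∀ i, ∀ x ∈ Metric.closedBall x₀ (2 * ρ), ∀ φ,
      inner ℝ (adjointMap (L i x) φ) (p - xdag) = 0 := by
    intro i x hx φ
    have h1 : closure (Set.range (adjointMap (L i xdag))) ⊆ {a | inner ℝ a (p - xdag) = 0} := by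
      refine closure_minimal ?_ (isClosed_eq (continuous_id.inner continuous_const)
        continuous_const)
      rintro _ ⟨φ, rfl⟩
      simp [inner_adjointMap, hker i]
    exact h1 (hran i x hx ⟨φ, rfl⟩)
  have hmin : realBregman Θ ξ₀ xdag x₀ ≤ realBregman Θ ξ₀ p x₀ := by
    have := hdag.2 p ⟨hp.1.2, hp.2⟩
    rw [bregman_eq_coe S.reg.proper ξ₀ hdl.1.2 S.init.1,
      bregman_eq_coe S.reg.proper ξ₀ hp.1.2 S.init.1, EReal.coe_le_coe_iff] at this
    exact this
  have hle : ∀ n, q.σ * ‖xdag - (iter q Θ F L x₀ ξ₀ y 0 I n).x‖ ^ 2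
      ≤ realBregman Θ (iter q Θ F L x₀ ξ₀ y 0 I n).ξ p (iter q Θ F L x₀ ξ₀ y 0 I n).x := by
    intro n
    refine (realBregman_ge S.reg (S.mem_subdiffGraph (S.iter_admissible hd n)) hdl.1.2).trans ?_
    have h1 := (S.inner_iter_eq hd hv n (I := I)).1
    simp only [realBregman, inner_sub_right] at h1 hmin ⊢
    linarith
  have h1 : Tendsto (fun n => q.σ * ‖xdag - (iter q Θ F L x₀ ξ₀ y 0 I n).x‖ ^ 2) atTop
      (𝓝 (q.σ * ‖xdag - p‖ ^ 2)) := ((tendsto_const_nhds.sub hlim).norm.pow 2).const_mul _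
  have h2 := le_of_tendsto_of_tendsto' h1 hD hle
  have h3 : ‖xdag - p‖ ^ 2 ≤ 0 := by
    by_contra hc
    push Not at hc
    have := mul_pos S.sigma_pos hc
    linarith
  exact (sub_eq_zero.1 (norm_eq_zero.1
    (pow_eq_zero_iff two_ne_zero |>.1 (le_antisymm h3 (sq_nonneg _))))).symm

end Setting

end Exact

/-! ### Regularization along a fixed sequence of batches -/

section Regularization

variable {X : Type*} [NormedAddCommGroup X] [InnerProductSpace ℝ X] [CompleteSpace X]
  {N : ℕ} {Y : Fin N → Type*} [∀ i, NormedAddCommGroup (Y i)] [∀ i, NormedSpace ℝ (Y i)]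
  {Θ : X → EReal} {domF : Fin N → Set X} {F : ∀ i, X → Y i}
  {L : ∀ i, X → X →L[ℝ] Y i} {y : ∀ i, Y i} {x₀ ξ₀ : X} {ρ B₀ : ℝ} {q : Params}
  {I : ℕ → Finset (Fin N)} {z p : X}

theorem Setting.exists_limit_of_summable_sq (S : Setting Θ domF F L y x₀ ξ₀ ρ B₀ q)
    (hsum : ∀ i, Summable fun n => ‖F i (iter q Θ F L x₀ ξ₀ y 0 I n).x - y i‖ ^ 2)
    (hz : z ∈ localSolutions Θ domF F y x₀ ρ) :
    ∃ p ∈ localSolutions Θ domF F y x₀ ρ,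
      Tendsto (fun n => (iter q Θ F L x₀ ξ₀ y 0 I n).x) atTop (𝓝 p) ∧
      Tendsto (fun n => realBregman Θ (iter q Θ F L x₀ ξ₀ y 0 I n).ξ p
        (iter q Θ F L x₀ ξ₀ y 0 I n).x) atTop (𝓝 0) ∧
      realBregman Θ ξ₀ p x₀ ≤ realBregman Θ ξ₀ z x₀
        + q.μ₁ * N ^ 2 * (3 * (1 + q.η))
          * (2 * N * ∑ i, ∑' n, ‖F i (iter q Θ F L x₀ ξ₀ y 0 I n).x - y i‖ ^ 2
            + 2 * ∑' n : ℕ, (1 / 4 : ℝ) ^ n) / (1 - q.β) := by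
  set r : Fin N → ℕ → ℝ := fun i n => ‖F i (iter q Θ F L x₀ ξ₀ y 0 I n).x - y i‖ with hr
  have hr0 : ∀ i n, 0 ≤ r i n := fun i n => norm_nonneg _
  -- the geometric term keeps the bound positive, so that record lows exist
  let e : ℕ → ℝ := fun n => ∑ i, r i n + (1 / 2) ^ n
  have he : ∀ n, 0 < e n := fun n =>
    add_pos_of_nonneg_of_pos (Finset.sum_nonneg fun i _ => hr0 i n) (by positivity)
  have hre : ∀ n i, r i n ≤ e n := by
    intro n i
    have h1 := Finset.single_le_sum (f := fun i => r i n) (fun i _ => hr0 i n) (Finset.mem_univ i)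
    have h2 : (0 : ℝ) ≤ (1 / 2) ^ n := by positivity
    simp only [e]
    linarith
  have hgeo : Summable fun n : ℕ => (1 / 4 : ℝ) ^ n :=
    summable_geometric_of_lt_one (by norm_num) (by norm_num)
  have hmaj : Summable fun n => 2 * N * ∑ i, r i n ^ 2 + 2 * (1 / 4 : ℝ) ^ n :=
    ((summable_sum fun i _ => hsum i).mul_left _).add (hgeo.mul_left _)
  have hle : ∀ n, e n ^ 2 ≤ 2 * N * ∑ i, r i n ^ 2 + 2 * (1 / 4 : ℝ) ^ n := by
    intro n
    have h1 := sq_sum_le_card_mul_sum_sq (s := (Finset.univ : Finset (Fin N)))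
      (f := fun i => r i n)
    rw [Finset.card_univ, Fintype.card_fin] at h1
    have h2 : ((1 / 2 : ℝ) ^ n) ^ 2 = (1 / 4) ^ n := by
      rw [← pow_mul, mul_comm, pow_mul]
      norm_num
    have h3 := add_sq_le (a := ∑ i, r i n) (b := (1 / 2 : ℝ) ^ n)
    rw [h2] at h3
    simp only [e]
    linarith
  have hes : Summable fun n => e n ^ 2 := hmaj.of_nonneg_of_le (fun n => sq_nonneg _) hle
  obtain ⟨p, hp, h1, h2, h3⟩ := S.exists_limit_of_summable he hes hre hz
  refine ⟨p, hp, h1, h2, h3.trans (add_le_add le_rfl ?_)⟩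
  have h4 : ∑' n, e n ^ 2 ≤ 2 * N * ∑ i, ∑' n, r i n ^ 2 + 2 * ∑' n : ℕ, (1 / 4 : ℝ) ^ n := by
    refine (hes.tsum_le_tsum hle hmaj).trans (le_of_eq ?_)
    rw [((summable_sum fun i _ => hsum i).mul_left _).tsum_add (hgeo.mul_left _), tsum_mul_left,
      tsum_mul_left, Summable.tsum_finsetSum fun i _ => hsum i]
  refine div_le_div_of_nonneg_right (mul_le_mul_of_nonneg_left h4 ?_) (by linarith [S.beta_lt])
  have := S.mu1_pos
  have := S.op.eta_nonneg
  positivity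

theorem Setting.mem_localSolutions_of_iter_solves (S : Setting Θ domF F L y x₀ ξ₀ ρ B₀ q)
    {n : ℕ} (h : ∀ i, F i (iter q Θ F L x₀ ξ₀ y 0 I n).x = y i) :
    (iter q Θ F L x₀ ξ₀ y 0 I n).x ∈ localSolutions Θ domF F y x₀ ρ := by
  have hadm := S.iter_admissible (IsNoisyData.exact y) n (I := I)
  exact ⟨⟨hadm.mem_ball, (S.mem_subdiffGraph hadm).1⟩, S.mem_solutionSet_of_ball hadm.mem_ball h⟩

/-- Convergence of the stopped iterates to the limit `p` of the method with exact data.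
Compare with a fixed late iterate: if the stopping index is larger, monotonicity applies; if a
smaller index `m` is the stopping index for arbitrarily small noise then the exact `m`-th iterate
solves the system and equals `p`. -/
theorem Setting.tendsto_output_bregman (S : Setting Θ domF F L y x₀ ξ₀ ρ B₀ q)
    {yδ : ℕ → ∀ i, Y i} {δ : ℕ → Fin N → ℝ} (hd : ∀ k, IsNoisyData y (yδ k) (δ k))
    (hδ : ∀ i, Tendsto (fun k => δ k i) atTop (𝓝 0))
    (hterm : ∀ k, Terminates q Θ F L x₀ ξ₀ (yδ k) (δ k) I)
    (hp : p ∈ localSolutions Θ domF F y x₀ ρ)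
    (hlim : Tendsto (fun n => (iter q Θ F L x₀ ξ₀ y 0 I n).x) atTop (𝓝 p))
    (hD : Tendsto (fun n => realBregman Θ (iter q Θ F L x₀ ξ₀ y 0 I n).ξ p
        (iter q Θ F L x₀ ξ₀ y 0 I n).x) atTop (𝓝 0)) :
    Tendsto (fun k => realBregman Θ (output q Θ F L x₀ ξ₀ (yδ k) (δ k) I).ξ p
      (output q Θ F L x₀ ξ₀ (yδ k) (δ k) I).x) atTop (𝓝 0) := by
  set ν : ℕ → ℕ := fun k => stopIndex q Θ F L x₀ ξ₀ (yδ k) (δ k) I with hν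
  have hout : ∀ k, output q Θ F L x₀ ξ₀ (yδ k) (δ k) I
      = iter q Θ F L x₀ ξ₀ (yδ k) (δ k) I (ν k) := fun _ => rfl
  have hactive : ∀ k, (iter q Θ F L x₀ ξ₀ (yδ k) (δ k) I (ν k)).active = ∅ := fun k =>
    Nat.sInf_mem (hterm k)
  simp only [hout]
  rw [Metric.tendsto_nhds]
  intro c hc
  obtain ⟨n, hn⟩ := (hD.eventually (gt_mem_nhds hc)).exists
  have hlate : ∀ᶠ k in atTop, realBregman Θ (iter q Θ F L x₀ ξ₀ (yδ k) (δ k) I n).ξ p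
      (iter q Θ F L x₀ ξ₀ (yδ k) (δ k) I n).x < c :=
    (S.tendsto_iter_bregman hd hδ n p).eventually (gt_mem_nhds hn)
  have hearly : ∀ m ∈ Finset.range n, ∀ᶠ k in atTop, ν k = m →
      realBregman Θ (iter q Θ F L x₀ ξ₀ (yδ k) (δ k) I m).ξ p
        (iter q Θ F L x₀ ξ₀ (yδ k) (δ k) I m).x < c := by
    intro m _
    by_cases hfreq : ∃ᶠ k in atTop, ν k = m
    · have hres : ∀ i, F i (iter q Θ F L x₀ ξ₀ y 0 I m).x = y i := by
        intro i
        have h1 := (S.tendsto_residual hd hδ (fun k => (S.iter_admissible (hd k) m).mem_ball)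
          (S.iter_admissible (IsNoisyData.exact y) m).mem_ball
          (S.tendsto_iter hd hδ m (I := I)).x i).norm.sub ((hδ i).const_mul q.τ)
        have h2 := le_of_tendsto_of_frequently (b := 0) h1 (hfreq.mono fun k hk => by
          have := S.residual_le_of_notMem_active (hd k) (ν k) (I := I) (i := i)
            (by rw [hactive k]; exact Finset.notMem_empty i)
          rw [hk] at this
          linarith)
        rw [mul_zero, sub_zero] at h2
        exact sub_eq_zero.1 (norm_le_zero_iff.1 h2)
      have hpm := S.eq_limit_of_mem_localSolutions
        (S.mem_localSolutions_of_iter_solves hres) hlim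
      have h3 := S.tendsto_iter_bregman hd hδ m p (I := I)
      rw [← hpm, realBregman_self] at h3
      filter_upwards [h3.eventually (gt_mem_nhds hc)] with k hk _
      exact hk
    · filter_upwards [not_frequently.1 hfreq] with k hk hk'
      exact absurd hk' hk
  filter_upwards [hlate, (eventually_all_finset _).2 hearly] with k hk1 hk2
  rw [Real.dist_0_eq_abs, abs_of_nonneg (S.iter_bregman_nonneg (hd k) hp _)]
  rcases lt_or_ge (ν k) n with h | h
  · exact hk2 _ (Finset.mem_range.2 h) rfl
  · exact (S.iter_bregman_antitone (hd k) hp h).trans_lt hk1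

end Regularization

/-! ### Random batches: measurability and independence -/

section Measurability

variable {Ω : Type*} [MeasurableSpace Ω]

/-- Functions of a countably-valued discrete random variable are strongly measurable. -/
theorem stronglyMeasurable_comp_of_countable {Z E : Type*} [TopologicalSpace E]
    [TopologicalSpace.PseudoMetrizableSpace E] {f : Ω → Z}
    (hf : ∀ A : Set Z, MeasurableSet (f ⁻¹' A)) (hc : (Set.range f).Countable) (h : Z → E) :
    StronglyMeasurable fun ω => h (f ω) := by
  borelize E
  refine stronglyMeasurable_iff_measurable_separable.2 ⟨fun A _ => hf (h ⁻¹' A), ?_⟩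
  have : Set.range (fun ω => h (f ω)) = h '' Set.range f := by
    rw [← Set.range_comp]
    rfl
  rw [this]
  exact (hc.image h).isSeparable

variable {N : ℕ} {P : Measure Ω} {b : ℕ} {I : ℕ → Ω → Finset (Fin N)}

theorem IsUniformBatchSequence.measurableSet_preimage (hI : IsUniformBatchSequence P b I) (n : ℕ)
    (A : Set (Finset (Fin N))) : MeasurableSet (I n ⁻¹' A) := by
  have : I n ⁻¹' A = ⋃ s ∈ A, I n ⁻¹' {s} := by
    ext ω
    simp
  rw [this]
  exact (Set.toFinite A).measurableSet_biUnion fun s _ => hI.measurable n s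

theorem IsUniformBatchSequence.le_measure_mem (hI : IsUniformBatchSequence P b I) (hb : 1 ≤ b)
    (hbN : b ≤ N) (n : ℕ) (i : Fin N) :
    ((N.choose b : ℕ) : ENNReal)⁻¹ ≤ P {ω | i ∈ I n ω} := by
  obtain ⟨s, his, -, hs⟩ := Finset.exists_subsuperset_card_eq
    (Finset.subset_univ ({i} : Finset (Fin N))) (n := b) (by simpa using hb) (by simpa using hbN)
  rw [← hI.uniform n s hs]
  refine measure_mono fun ω hω => ?_
  have : I n ω = s := hω
  change i ∈ I n ω
  rw [this]
  exact his (Finset.mem_singleton_self i)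

/-- Almost surely every equation is drawn infinitely often. -/
theorem IsUniformBatchSequence.ae_frequently_mem (hI : IsUniformBatchSequence P b I)
    [IsProbabilityMeasure P] (hb : 1 ≤ b) (hbN : b ≤ N) :
    ∀ᵐ ω ∂P, ∀ i, ∃ᶠ n in atTop, i ∈ I n ω := by
  rw [ae_all_iff]
  intro i
  have hms : ∀ n, MeasurableSet {ω | i ∈ I n ω} := fun n =>
    hI.measurableSet_preimage n {s | i ∈ s}
  have hind : iIndepSet (fun n => {ω | i ∈ I n ω}) P := by
    rw [iIndepSet_iff_meas_biInter hms]
    intro T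
    exact hI.indep.measure_inter_preimage_eq_mul T (sets := fun _ => {s | i ∈ s})
      fun _ _ => trivial
  have hsum : ∑' n, P {ω | i ∈ I n ω} = ⊤ := by
    refine top_unique ?_
    rw [← ENNReal.tsum_const_eq_top_of_ne_zero (α := ℕ)
      (c := ((N.choose b : ℕ) : ENNReal)⁻¹) (by simp)]
    exact ENNReal.tsum_le_tsum fun n => hI.le_measure_mem hb hbN n i
  have h1 := measure_limsup_eq_one hms hind hsum
  have h2 : MeasurableSet (limsup (fun n => {ω | i ∈ I n ω}) atTop) :=
    MeasurableSet.measurableSet_limsup hms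
  have h3 := (prob_compl_eq_zero_iff h2).2 h1
  rw [← mem_ae_iff] at h3
  filter_upwards [h3] with ω hω
  exact (mem_limsup_iff_frequently_mem (s := fun n => {ω | i ∈ I n ω})).1 hω

end Measurability

section RandomIteration

variable {X : Type*} [NormedAddCommGroup X] [InnerProductSpace ℝ X] [CompleteSpace X]
  {N : ℕ} {Y : Fin N → Type*} [∀ i, NormedAddCommGroup (Y i)] [∀ i, NormedSpace ℝ (Y i)]
  {Θ : X → EReal} {domF : Fin N → Set X} {F : ∀ i, X → Y i}
  {L : ∀ i, X → X →L[ℝ] Y i} {y : ∀ i, Y i} {x₀ ξ₀ : X} {ρ B₀ : ℝ} {q : Params}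
  {Ω : Type*} [MeasurableSpace Ω] {P : Measure Ω} {b : ℕ} {I : ℕ → Ω → Finset (Fin N)}
  {yδ : ∀ i, Y i} {δ : Fin N → ℝ}

theorem iter_congr {I I' : ℕ → Finset (Fin N)} (n : ℕ) (h : ∀ k < n, I k = I' k) :
    iter q Θ F L x₀ ξ₀ yδ δ I n = iter q Θ F L x₀ ξ₀ yδ δ I' n := by
  induction n with
  | zero => rfl
  | succ n ih => rw [iter, iter, ih fun k hk => h k (by omega), h n (by omega)]

/-- The `n`-th iterate as a function of the first `n` batches. -/
def iterOfPast (q : Params) (Θ : X → EReal) (F : ∀ i, X → Y i) (L : ∀ i, X → X →L[ℝ] Y i)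
    (x₀ ξ₀ : X) (yδ : ∀ i, Y i) (δ : Fin N → ℝ) (n : ℕ)
    (J : Finset.range n → Finset (Fin N)) : State X N :=
  iter q Θ F L x₀ ξ₀ yδ δ (fun k => if h : k ∈ Finset.range n then J ⟨k, h⟩ else ∅) n

omit [MeasurableSpace Ω] in
theorem iter_eq_iterOfPast (n : ℕ) (ω : Ω) :
    iter q Θ F L x₀ ξ₀ yδ δ (fun k => I k ω) n
      = iterOfPast q Θ F L x₀ ξ₀ yδ δ n fun k => I k ω := by
  refine iter_congr n fun k hk => ?_
  rw [dif_pos (Finset.mem_range.2 hk)]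

omit [MeasurableSpace Ω] in
theorem finite_range_iter (n : ℕ) :
    (Set.range fun ω => iter q Θ F L x₀ ξ₀ yδ δ (fun k => I k ω) n).Finite := by
  refine (Set.finite_range (iterOfPast q Θ F L x₀ ξ₀ yδ δ n)).subset ?_
  rintro _ ⟨ω, rfl⟩
  exact ⟨_, (iter_eq_iterOfPast n ω).symm⟩

theorem measurableSet_iter (hI : IsUniformBatchSequence P b I) (n : ℕ) (A : Set (State X N)) :
    MeasurableSet ((fun ω => iter q Θ F L x₀ ξ₀ yδ δ (fun k => I k ω) n) ⁻¹' A) := by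
  have : (fun ω => iter q Θ F L x₀ ξ₀ yδ δ (fun k => I k ω) n) ⁻¹' A
      = ⋃ J ∈ {J | iterOfPast q Θ F L x₀ ξ₀ yδ δ n J ∈ A},
        ⋂ k : Finset.range n, I k ⁻¹' {J k} := by
    ext ω
    simp only [Set.mem_preimage, iter_eq_iterOfPast, Set.mem_ofPred_eq, Set.mem_iUnion,
      Set.mem_iInter, Set.mem_singleton_iff, exists_prop]
    constructor
    · intro h
      exact ⟨_, h, fun _ => rfl⟩
    · rintro ⟨J, hJ, hk⟩
      rwa [show (fun k : Finset.range n => I k ω) = J from funext hk]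
  rw [this]
  exact (Set.toFinite _).measurableSet_biUnion fun J _ =>
    MeasurableSet.iInter fun k => hI.measurable k (J k)

theorem stronglyMeasurable_iter (hI : IsUniformBatchSequence P b I) (n : ℕ) {E : Type*}
    [TopologicalSpace E] [TopologicalSpace.PseudoMetrizableSpace E] (h : State X N → E) :
    StronglyMeasurable fun ω => h (iter q Θ F L x₀ ξ₀ yδ δ (fun k => I k ω) n) :=
  stronglyMeasurable_comp_of_countable (measurableSet_iter hI n) (finite_range_iter n).countable h

theorem measurableSet_stopIndex (hI : IsUniformBatchSequence P b I) (n : ℕ) :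
    MeasurableSet {ω | stopIndex q Θ F L x₀ ξ₀ yδ δ (fun k => I k ω) = n} := by
  set E : ℕ → Set Ω := fun k =>
    {ω | (iter q Θ F L x₀ ξ₀ yδ δ (fun k => I k ω) k).active = ∅} with hE
  have hEm : ∀ k, MeasurableSet (E k) := fun k => measurableSet_iter hI k {s | s.active = ∅}
  have : {ω | stopIndex q Θ F L x₀ ξ₀ yδ δ (fun k => I k ω) = n}
      = (E n ∩ ⋂ k, ⋂ _ : k < n, (E k)ᶜ) ∪ (⋂ k, (E k)ᶜ) ∩ {_ω | n = 0} := by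
    ext ω
    have hst : stopIndex q Θ F L x₀ ξ₀ yδ δ (fun k => I k ω) = sInf {k | ω ∈ E k} := rfl
    simp only [Set.mem_ofPred_eq, Set.mem_union, Set.mem_inter_iff, Set.mem_iInter,
      Set.mem_compl_iff]
    rw [hst]
    constructor
    · rintro rfl
      by_cases hne : {k | ω ∈ E k}.Nonempty
      · exact Or.inl ⟨Nat.sInf_mem hne, fun k hk => Nat.notMem_of_lt_sInf hk⟩
      · have hemp := Set.not_nonempty_iff_eq_empty.1 hne
        refine Or.inr ⟨fun k hk => hne ⟨k, hk⟩, ?_⟩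
        rw [hemp, Nat.sInf_empty]
    · rintro (⟨h1, h2⟩ | ⟨h1, rfl⟩)
      · refine le_antisymm (Nat.sInf_le h1) ?_
        by_contra hc
        push Not at hc
        exact h2 _ hc (Nat.sInf_mem (s := {k | ω ∈ E k}) ⟨n, h1⟩)
      · have : {k | ω ∈ E k} = ∅ := Set.eq_empty_of_forall_notMem h1
        rw [this, Nat.sInf_empty]
  rw [this]
  refine ((hEm n).inter (MeasurableSet.iInter fun k => MeasurableSet.iInter fun _ =>
    (hEm k).compl)).union ((MeasurableSet.iInter fun k => (hEm k).compl).inter ?_)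
  exact MeasurableSet.const _

theorem stronglyMeasurable_output (hI : IsUniformBatchSequence P b I) {E : Type*}
    [TopologicalSpace E] [TopologicalSpace.PseudoMetrizableSpace E] (h : State X N → E) :
    StronglyMeasurable fun ω => h (output q Θ F L x₀ ξ₀ yδ δ (fun k => I k ω)) := by
  refine stronglyMeasurable_comp_of_countable (fun A => ?_) ?_ h
  · have : (fun ω => output q Θ F L x₀ ξ₀ yδ δ (fun k => I k ω)) ⁻¹' A
        = ⋃ n, {ω | stopIndex q Θ F L x₀ ξ₀ yδ δ (fun k => I k ω) = n}
          ∩ (fun ω => iter q Θ F L x₀ ξ₀ yδ δ (fun k => I k ω) n) ⁻¹' A := by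
      ext ω
      simp [output]
    rw [this]
    exact MeasurableSet.iUnion fun n =>
      (measurableSet_stopIndex hI n).inter (measurableSet_iter hI n A)
  · refine (Set.countable_iUnion fun n => (finite_range_iter (q := q) (Θ := Θ) (F := F) (L := L)
      (x₀ := x₀) (ξ₀ := ξ₀) (yδ := yδ) (δ := δ) (I := I) n).countable).mono ?_
    rintro _ ⟨ω, rfl⟩
    exact Set.mem_iUnion.2 ⟨_, ω, rfl⟩

/-- The `n`-th batch is independent of the `n`-th iterate: a nonnegative function of the iterate
is seen by an equation in the batch with a fixed proportion of its expectation. -/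
theorem lintegral_iter_mul_le (hI : IsUniformBatchSequence P b I) (hb : 1 ≤ b) (hbN : b ≤ N)
    (n : ℕ) (i : Fin N) (h : State X N → ENNReal) :
    ((N.choose b : ℕ) : ENNReal)⁻¹ * ∫⁻ ω, h (iter q Θ F L x₀ ξ₀ yδ δ (fun k => I k ω) n) ∂P
      ≤ ∫⁻ ω, h (iter q Θ F L x₀ ξ₀ yδ δ (fun k => I k ω) n)
          * {ω | i ∈ I n ω}.indicator 1 ω ∂P := by
  let _ : MeasurableSpace (Finset (Fin N)) := ⊤
  have _ : DiscreteMeasurableSpace (Finset (Fin N)) := ⟨fun _ => trivial⟩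
  have hm : ∀ n, Measurable (I n) := fun n => measurable_to_countable' (hI.measurable n)
  have hmi : MeasurableSet {ω | i ∈ I n ω} := hI.measurableSet_preimage n {s | i ∈ s}
  have h1 := hI.indep.indepFun_finset (Finset.range n) {n} (by simp) hm
  have h2 := h1.comp
    (φ := fun J => h (iterOfPast q Θ F L x₀ ξ₀ yδ δ n J))
    (ψ := fun J => {s : Finset (Fin N) | i ∈ s}.indicator (1 : Finset (Fin N) → ENNReal)
      (J ⟨n, Finset.mem_singleton_self n⟩))
    (measurable_of_finite _) (measurable_of_finite _)
  have hf : Measurable fun ω => h (iter q Θ F L x₀ ξ₀ yδ δ (fun k => I k ω) n) :=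
    (stronglyMeasurable_iter hI n h).measurable
  have h3 := lintegral_mul_eq_lintegral_mul_lintegral_of_indepFun (μ := P)
    (f := fun ω => h (iter q Θ F L x₀ ξ₀ yδ δ (fun k => I k ω) n))
    (g := {ω | i ∈ I n ω}.indicator 1) hf (measurable_one.indicator hmi) (by
      simp only [iter_eq_iterOfPast]
      exact h2)
  have h4 : ∫⁻ ω, {ω | i ∈ I n ω}.indicator 1 ω ∂P = P {ω | i ∈ I n ω} :=
    lintegral_indicator_one hmi
  rw [h4] at h3
  refine le_trans ?_ h3.ge
  rw [mul_comm]
  gcongr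
  exact hI.le_measure_mem hb hbN n i

/-- With exact data the residuals of each equation are square summable in expectation. -/
theorem Setting.lintegral_tsum_residual_lt_top (S : Setting Θ domF F L y x₀ ξ₀ ρ B₀ q)
    [IsProbabilityMeasure P] (hI : IsUniformBatchSequence P b I) (hb : 1 ≤ b) (hbN : b ≤ N)
    (i : Fin N) :
    ∫⁻ ω, ∑' n, ENNReal.ofReal
      (‖F i (iter q Θ F L x₀ ξ₀ y 0 (fun k => I k ω) n).x - y i‖ ^ 2) ∂P < ⊤ := by
  have hd := IsNoisyData.exact y
  obtain ⟨z, hz, -⟩ := S.exists_near_solution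
  have hB : 0 < B₀ * N := mul_pos S.op.B_pos (by exact_mod_cast S.N_pos)
  have hgap := S.gap_pos
  have hμ₀ := S.mu0_pos
  have hone := S.one_sub_mu0_div_pos
  have hmin : 0 < min (q.μ₀ * gap q / (B₀ * N) ^ 2) q.μ₁ := lt_min (by positivity) S.mu1_pos
  set c := (1 - q.μ₀ / (4 * q.σ)) * (gap q * min (q.μ₀ * gap q / (B₀ * N) ^ 2) q.μ₁) with hc
  have hc0 : 0 < c := by positivity
  let h : State X N → ENNReal := fun s => ENNReal.ofReal (‖F i s.x - y i‖ ^ 2)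
  let f : ℕ → Ω → ENNReal := fun n ω => h (iter q Θ F L x₀ ξ₀ y 0 (fun k => I k ω) n)
  have hfm : ∀ n, Measurable (f n) := fun n => (stronglyMeasurable_iter hI n h).measurable
  have hmi : ∀ n, MeasurableSet {ω | i ∈ I n ω} := fun n =>
    hI.measurableSet_preimage n {s | i ∈ s}
  -- the decrease of the Bregman distance pays for the residuals that are seen
  have hpt : ∀ ω, ∑' n, f n ω * {ω | i ∈ I n ω}.indicator 1 ω
      ≤ ENNReal.ofReal (realBregman Θ ξ₀ z x₀ / c) := by
    intro ω
    refine ENNReal.tsum_le_of_sum_range_le fun M => ?_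
    set s := iter q Θ F L x₀ ξ₀ y 0 (fun k => I k ω) with hs
    have hterm : ∀ n, f n ω * {ω | i ∈ I n ω}.indicator 1 ω
        ≤ ENNReal.ofReal ((realBregman Θ (s n).ξ z (s n).x
          - realBregman Θ (s (n + 1)).ξ z (s (n + 1)).x) / c) := by
      intro n
      by_cases hi : i ∈ I n ω
      · rw [Set.indicator_of_mem (show ω ∈ {ω | i ∈ I n ω} from hi), Pi.one_apply, mul_one]
        refine ENNReal.ofReal_le_ofReal ?_
        rw [le_div_iff₀ hc0]
        have h1 := S.step_descent hd (S.iter_admissible hd n (I := fun k => I k ω)) hz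
          (J := I n ω)
        have h3 := mul_nonneg (S.stateMomentum_nonneg hd (J := I n ω) (s := s n))
          (mul_nonneg (mul_nonneg S.ups1_pos.le hd.iInf_nonneg)
            (sq_nonneg ‖(s n).ξ - (s n).ξprev‖))
        have h5 : gap q * min (q.μ₀ * gap q / (B₀ * N) ^ 2) q.μ₁ * ‖F i (s n).x - y i‖ ^ 2
            ≤ stepSize q F L y 0 (I n ω) (s n).x * phiTerm q F y 0 (I n ω) (s n).x := by
          by_cases hr : ‖F i (s n).x - y i‖ = 0
          · rw [hr]
            simpa using mul_nonneg (S.stepSize_nonneg hd) (S.phiTerm_nonneg hd)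
          · refine S.residual_sq_le hd (S.iter_admissible hd n).mem_ball
              (mem_violating.2 ⟨hi, ?_⟩)
            rw [Pi.zero_apply, mul_zero]
            exact (norm_nonneg _).lt_of_ne' hr
        have h6 := mul_le_mul_of_nonneg_left h5 hone.le
        have h7 : s (n + 1) = step q Θ F L y 0 (I n ω) (s n) := rfl
        rw [h7]
        rw [← hs] at h1
        rw [hc]
        linarith
      · rw [Set.indicator_of_notMem (show ω ∉ {ω | i ∈ I n ω} from hi), mul_zero]
        exact zero_le
    refine (Finset.sum_le_sum fun n _ => hterm n).trans ?_
    rw [← ENNReal.ofReal_sum_of_nonneg]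
    · refine ENNReal.ofReal_le_ofReal ?_
      rw [← Finset.sum_div, Finset.sum_range_sub' fun n => realBregman Θ (s n).ξ z (s n).x]
      refine div_le_div_of_nonneg_right ?_ hc0.le
      have h1 := S.iter_bregman_nonneg hd hz M (I := fun k => I k ω)
      have h2 : realBregman Θ (s 0).ξ z (s 0).x = realBregman Θ ξ₀ z x₀ := rfl
      linarith
    · intro n _
      exact div_nonneg (sub_nonneg.2 (S.iter_bregman_antitone hd hz (Nat.le_succ n))) hc0.le
  have hp0 : ((N.choose b : ℕ) : ENNReal)⁻¹ ≠ 0 := by simp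
  have hle : ((N.choose b : ℕ) : ENNReal)⁻¹ * ∫⁻ ω, ∑' n, f n ω ∂P
      ≤ ENNReal.ofReal (realBregman Θ ξ₀ z x₀ / c) := by
    rw [lintegral_tsum fun n => (hfm n).aemeasurable, ← ENNReal.tsum_mul_left]
    calc _ ≤ ∑' n, ∫⁻ ω, f n ω * {ω | i ∈ I n ω}.indicator 1 ω ∂P :=
          ENNReal.tsum_le_tsum fun n => lintegral_iter_mul_le hI hb hbN n i h
      _ = ∫⁻ ω, ∑' n, f n ω * {ω | i ∈ I n ω}.indicator 1 ω ∂P :=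
          (lintegral_tsum fun n =>
            ((hfm n).mul (measurable_one.indicator (hmi n))).aemeasurable).symm
      _ ≤ ∫⁻ _, ENNReal.ofReal (realBregman Θ ξ₀ z x₀ / c) ∂P := lintegral_mono hpt
      _ = _ := by simp
  by_contra hcon
  rw [not_lt, top_le_iff] at hcon
  have : ∫⁻ ω, ∑' n, f n ω ∂P = ⊤ := hcon
  rw [this, ENNReal.mul_top hp0, top_le_iff] at hle
  exact ENNReal.ofReal_ne_top hle

end RandomIteration

/-! ### The random limit -/

section Limit

variable {X : Type*} [NormedAddCommGroup X] [InnerProductSpace ℝ X] [CompleteSpace X]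
  {N : ℕ} {Y : Fin N → Type*} [∀ i, NormedAddCommGroup (Y i)] [∀ i, NormedSpace ℝ (Y i)]
  {Θ : X → EReal} {domF : Fin N → Set X} {F : ∀ i, X → Y i}
  {L : ∀ i, X → X →L[ℝ] Y i} {y : ∀ i, Y i} {x₀ ξ₀ : X} {ρ B₀ : ℝ} {q : Params}
  {Ω : Type*} [MeasurableSpace Ω] {P : Measure Ω} {b : ℕ} {I : ℕ → Ω → Finset (Fin N)}

/-- With exact data the method converges almost surely to a random solution, which has an
integrable Bregman distance to the initial guess. Off the event of convergence, the random
solution is set to a fixed one. -/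
theorem Setting.exists_random_limit (S : Setting Θ domF F L y x₀ ξ₀ ρ B₀ q)
    [IsProbabilityMeasure P] (hI : IsUniformBatchSequence P b I) (hb : 1 ≤ b) (hbN : b ≤ N) :
    ∃ xstar : Ω → X, StronglyMeasurable xstar ∧
      (∀ ω, xstar ω ∈ localSolutions Θ domF F y x₀ ρ) ∧
      (∀ᵐ ω ∂P,
        Tendsto (fun n => (iter q Θ F L x₀ ξ₀ y 0 (fun k => I k ω) n).x) atTop (𝓝 (xstar ω)) ∧
        Tendsto (fun n => realBregman Θ (iter q Θ F L x₀ ξ₀ y 0 (fun k => I k ω) n).ξ (xstar ω)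
          (iter q Θ F L x₀ ξ₀ y 0 (fun k => I k ω) n).x) atTop (𝓝 0)) ∧
      ∃ B : Ω → ℝ, Integrable B P ∧ ∀ᵐ ω ∂P, realBregman Θ ξ₀ (xstar ω) x₀ ≤ B ω := by
  obtain ⟨z, hz, -⟩ := S.exists_near_solution
  let h : Fin N → State X N → ENNReal := fun i s => ENNReal.ofReal (‖F i s.x - y i‖ ^ 2)
  let s : ℕ → Ω → State X N := fun n ω => iter q Θ F L x₀ ξ₀ y 0 (fun k => I k ω) n
  let Q : Fin N → Ω → ENNReal := fun i ω => ∑' n, h i (s n ω)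
  have hQm : ∀ i, Measurable (Q i) := fun i =>
    Measurable.tsum fun n => (stronglyMeasurable_iter hI n (h i)).measurable
  have hQint : ∀ i, ∫⁻ ω, Q i ω ∂P ≠ ⊤ := fun i =>
    (S.lintegral_tsum_residual_lt_top hI hb hbN i).ne
  let G : Set Ω := {ω | ∀ i, Q i ω < ⊤}
  have hGm : MeasurableSet G := by
    have : G = ⋂ i, {ω | Q i ω < ⊤} := by
      ext ω
      simp [G]
    rw [this]
    exact MeasurableSet.iInter fun i => measurableSet_lt (hQm i) measurable_const
  have hGae : ∀ᵐ ω ∂P, ω ∈ G := by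
    have : ∀ᵐ ω ∂P, ∀ i, Q i ω < ⊤ :=
      ae_all_iff.2 fun i => ae_lt_top (hQm i) (hQint i)
    exact this
  have hQreal : ∀ i ω, (Q i ω).toReal = ∑' n, ‖F i (s n ω).x - y i‖ ^ 2 := by
    intro i ω
    rw [ENNReal.tsum_toReal_eq fun n => ENNReal.ofReal_ne_top]
    exact tsum_congr fun n => ENNReal.toReal_ofReal (sq_nonneg _)
  have hsum : ∀ ω ∈ G, ∀ i, Summable fun n => ‖F i (s n ω).x - y i‖ ^ 2 := by
    intro ω hω i
    refine (ENNReal.summable_toReal (hω i).ne).congr fun n => ?_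
    exact ENNReal.toReal_ofReal (sq_nonneg _)
  let B : Ω → ℝ := fun ω => realBregman Θ ξ₀ z x₀ + q.μ₁ * N ^ 2 * (3 * (1 + q.η))
    * (2 * N * ∑ i, (Q i ω).toReal + 2 * ∑' n : ℕ, (1 / 4 : ℝ) ^ n) / (1 - q.β)
  have hex : ∀ ω, ∃ p ∈ localSolutions Θ domF F y x₀ ρ, (ω ∉ G → p = z) ∧ (ω ∈ G →
      Tendsto (fun n => (s n ω).x) atTop (𝓝 p) ∧
      Tendsto (fun n => realBregman Θ (s n ω).ξ p (s n ω).x) atTop (𝓝 0) ∧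
      realBregman Θ ξ₀ p x₀ ≤ B ω) := by
    intro ω
    by_cases hω : ω ∈ G
    · obtain ⟨p, hp, h1, h2, h3⟩ := S.exists_limit_of_summable_sq (hsum ω hω) hz
      refine ⟨p, hp, fun hc => absurd hω hc, fun _ => ⟨h1, h2, ?_⟩⟩
      simp only [B, hQreal]
      exact h3
    · exact ⟨z, hz, fun _ => rfl, fun hc => absurd hc hω⟩
  choose xs hxs hxz hxG using hex
  refine ⟨xs, ?_, hxs, hGae.mono fun ω hω => ⟨(hxG ω hω).1, (hxG ω hω).2.1⟩, B, ?_,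
    hGae.mono fun ω hω => (hxG ω hω).2.2⟩
  · classical
    refine stronglyMeasurable_of_tendsto atTop
      (f := fun n => G.piecewise (fun ω => (s n ω).x) fun _ => z)
      (fun n => StronglyMeasurable.piecewise hGm
        (stronglyMeasurable_iter hI n fun s => s.x) stronglyMeasurable_const)
      (tendsto_pi_nhds.2 fun ω => ?_)
    by_cases hω : ω ∈ G
    · simpa only [Set.piecewise_eq_of_mem _ _ _ hω] using (hxG ω hω).1
    · simp only [Set.piecewise_eq_of_notMem _ _ _ hω, hxz ω hω]
      exact tendsto_const_nhds
  · have hsumint : Integrable (fun ω => ∑ i, (Q i ω).toReal) P :=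
      integrable_finsetSum _ fun i _ =>
        integrable_toReal_of_lintegral_ne_top (hQm i).aemeasurable (hQint i)
    exact (integrable_const _).add
      ((((hsumint.const_mul _).add (integrable_const _)).const_mul _).div_const _)

end Limit

end MinibatchSHB

end

theorem mainTheorem4
    {X : Type*} [NormedAddCommGroup X] [InnerProductSpace ℝ X] [CompleteSpace X]
    {N : ℕ} {Y : Fin N → Type*} [∀ i, NormedAddCommGroup (Y i)] [∀ i, NormedSpace ℝ (Y i)]
    [∀ i, CompleteSpace (Y i)]
    {Ω : Type*} [MeasurableSpace Ω] (P : Measure Ω) [IsProbabilityMeasure P]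
    -- the system, the regularizer and the initial guess
    (Θ : X → EReal) (domF : Fin N → Set X) (F : ∀ i, X → Y i)
    (L : ∀ i, X → X →L[ℝ] Y i) (y : ∀ i, Y i) (x₀ ξ₀ : X) (ρ B₀ : ℝ)
    -- the parameters of the method
    (q : MinibatchSHB.Params) (b : ℕ)
    (hinit : (x₀, ξ₀) ∈ MinibatchSHB.subdiffGraph Θ)
    (hΘ : MinibatchSHB.RegularizerAssumption Θ q.σ)
    (hF : MinibatchSHB.OperatorAssumption Θ domF F L y x₀ ξ₀ q.σ ρ B₀ q.η)
    (hr : 1 < q.r) (hμ₀ : 0 < q.μ₀) (hμ₀σ : q.μ₀ < 4 * q.σ) (hμ₁ : 0 < q.μ₁)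
    (hυ₀ : 0 < q.υ₀) (hυ₁ : 0 < q.υ₁) (hβ : 0 ≤ q.β) (hβ1 : q.β < 1)
    (hτ : (1 + q.η) / (1 - q.η) < q.τ) (hb : 1 ≤ b) (hbN : b ≤ N)
    -- the random batches
    (I : ℕ → Ω → Finset (Fin N)) (hI : MinibatchSHB.IsUniformBatchSequence P b I)
    -- the sequence of noisy data
    (yδ : ℕ → ∀ i, Y i) (δ : ℕ → Fin N → ℝ)
    (hδ : ∀ l i, 0 < δ l i) (hy : ∀ l i, ‖yδ l i - y i‖ ≤ δ l i)
    (hδ0 : Tendsto (fun l => ⨆ i, δ l i) atTop (𝓝 0)) :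
    (∃! xdag, MinibatchSHB.IsMinimalDistanceSolution Θ domF F y x₀ ξ₀ xdag) ∧
    (∀ l, ∀ᵐ ω ∂P,
      MinibatchSHB.Terminates q Θ F L x₀ ξ₀ (yδ l) (δ l) (fun n => I n ω)) ∧
    ∃ xstar : Ω → X, StronglyMeasurable xstar ∧
      (∀ ω, xstar ω ∈ Metric.closedBall x₀ (2 * ρ) ∩ MinibatchSHB.effDomain Θ ∩
        MinibatchSHB.solutionSet domF F y) ∧
      (∀ᵐ ω ∂P,
        Tendsto (fun l =>
            ‖(MinibatchSHB.output q Θ F L x₀ ξ₀ (yδ l) (δ l) (fun n => I n ω)).x - xstar ω‖)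
          atTop (𝓝 0) ∧
        Tendsto (fun l =>
            MinibatchSHB.bregman Θ
              (MinibatchSHB.output q Θ F L x₀ ξ₀ (yδ l) (δ l) (fun n => I n ω)).ξ (xstar ω)
              (MinibatchSHB.output q Θ F L x₀ ξ₀ (yδ l) (δ l) (fun n => I n ω)).x)
          atTop (𝓝 0)) ∧
      (∀ l, Integrable (fun ω =>
        ‖(MinibatchSHB.output q Θ F L x₀ ξ₀ (yδ l) (δ l) (fun n => I n ω)).x - xstar ω‖ ^ 2)
        P) ∧
      Tendsto (fun l => ∫ ω,
          ‖(MinibatchSHB.output q Θ F L x₀ ξ₀ (yδ l) (δ l) (fun n => I n ω)).x - xstar ω‖ ^ 2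
          ∂P)
        atTop (𝓝 0) ∧
      -- the Bregman distances are finite, so that `toReal` loses nothing
      (∀ l ω, MinibatchSHB.bregman Θ
          (MinibatchSHB.output q Θ F L x₀ ξ₀ (yδ l) (δ l) (fun n => I n ω)).ξ (xstar ω)
          (MinibatchSHB.output q Θ F L x₀ ξ₀ (yδ l) (δ l) (fun n => I n ω)).x ∉
        ({⊥, ⊤} : Set EReal)) ∧
      (∀ l, Integrable (fun ω =>
        (MinibatchSHB.bregman Θ
          (MinibatchSHB.output q Θ F L x₀ ξ₀ (yδ l) (δ l) (fun n => I n ω)).ξ (xstar ω)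
          (MinibatchSHB.output q Θ F L x₀ ξ₀ (yδ l) (δ l) (fun n => I n ω)).x).toReal) P) ∧
      Tendsto (fun l => ∫ ω,
          (MinibatchSHB.bregman Θ
            (MinibatchSHB.output q Θ F L x₀ ξ₀ (yδ l) (δ l) (fun n => I n ω)).ξ (xstar ω)
            (MinibatchSHB.output q Θ F L x₀ ξ₀ (yδ l) (δ l) (fun n => I n ω)).x).toReal ∂P)
        atTop (𝓝 0) ∧
      (∀ xdag, MinibatchSHB.IsMinimalDistanceSolution Θ domF F y x₀ ξ₀ xdag →
        (∀ i, ∀ x ∈ Metric.closedBall x₀ (2 * ρ),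
          Set.range (MinibatchSHB.adjointMap (L i x)) ⊆
            closure (Set.range (MinibatchSHB.adjointMap (L i xdag)))) →
        ∀ᵐ ω ∂P, xstar ω = xdag) := by
  have hN : 0 < N := by omega
  have S : MinibatchSHB.Setting Θ domF F L y x₀ ξ₀ ρ B₀ q :=
    ⟨hinit, hΘ, hF, hr, hμ₀, hμ₀σ, hμ₁, hυ₀, hυ₁, hβ, hβ1, hτ, hN⟩
  have hd : ∀ l, MinibatchSHB.IsNoisyData y (yδ l) (δ l) := fun l =>
    ⟨fun i => (hδ l i).le, hy l⟩
  have hδi : ∀ i, Tendsto (fun l => δ l i) atTop (𝓝 0) := fun i =>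
    squeeze_zero (fun l => (hδ l i).le)
      (fun l => le_ciSup (Set.finite_range (δ l)).bddAbove i) hδ0
  have hio := hI.ae_frequently_mem hb hbN
  have hterm : ∀ᵐ ω ∂P, ∀ l,
      MinibatchSHB.Terminates q Θ F L x₀ ξ₀ (yδ l) (δ l) (fun n => I n ω) := by
    filter_upwards [hio] with ω hω l
    exact S.terminates (hd l) (hδ l) hω
  refine ⟨S.existsUnique_minimalDistanceSolution, ae_all_iff.1 hterm, ?_⟩
  obtain ⟨xs, hxm, hxs, hlim, B, hB, hxB⟩ := S.exists_random_limit hI hb hbN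
  let out : ℕ → Ω → MinibatchSHB.State X N := fun l ω =>
    MinibatchSHB.output q Θ F L x₀ ξ₀ (yδ l) (δ l) (fun n => I n ω)
  have hadm : ∀ l ω, MinibatchSHB.Admissible Θ domF F y x₀ ξ₀ ρ (out l ω) := fun l ω =>
    S.iter_admissible (hd l) _
  have hgraph := fun l ω => S.mem_subdiffGraph (hadm l ω)
  let D : ℕ → Ω → ℝ := fun l ω =>
    MinibatchSHB.realBregman Θ (out l ω).ξ (xs ω) (out l ω).x
  have hDcoe : ∀ l ω, MinibatchSHB.bregman Θ (out l ω).ξ (xs ω) (out l ω).x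
      = ((D l ω : ℝ) : EReal) := fun l ω =>
    MinibatchSHB.bregman_eq_coe hΘ.proper _ (hxs ω).1.2 (hgraph l ω).1
  have hσ := S.sigma_pos
  have hD0 : ∀ l ω, 0 ≤ D l ω := fun l ω =>
    MinibatchSHB.realBregman_nonneg hΘ (hgraph l ω) (hxs ω).1.2
  have hnormsq : ∀ l ω, ‖(out l ω).x - xs ω‖ ^ 2 ≤ D l ω / q.σ := by
    intro l ω
    rw [le_div_iff₀ hσ, mul_comm, norm_sub_rev]
    exact MinibatchSHB.realBregman_ge hΘ (hgraph l ω) (hxs ω).1.2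
  have hDlim : ∀ᵐ ω ∂P, Tendsto (fun l => D l ω) atTop (𝓝 0) := by
    filter_upwards [hterm, hlim] with ω h1 h2
    exact S.tendsto_output_bregman hd hδi h1 (hxs ω) h2.1 h2.2
  have hnormlim : ∀ᵐ ω ∂P, Tendsto (fun l => ‖(out l ω).x - xs ω‖) atTop (𝓝 0) := by
    filter_upwards [hDlim] with ω hω
    have h1 : Tendsto (fun l => ‖(out l ω).x - xs ω‖ ^ 2) atTop (𝓝 0) :=
      squeeze_zero (fun _ => sq_nonneg _) (fun l => hnormsq l ω) (by simpa using hω.div_const q.σ)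
    have h2 := h1.sqrt
    rw [Real.sqrt_zero] at h2
    exact h2.congr fun l => Real.sqrt_sq (norm_nonneg _)
  have hxout : ∀ l, StronglyMeasurable fun ω => (out l ω).x := fun l =>
    MinibatchSHB.stronglyMeasurable_output hI fun s => s.x
  have hDm : ∀ l, StronglyMeasurable (D l) := by
    intro l
    borelize X
    have h1 : StronglyMeasurable fun ω => (Θ (xs ω)).toReal :=
      (hΘ.lsc.measurable.comp hxm.measurable).ereal_toReal.stronglyMeasurable
    have h2 : StronglyMeasurable fun ω => (Θ (out l ω).x).toReal :=
      MinibatchSHB.stronglyMeasurable_output hI fun s => (Θ s.x).toReal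
    have h3 : StronglyMeasurable fun ω => (out l ω).ξ :=
      MinibatchSHB.stronglyMeasurable_output hI fun s => s.ξ
    exact (h1.sub h2).sub (h3.inner (hxm.sub (hxout l)))
  have hDB : ∀ l, ∀ᵐ ω ∂P, ‖D l ω‖ ≤ B ω := by
    intro l
    filter_upwards [hxB] with ω hω
    rw [Real.norm_of_nonneg (hD0 l ω)]
    exact ((hadm l ω).bregman_le _ (hxs ω)).trans hω
  have hDint : ∀ l, Integrable (D l) P := fun l =>
    hB.mono' (hDm l).aestronglyMeasurable (hDB l)
  have hDintlim : Tendsto (fun l => ∫ ω, D l ω ∂P) atTop (𝓝 0) := by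
    have := tendsto_integral_of_dominated_convergence B
      (fun l => (hDm l).aestronglyMeasurable) hB hDB hDlim
    rwa [integral_zero] at this
  have hNint : ∀ l, Integrable (fun ω => ‖(out l ω).x - xs ω‖ ^ 2) P := fun l =>
    ((hDint l).div_const q.σ).mono'
      (((hxout l).sub hxm).norm.pow 2).aestronglyMeasurable
      (Eventually.of_forall fun ω => by
        rw [Real.norm_of_nonneg (sq_nonneg _)]
        exact hnormsq l ω)
  refine ⟨xs, hxm, hxs, ?_, hNint, ?_, ?_, ?_, ?_, ?_⟩
  · filter_upwards [hnormlim, hDlim] with ω h1 h2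
    refine ⟨h1, ?_⟩
    have h3 := (continuous_coe_real_ereal.tendsto 0).comp h2
    exact h3.congr fun l => (hDcoe l ω).symm
  · refine squeeze_zero (fun l => integral_nonneg fun ω => sq_nonneg _)
      (fun l => integral_mono (hNint l) ((hDint l).div_const q.σ) (hnormsq l)) ?_
    simp only [integral_div]
    simpa using hDintlim.div_const q.σ
  · intro l ω
    change MinibatchSHB.bregman Θ (out l ω).ξ (xs ω) (out l ω).x ∉ _
    rw [hDcoe]
    simp
  · intro l
    refine (hDint l).congr (Eventually.of_forall fun ω => ?_)
    change D l ω = (MinibatchSHB.bregman Θ (out l ω).ξ (xs ω) (out l ω).x).toReal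
    rw [hDcoe, EReal.toReal_coe]
  · refine hDintlim.congr fun l => integral_congr_ae (Eventually.of_forall fun ω => ?_)
    change D l ω = (MinibatchSHB.bregman Θ (out l ω).ξ (xs ω) (out l ω).x).toReal
    rw [hDcoe, EReal.toReal_coe]
  · intro xdag hdag hran
    filter_upwards [hlim] with ω hω
    exact S.eq_minimalDistanceSolution_of_range (hxs ω) hω.1 hω.2 hdag hran
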